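/- Let $k$ be a field with algebraic closure $\bar k$. A curve over $k$ is a proper, smooth, geometrically irreducible $k$-scheme of dimension $1$. Let $C$ be a curve over $k$ and let $(D,\pi_1,\pi_2)$ be a self-correspondence on $C$: $D$ is a noetherian reduced $k$-scheme whose connected components $D_i$ are curves over $k$, and $\pi_1,\pi_2:D\to C$ are $k$-morphisms whose restrictions to each $D_i$ are non-constant and separable. Put $d_j=\deg \pi_j=\sum_i \deg(\pi_j|_{D_i})$, let $g_C$ be the genus of $C$ and let $g_D$ be the sum of the genera of the $D_i$. For $z\in D(\bar k)$ let $e_{j,z}$ be the ramification index at $z$ of $\pi_j$ (over $\bar k$). A subset $S\subseteq C(\bar k)$ is forward-complete if $\pi_1^{-1}(S)\subseteq\pi_2^{-1}(S)$, backward-complete if $\pi_2^{-1}(S)\subseteq\pi_1^{-1}(S)$ (preimages in $D(\bar k)$), and complete if it is both. It is ramification-decreasing (resp. equiramified, resp. étale) if $e_{1,z}\ge e_{2,z}$ (resp. $e_{1,z}=e_{2,z}$, resp. $e_{1,z}=e_{2,z}=1$) for all $z\in D(\bar k)$ with $\pi_1(z)\in S$ and $\pi_2(z)\in S$. 1. If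 $d_1<d_2$, every finite backward-complete set $S\subseteq C(\bar k)$ satisfies $$|S|\le 2\,\frac{g_D-d_2g_C+d_2-1}{d_2-d_1},$$ and if such an $S$ is moreover ramification-decreasing, then $S=\emptyset$. 2. If $d_1\le d_2$, every finite, backward-complete, ramification-decreasing set $S\subseteq C(\bar k)$ is complete and equiramified. Moreover (for arbitrary $d_1,d_2$), if there is a finite non-empty complete equiramified set $S\subseteq C(\bar k)$, then $d_1=d_2$. 3. If $d_1\neq d_2$ and $d=\max(d_1,d_2)$, then every finite complete set $S\subseteq C(\bar k)$ satisfies $$|S|\le 2\,\frac{g_D-dg_C+d-1}{|d_2-d_1|},$$ and if $S$ is non-empty, then $S$ is not equiramified, in particular not étale. -/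

import Mathlib

open CategoryTheory CategoryTheory.Limits AlgebraicGeometry TopologicalSpace

universe u

noncomputable section

namespace CurveCorr

/-! ### Curves and their genus -/

/-- A curve over a field `k`: a proper, smooth, geometrically irreducible `k`-scheme of
dimension `1`. -/
class IsCurve {k : Type u} [Field k] {X : Scheme.{u}} (f : X ⟶ Spec (.of k)) : Prop where
  isProper : IsProper f
  smooth : SmoothOfRelativeDimension 1 f
  geometricallyIrreducible : GeometricallyIrreducible f

lemma IsCurve.irreducibleSpace {k : Type u} [Field k] {X : Scheme.{u}} (f : X ⟶ Spec (.of k))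
    [h : IsCurve f] : IrreducibleSpace X :=
  haveI := h.geometricallyIrreducible
  GeometricallyIrreducible.irreducibleSpace_of_subsingleton f

section Genus

variable {k : Type u} [Field k] {X : Scheme.{u}} (f : X ⟶ Spec (.of k))

/-- The structure map of the stalk of a `k`-scheme at `x`. -/
def toStalk (x : X) : k →+* X.presheaf.stalk x :=
  (X.presheaf.germ ⊤ x (Opens.mem_top x)).hom.comp
    ((Scheme.Hom.appTop f).hom.comp (Scheme.ΓSpecIso (.of k)).inv.hom)

variable [IrreducibleSpace X]

/-- The function field of a `k`-scheme as a `k`-algebra. -/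
@[reducible] def functionFieldAlgebra : Algebra k X.functionField :=
  (toStalk f (genericPoint X)).toAlgebra

lemma algebraMap_toStalk (x : X) (a : k) :
    algebraMap (X.presheaf.stalk x) X.functionField (toStalk f x a) =
      toStalk f (genericPoint X) a := by
  simp only [toStalk, RingHom.comp_apply, RingHom.algebraMap_toAlgebra]
  rw [← CommRingCat.comp_apply, TopCat.Presheaf.germ_stalkSpecializes]

/-- The local ring `𝒪_{X,x}` as a `k`-subspace of the function field. -/
def localSubspace (x : X) :
    letI := functionFieldAlgebra f
    Submodule k X.functionField :=
  letI := functionFieldAlgebra f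
  { carrier := Set.range (algebraMap (X.presheaf.stalk x) X.functionField)
    add_mem' := by
      rintro _ _ ⟨a, rfl⟩ ⟨b, rfl⟩
      exact ⟨a + b, map_add _ _ _⟩
    zero_mem' := ⟨0, map_zero _⟩
    smul_mem' := by
      rintro c _ ⟨a, rfl⟩
      refine ⟨toStalk f x c * a, ?_⟩
      rw [map_mul, algebraMap_toStalk, Algebra.smul_def]
      rfl }

/-- Repartitions on `X`: families of rational functions indexed by the closed points of `X`,
all but finitely many members of which are regular at the corresponding point. -/
def repartitions :
    letI := functionFieldAlgebra f
    Submodule k (closedPoints X → X.functionField) :=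
  letI := functionFieldAlgebra f
  { carrier := {r | {x : closedPoints X | r x ∉ localSubspace f x}.Finite}
    add_mem' := by
      intro r s hr hs
      refine (hr.union hs).subset fun x hx => ?_
      by_contra h
      simp only [Set.mem_union, Set.mem_ofPred_eq, not_or, not_not] at h
      exact hx (Submodule.add_mem _ h.1 h.2)
    zero_mem' := by
      simp
    smul_mem' := by
      intro c r hr
      exact hr.subset fun x hx h => hx (Submodule.smul_mem _ c h) }

/-- Families of rational functions, each regular at its point. -/
def regularRepartitions :
    letI := functionFieldAlgebra f
    Submodule k (closedPoints X → X.functionField) :=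
  letI := functionFieldAlgebra f
  Submodule.pi Set.univ fun x => localSubspace f x

/-- Constant families of rational functions. -/
def constantRepartitions :
    letI := functionFieldAlgebra f
    Submodule k (closedPoints X → X.functionField) :=
  letI := functionFieldAlgebra f
  LinearMap.range (LinearMap.pi fun _ : closedPoints X =>
    (LinearMap.id : X.functionField →ₗ[k] X.functionField))

/-- `H¹(X, 𝒪_X)` of a curve `X` over `k`, as the space `R / (R(0) + k(X))` of repartitions modulo
the regular and the constant ones. This is the cokernel of `k(X) → ⨁ₓ k(X) / 𝒪_{X,x}`, that is
the first cohomology of the flasque resolution of `𝒪_X` by rational functions and principal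
parts. -/
abbrev H1 : Type u :=
  letI := functionFieldAlgebra f
  repartitions f ⧸
    (regularRepartitions f ⊔ constantRepartitions f).comap (repartitions f).subtype

/-- `dim_k H¹(X, 𝒪_X)`. -/
def genusOver : ℕ :=
  letI := functionFieldAlgebra f
  Module.finrank k (H1 f)

end Genus

section BaseChange

variable {k : Type u} [Field k] (K : Type u) [Field K] [Algebra k K]

/-- `Spec K ⟶ Spec k`. -/
abbrev specMap (k : Type u) [Field k] (K : Type u) [Field K] [Algebra k K] :
    Spec (.of K) ⟶ Spec (.of k) :=
  Spec.map (CommRingCat.ofHom (algebraMap k K))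

/-- The base change `X_K` of a `k`-scheme. -/
abbrev baseChange {X : Scheme.{u}} (f : X ⟶ Spec (.of k)) : Scheme.{u} :=
  pullback f (specMap k K)

/-- The structure morphism of `X_K`. -/
abbrev baseChangeHom {X : Scheme.{u}} (f : X ⟶ Spec (.of k)) :
    baseChange K f ⟶ Spec (.of K) :=
  pullback.snd f (specMap k K)

/-- The base change `π_K : X_K ⟶ Y_K` of a `k`-morphism. -/
abbrev baseChangeMap {X Y : Scheme.{u}} (f : X ⟶ Spec (.of k)) (g : Y ⟶ Spec (.of k))
    (π : X ⟶ Y) (hπ : π ≫ g = f) : baseChange K f ⟶ baseChange K g :=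
  pullback.lift (pullback.fst f (specMap k K) ≫ π) (pullback.snd f (specMap k K))
    (by rw [Category.assoc, hπ, pullback.condition])

/-- The genus of a curve `X` over `k`, `K` being an algebraic closure of `k`: the dimension of
`H¹(X_K, 𝒪)` over `K`. -/
def genus {X : Scheme.{u}} (f : X ⟶ Spec (.of k)) [h : IsCurve f] : ℕ :=
  haveI := h.geometricallyIrreducible
  haveI : IrreducibleSpace (baseChange K f) :=
    GeometricallyIrreducible.irreducibleSpace_of_subsingleton (baseChangeHom K f)
  genusOver (baseChangeHom K f)

/-- The set `X(K)` of `K`-points of a `k`-scheme. -/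
abbrev Pt {X : Scheme.{u}} (f : X ⟶ Spec (.of k)) : Type u :=
  {z : Spec (.of K) ⟶ X // z ≫ f = specMap k K}

variable {K}

/-- The map `X(K) → Y(K)` given by a `k`-morphism. -/
def Pt.map {X Y : Scheme.{u}} {f : X ⟶ Spec (.of k)} {g : Y ⟶ Spec (.of k)}
    (π : X ⟶ Y) (hπ : π ≫ g = f) (z : Pt K f) : Pt K g :=
  ⟨z.1 ≫ π, by rw [Category.assoc, hπ, z.2]⟩

/-- The point of the scheme `X_K` given by a `K`-point of `X`. -/
def Pt.geom {X : Scheme.{u}} {f : X ⟶ Spec (.of k)} (z : Pt K f) : baseChange K f :=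
  pullback.lift (f := f) (g := specMap k K) z.1 (𝟙 _) (by rw [z.2, Category.id_comp])
    (IsLocalRing.closedPoint K)

/-- The ramification index at a point `x` of a morphism of schemes: the largest `n` such that the
maximal ideal of `π x` generates an ideal of `𝒪_{X,x}` contained in the `n`-th power of the
maximal ideal. -/
def ramIdx {X Y : Scheme.{u}} (π : X ⟶ Y) (x : X) : ℕ :=
  letI : Algebra (Y.presheaf.stalk (π x)) (X.presheaf.stalk x) := (π.stalkMap x).hom.toAlgebra
  Ideal.ramificationIdx' (IsLocalRing.maximalIdeal (Y.presheaf.stalk (π x)))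
    (IsLocalRing.maximalIdeal (X.presheaf.stalk x))

/-- The ramification index of `π` at `z ∈ X(K)`: that of `π_K : X_K ⟶ Y_K` at `z`. -/
def Pt.ramIdx {X Y : Scheme.{u}} {f : X ⟶ Spec (.of k)} {g : Y ⟶ Spec (.of k)}
    (π : X ⟶ Y) (hπ : π ≫ g = f) (z : Pt K f) : ℕ :=
  CurveCorr.ramIdx (baseChangeMap K f g π hπ) z.geom

end BaseChange

/-! ### Degree and separability -/

section Degree

variable {X Y : Scheme.{u}} (π : X ⟶ Y) [IrreducibleSpace X]

/-- The extension of function fields given by a non-constant morphism of curves. (Such a morphism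
sends the generic point to the generic point.) -/
@[reducible] def functionFieldExt :
    Algebra (Y.presheaf.stalk (π (genericPoint X))) X.functionField :=
  (π.stalkMap (genericPoint X)).hom.toAlgebra

/-- The degree `[k(X) : k(Y)]` of a non-constant morphism of curves. -/
def degree : ℕ :=
  letI := functionFieldExt π
  Module.finrank (Y.presheaf.stalk (π (genericPoint X))) X.functionField

/-- `k(X)` is separable over `k(Y)`. -/
def IsSeparableMap : Prop :=
  letI := functionFieldExt π
  Algebra.IsSeparable (Y.presheaf.stalk (π (genericPoint X))) X.functionField

/-- The morphism does not map all of `X` to one point. -/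
def IsNonconstant {X Y : Scheme.{u}} (π : X ⟶ Y) : Prop := ¬ ∃ y : Y, ∀ x : X, π x = y

end Degree

/-! ### Self-correspondences -/

lemma isOpen_connectedComponent_of_noetherian (D : Scheme.{u}) [IsNoetherian D] (x : D) :
    IsOpen (connectedComponent x) := by
  have hfin : (irreducibleComponents D).Finite := NoetherianSpace.finite_irreducibleComponents
  have key : (connectedComponent x)ᶜ =
      ⋃ Z ∈ {Z ∈ irreducibleComponents D | Disjoint Z (connectedComponent x)}, Z := by
    ext y
    simp only [Set.mem_compl_iff, Set.mem_iUnion, Set.mem_ofPred_eq, exists_prop]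
    constructor
    · intro hy
      refine ⟨irreducibleComponent y, ⟨irreducibleComponent_mem_irreducibleComponents y, ?_⟩,
        mem_irreducibleComponent⟩
      rw [Set.disjoint_left]
      intro z hz hzx
      have h1 : irreducibleComponent y ⊆ connectedComponent y :=
        isIrreducible_irreducibleComponent.isConnected.isPreconnected.subset_connectedComponent
          mem_irreducibleComponent
      have h2 := connectedComponent_eq (h1 hz)
      have h3 := connectedComponent_eq hzx
      rw [h3, ← h2] at hy
      exact hy mem_connectedComponent
    · rintro ⟨Z, ⟨_, hZ⟩, hy⟩ hyx
      exact Set.disjoint_left.mp hZ hy hyx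
  rw [← isClosed_compl_iff, key]
  exact (hfin.subset fun Z hZ => hZ.1).isClosed_biUnion
    fun Z hZ => isClosed_of_mem_irreducibleComponents Z hZ.1

/-- A connected component of a noetherian scheme, as an open subscheme. -/
def component (D : Scheme.{u}) [IsNoetherian D] (c : _root_.ConnectedComponents D) : D.Opens where
  carrier := _root_.ConnectedComponents.mk ⁻¹' {c}
  is_open' := by
    obtain ⟨x, rfl⟩ := _root_.ConnectedComponents.surjective_coe c
    rw [connectedComponents_preimage_singleton]
    exact isOpen_connectedComponent_of_noetherian D x

/-- A self-correspondence on a curve `C` over `k`: a noetherian reduced `k`-scheme `D` whose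
connected components are curves over `k`, with two `k`-morphisms `D ⟶ C` which are non-constant
and separable on every connected component. -/
structure SelfCorrespondence {k : Type u} [Field k] {C : Scheme.{u}} (f : C ⟶ Spec (.of k)) where
  /-- the scheme `D` -/
  D : Scheme.{u}
  /-- its structure morphism -/
  str : D ⟶ Spec (.of k)
  isNoetherian : IsNoetherian D
  isReduced : IsReduced D
  isCurve : ∀ c : _root_.ConnectedComponents D, IsCurve ((component D c).ι ≫ str)
  /-- the first morphism -/
  π₁ : D ⟶ C
  /-- the second morphism -/
  π₂ : D ⟶ C
  π₁_comp : π₁ ≫ f = str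
  π₂_comp : π₂ ≫ f = str
  nonconstant₁ : ∀ c : _root_.ConnectedComponents D, IsNonconstant ((component D c).ι ≫ π₁)
  nonconstant₂ : ∀ c : _root_.ConnectedComponents D, IsNonconstant ((component D c).ι ≫ π₂)
  separable₁ : ∀ c : _root_.ConnectedComponents D,
    haveI := (isCurve c).irreducibleSpace
    IsSeparableMap ((component D c).ι ≫ π₁)
  separable₂ : ∀ c : _root_.ConnectedComponents D,
    haveI := (isCurve c).irreducibleSpace
    IsSeparableMap ((component D c).ι ≫ π₂)

namespace SelfCorrespondence

variable {k : Type u} [Field k] {C : Scheme.{u}} {f : C ⟶ Spec (.of k)}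
  (T : SelfCorrespondence f)

attribute [instance] SelfCorrespondence.isNoetherian SelfCorrespondence.isCurve

/-- `deg π₁`, the sum of the degrees of `π₁` on the (finitely many) connected components. -/
def d₁ : ℕ :=
  ∑ᶠ c : _root_.ConnectedComponents T.D,
    haveI := (T.isCurve c).irreducibleSpace
    degree ((component T.D c).ι ≫ T.π₁)

/-- `deg π₂`, the sum of the degrees of `π₂` on the (finitely many) connected components. -/
def d₂ : ℕ :=
  ∑ᶠ c : _root_.ConnectedComponents T.D,
    haveI := (T.isCurve c).irreducibleSpace
    degree ((component T.D c).ι ≫ T.π₂)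

variable (K : Type u) [Field K] [Algebra k K]

/-- The genus of `D`: the sum of the genera of its connected components. -/
def genusD : ℕ :=
  ∑ᶠ c : _root_.ConnectedComponents T.D, genus K ((component T.D c).ι ≫ T.str)

variable {K}

/-- `π₁` on `K`-points. -/
def source (z : Pt K T.str) : Pt K f := z.map T.π₁ T.π₁_comp

/-- `π₂` on `K`-points. -/
def target (z : Pt K T.str) : Pt K f := z.map T.π₂ T.π₂_comp

/-- `e_{1,z}`. -/
def e₁ (z : Pt K T.str) : ℕ := z.ramIdx T.π₁ T.π₁_comp

/-- `e_{2,z}`. -/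
def e₂ (z : Pt K T.str) : ℕ := z.ramIdx T.π₂ T.π₂_comp

variable (S : Set (Pt K f))

/-- `π₁⁻¹(S) ⊆ π₂⁻¹(S)`. -/
def ForwardComplete : Prop := T.source ⁻¹' S ⊆ T.target ⁻¹' S

/-- `π₂⁻¹(S) ⊆ π₁⁻¹(S)`. -/
def BackwardComplete : Prop := T.target ⁻¹' S ⊆ T.source ⁻¹' S

/-- `S` is forward-complete and backward-complete. -/
def Complete : Prop := T.ForwardComplete S ∧ T.BackwardComplete S

/-- `e_{1,z} ≥ e_{2,z}` for every `z` with source and target in `S`. -/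
def RamificationDecreasing : Prop :=
  ∀ z : Pt K T.str, T.source z ∈ S → T.target z ∈ S → T.e₂ z ≤ T.e₁ z

/-- `e_{1,z} = e_{2,z}` for every `z` with source and target in `S`. -/
def Equiramified : Prop :=
  ∀ z : Pt K T.str, T.source z ∈ S → T.target z ∈ S → T.e₁ z = T.e₂ z

/-- `e_{1,z} = e_{2,z} = 1` for every `z` with source and target in `S`. -/
def Etale : Prop :=
  ∀ z : Pt K T.str, T.source z ∈ S → T.target z ∈ S → T.e₁ z = 1 ∧ T.e₂ z = 1

end SelfCorrespondence

end CurveCorr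

end

/-!
The key is the Riemann–Hurwitz inequality for a finite separable extension `F / E` of function
fields of curves, also when the ramification is wild. The cohomology of a family of
lattices, one for each place, is expressed through its global elements and through repartitions
modulo regular ones. For a family of lattices in the `E`-vector space `F`, indexed by the places of
`E`, the Euler characteristics of the family and of its dual under the trace form have a sum that
does not depend on the family: enlarging one by a finite length shrinks the other by the same
length. For a free family the sum is `2 * [F : E] * (1 - g_E)`. The Euler characteristic of the
family of integral closures is `1 - g_F`, and its dual contains all elements with poles of order at
most `e_w - 1` at every place `w`, which gives
`∑ (e_w - 1) ≤ 2 * g_F - 2 - [F : E] * (2 * g_E - 2)`.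

Summed over the components of `D` it reads `∑ (e₂ - 1) ≤ 2 * (g_D - d₂ * g_C + d₂ - 1)`. If `S` is
finite and backward-complete, then `π₂⁻¹(S)` is contained in `π₁⁻¹(S)`. The former has `d₂ * #S`
points with multiplicities `e₂`, hence at least `d₂ * #S - ∑ (e₂ - 1)` points, and the latter has at
most `d₁ * #S`. If moreover `e₂ ≤ e₁` over `S`, then comparing weights instead of points gives
`d₂ * #S = ∑ e₂ ≤ ∑ e₁ ≤ d₁ * #S`, and equality forces both sets and both weights to agree.
-/

noncomputable section

namespace CurveCorr

/-! ### Maps with fibres of constant weight -/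

section Counting

variable {P Q : Type*}

/-- Every fibre of `t` is finite and the weights `e` of its points add up to `d`, as for the
ramification indices of a morphism of curves of degree `d`. -/
def HasFibreSum (t : P → Q) (e : P → ℕ) (d : ℕ) : Prop :=
  ∀ q, ∃ Z : Finset P, (∀ z, z ∈ Z ↔ t z = q) ∧ ∑ z ∈ Z, e z = d

lemma HasFibreSum.of_equiv {P' Q' : Type*} {t : P → Q} {e : P → ℕ} {d : ℕ} {t' : P' → Q'}
    {e' : P' → ℕ} (h : HasFibreSum t e d) (φ : P' ≃ P) (ψ : Q' ≃ Q)
    (ht : ∀ z, t (φ z) = ψ (t' z)) (he : ∀ z, e (φ z) = e' z) : HasFibreSum t' e' d := by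
  intro q
  obtain ⟨Z, hZ, rfl⟩ := h (ψ q)
  refine ⟨Z.map φ.symm.toEmbedding, fun z => ?_, ?_⟩
  · rw [Finset.mem_map_equiv, Equiv.symm_symm, hZ, ht, EmbeddingLike.apply_eq_iff_eq]
  · rw [Finset.sum_map]
    refine Finset.sum_congr rfl fun z _ => ?_
    rw [← he, Equiv.coe_toEmbedding, Equiv.apply_symm_apply]

lemma HasFibreSum.sigma {ι : Type*} [Fintype ι] {P : ι → Type*} {t : ∀ i, P i → Q}
    {e : ∀ i, P i → ℕ} {d : ι → ℕ} (h : ∀ i, HasFibreSum (t i) (e i) (d i)) :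
    HasFibreSum (fun z : Σ i, P i => t z.1 z.2) (fun z => e z.1 z.2) (∑ i, d i) := by
  intro q
  choose Z hZ hsum using fun i => h i q
  refine ⟨Finset.univ.sigma Z, fun z => ?_, ?_⟩
  · rw [Finset.mem_sigma, and_iff_right (Finset.mem_univ _), hZ]
  · rw [Finset.sum_sigma]
    exact Finset.sum_congr rfl fun i _ => hsum i

variable {s t : P → Q} {e₁ e₂ : P → ℕ} {d₁ d₂ : ℕ}

lemma HasFibreSum.exists_preimage (h : HasFibreSum t e₂ d₂) (S : Finset Q) :
    ∃ Z : Finset P, (∀ z, z ∈ Z ↔ t z ∈ S) ∧ ∑ z ∈ Z, e₂ z = d₂ * S.card := by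
  classical
  choose Z hZ hsum using h
  have hdisj : (S : Set Q).PairwiseDisjoint Z := fun p _ q _ hpq =>
    Finset.disjoint_left.mpr fun z hp hq => hpq (((hZ p z).mp hp).symm.trans ((hZ q z).mp hq))
  refine ⟨S.biUnion Z, fun z => ?_, ?_⟩
  · simp only [Finset.mem_biUnion, hZ, exists_eq_right']
  · rw [Finset.sum_biUnion hdisj, Finset.sum_congr rfl fun p _ => hsum p, Finset.sum_const,
      smul_eq_mul, mul_comm]

variable (hs : HasFibreSum s e₁ d₁) (ht : HasFibreSum t e₂ d₂) (hpos : ∀ z, 0 < e₁ z)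
  {S : Finset Q} (hS : ∀ z, t z ∈ S → s z ∈ S)

include hs ht hpos hS

/- The fibres of `t` over `S` contain at least `d₂ * #S - R` points, those of `s` at most
`d₁ * #S`. -/
lemma mul_card_sub_mul_card_le {R : ℤ} (hR : ∀ Z : Finset P, ∑ z ∈ Z, ((e₂ z : ℤ) - 1) ≤ R) :
    ((d₂ : ℤ) - d₁) * S.card ≤ R := by
  obtain ⟨Zs, hZs, hsum_s⟩ := hs.exists_preimage S
  obtain ⟨Zt, hZt, hsum_t⟩ := ht.exists_preimage S
  have hsub : Zt ⊆ Zs := fun z hz => (hZs z).mpr (hS z ((hZt z).mp hz))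
  have hcard : (Zt.card : ℤ) ≤ Zs.card := by exact_mod_cast Finset.card_le_card hsub
  have hcard_s : (Zs.card : ℤ) ≤ d₁ * S.card := by
    rw [← nsmul_one, ← Finset.sum_const]
    exact_mod_cast (Finset.sum_le_sum fun z _ => Nat.succ_le_iff.mpr (hpos z)).trans_eq hsum_s
  have hcard_t : (d₂ : ℤ) * S.card - Zt.card ≤ R := by
    have hRt := hR Zt
    rw [Finset.sum_sub_distrib, Finset.sum_const, nsmul_one] at hRt
    rw [← Nat.cast_sum, hsum_t] at hRt
    exact_mod_cast hRt
  linarith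

omit hpos in
lemma mul_card_le_mul_card (hdec : ∀ z, t z ∈ S → e₂ z ≤ e₁ z) : d₂ * S.card ≤ d₁ * S.card := by
  obtain ⟨Zs, hZs, hsum_s⟩ := hs.exists_preimage S
  obtain ⟨Zt, hZt, hsum_t⟩ := ht.exists_preimage S
  rw [← hsum_s, ← hsum_t]
  exact (Finset.sum_le_sum fun z hz => hdec z ((hZt z).mp hz)).trans
    (Finset.sum_le_sum_of_subset fun z hz => (hZs z).mpr (hS z ((hZt z).mp hz)))

lemma forall_mem_and_forall_eq_of_decreasing (hd : d₁ ≤ d₂)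
    (hdec : ∀ z, t z ∈ S → e₂ z ≤ e₁ z) :
    (∀ z, s z ∈ S → t z ∈ S) ∧ ∀ z, t z ∈ S → e₁ z = e₂ z := by
  obtain ⟨Zs, hZs, hsum_s⟩ := hs.exists_preimage S
  obtain ⟨Zt, hZt, hsum_t⟩ := ht.exists_preimage S
  have hsub : Zt ⊆ Zs := fun z hz => (hZs z).mpr (hS z ((hZt z).mp hz))
  have hle_weight : ∑ z ∈ Zt, e₂ z ≤ ∑ z ∈ Zt, e₁ z :=
    Finset.sum_le_sum fun z hz => hdec z ((hZt z).mp hz)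
  have hle_points : ∑ z ∈ Zt, e₁ z ≤ ∑ z ∈ Zs, e₁ z := Finset.sum_le_sum_of_subset hsub
  have hle_degree : ∑ z ∈ Zs, e₁ z ≤ ∑ z ∈ Zt, e₂ z := by
    rw [hsum_s, hsum_t]
    exact Nat.mul_le_mul_right _ hd
  constructor
  · intro z hz
    by_contra hzt
    have hlt : ∑ z ∈ Zt, e₁ z < ∑ z ∈ Zs, e₁ z :=
      Finset.sum_lt_sum_of_subset hsub ((hZs z).mpr hz) (fun h => hzt ((hZt z).mp h)) (hpos z)
        fun _ _ _ => Nat.zero_le _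
    exact hlt.not_ge (hle_degree.trans hle_weight)
  · intro z hz
    exact ((Finset.sum_eq_sum_iff_of_le fun z hz => hdec z ((hZt z).mp hz)).mp
      (hle_weight.antisymm (hle_points.trans hle_degree)) z ((hZt z).mpr hz)).symm

end Counting

/-! ### Relative lengths of submodules -/

section RelLength

variable {R X Y : Type*} [Ring R] [AddCommGroup X] [Module R X] [AddCommGroup Y] [Module R Y]

/-- The length of `N / (M ∩ N)`. For `M ≤ N` this is the index of `M` in `N`; allowing arbitrary
pairs avoids carrying inclusions around. -/
def relLength (M N : Submodule R X) : ℕ∞ := Module.length R (N ⧸ M.comap N.subtype)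

lemma mapQ_injective {p : Submodule R X} {q : Submodule R Y} (φ : X →ₗ[R] Y)
    (h : p ≤ q.comap φ) (h' : q.comap φ ≤ p) : Function.Injective (p.mapQ q φ h) := by
  rw [← LinearMap.ker_eq_bot, Submodule.ker_mapQ, h'.antisymm h, Submodule.mkQ_map_self]

lemma relLength_eq_length_of_surjective {M N : Submodule R X} (φ : N →ₗ[R] Y)
    (hφ : Function.Surjective φ) (h : ∀ x : N, φ x = 0 ↔ (x : X) ∈ M) :
    relLength M N = Module.length R Y := by
  have hker : LinearMap.ker φ = M.comap N.subtype := Submodule.ext h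
  rw [relLength, ← hker]
  exact (φ.quotKerEquivOfSurjective hφ).length_eq

lemma relLength_bot_left (N : Submodule R X) : relLength ⊥ N = Module.length R N :=
  relLength_eq_length_of_surjective LinearMap.id Function.surjective_id fun x => by simp

lemma relLength_bot_top_self (R : Type*) [DivisionRing R] :
    relLength (⊥ : Submodule R R) ⊤ = 1 := by
  rw [relLength_bot_left, Submodule.topEquiv.length_eq]
  exact Module.length_eq_one R R

lemma relLength_eq_of_map (φ : X →ₗ[R] Y) {M N : Submodule R X} {M' N' : Submodule R Y}
    (hmaps : ∀ x ∈ N, φ x ∈ N') (hmem : ∀ x ∈ N, φ x ∈ M' ↔ x ∈ M)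
    (hsurj : ∀ y ∈ N', ∃ x ∈ N, y - φ x ∈ M') : relLength M N = relLength M' N' := by
  refine relLength_eq_length_of_surjective
    ((M'.comap N'.subtype).mkQ ∘ₗ φ.restrict hmaps) ?_ ?_
  · intro y
    obtain ⟨⟨y, hy⟩, rfl⟩ := Submodule.mkQ_surjective _ y
    obtain ⟨x, hx, hxy⟩ := hsurj y hy
    exact ⟨⟨x, hx⟩, ((Submodule.Quotient.eq (M'.comap N'.subtype) (x := ⟨y, hy⟩)
      (y := φ.restrict hmaps ⟨x, hx⟩)).mpr hxy).symm⟩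
  · rintro ⟨x, hx⟩
    exact (Submodule.Quotient.mk_eq_zero _).trans (hmem x hx)

lemma relLength_inf_left (M N : Submodule R X) : relLength (M ⊓ N) N = relLength M N :=
  relLength_eq_of_map LinearMap.id (fun _ hx => hx) (fun _ hx => (and_iff_left hx).symm)
    fun y hy => ⟨y, hy, by simp⟩

lemma relLength_sup_right (M N : Submodule R X) : relLength M (M ⊔ N) = relLength M N := by
  refine (relLength_eq_of_map LinearMap.id (fun x hx => Submodule.mem_sup_right hx)
    (fun x _ => Iff.rfl) fun y hy => ?_).symm
  obtain ⟨m, hm, n, hn, rfl⟩ := Submodule.mem_sup.mp hy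
  exact ⟨n, hn, by simpa using hm⟩

lemma relLength_eq_zero_of_le {M N : Submodule R X} (h : N ≤ M) : relLength M N = 0 := by
  rw [relLength, Submodule.comap_subtype_eq_top.mpr h]
  exact Module.length_eq_zero

lemma relLength_anti_left {M M' : Submodule R X} (h : M ≤ M') (N : Submodule R X) :
    relLength M' N ≤ relLength M N :=
  Module.length_le_of_surjective (Submodule.factor (Submodule.comap_mono h))
    (Submodule.factor_surjective _)

lemma relLength_le_of_map (φ : X →ₗ[R] Y) {M N : Submodule R X} {M' N' : Submodule R Y}
    (hmaps : ∀ x ∈ N, φ x ∈ N') (hmem : ∀ x ∈ N, φ x ∈ M' → x ∈ M) :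
    relLength M N ≤ relLength M' N' := calc
  relLength M N ≤ relLength (M'.comap φ) N := by
    have hle : M'.comap φ ⊓ N ≤ M := fun x hx => hmem x hx.2 hx.1
    rw [← relLength_inf_left (M'.comap φ)]
    exact relLength_anti_left hle N
  _ ≤ relLength M' N' := Module.length_le_of_injective
    (Submodule.mapQ ((M'.comap φ).comap N.subtype) (M'.comap N'.subtype) (φ.restrict hmaps)
      fun _ hx => hx) (mapQ_injective _ _ fun _ hx => hx)

lemma relLength_mono_right (M : Submodule R X) {N N' : Submodule R X} (h : N ≤ N') :
    relLength M N ≤ relLength M N' :=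
  relLength_le_of_map LinearMap.id (fun _ hx => h hx) fun _ _ hx => hx

lemma relLength_add {M N P : Submodule R X} (h : M ≤ N) (h' : N ≤ P) :
    relLength M P = relLength M N + relLength N P := by
  refine Module.length_eq_add_of_exact
    (Submodule.mapQ (M.comap N.subtype) (M.comap P.subtype) (Submodule.inclusion h')
      fun _ hx => hx)
    (Submodule.factor (Submodule.comap_mono h)) (mapQ_injective _ _ fun _ hx => hx)
    (Submodule.factor_surjective _) fun y => ?_
  obtain ⟨⟨y, hy⟩, rfl⟩ := Submodule.mkQ_surjective _ y
  rw [Submodule.factor_mk, Submodule.mkQ_apply, Submodule.Quotient.mk_eq_zero]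
  constructor
  · exact fun hyN => ⟨Submodule.Quotient.mk ⟨y, hyN⟩, rfl⟩
  · rintro ⟨z, hz⟩
    obtain ⟨⟨z, hzN⟩, rfl⟩ := Submodule.mkQ_surjective _ z
    have hzy : z - y ∈ M := (Submodule.Quotient.eq (M.comap P.subtype)
      (x := Submodule.inclusion h' ⟨z, hzN⟩) (y := ⟨y, hy⟩)).mp hz
    exact (Submodule.sub_mem_iff_right N hzN).mp (h hzy)

lemma relLength_bot_inf_add_relLength_sup {Λ Λ' A : Submodule R X} (W : Submodule R X)
    (h : Λ ≤ Λ') (h' : Λ' ≤ A) (hW : W ≤ A) :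
    relLength ⊥ (Λ' ⊓ W) + relLength (Λ ⊔ W) A =
      relLength ⊥ (Λ ⊓ W) + relLength Λ Λ' + relLength (Λ' ⊔ W) A := by
  have hsup : relLength (Λ ⊔ W) A = relLength (Λ ⊔ W) (Λ' ⊔ W) + relLength (Λ' ⊔ W) A :=
    relLength_add (sup_le_sup_right h W) (sup_le h' hW)
  have hinf : relLength ⊥ (Λ' ⊓ W) = relLength ⊥ (Λ ⊓ W) + relLength (Λ ⊓ W) (Λ' ⊓ W) :=
    relLength_add bot_le (inf_le_inf_right W h)
  have hfilter : relLength Λ Λ' = relLength Λ (Λ ⊔ (Λ' ⊓ W)) + relLength (Λ ⊔ (Λ' ⊓ W)) Λ' :=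
    relLength_add le_sup_left (sup_le h inf_le_left)
  have hlower : relLength Λ (Λ ⊔ (Λ' ⊓ W)) = relLength (Λ ⊓ W) (Λ' ⊓ W) := by
    rw [relLength_sup_right, ← relLength_inf_left, ← inf_assoc, inf_eq_left.mpr h]
  have hupper : relLength (Λ ⊔ (Λ' ⊓ W)) Λ' = relLength (Λ ⊔ W) (Λ' ⊔ W) := by
    have hsup' : Λ' ⊔ W = (Λ ⊔ W) ⊔ Λ' := by rw [sup_right_comm, sup_eq_right.mpr h]
    rw [hsup', relLength_sup_right, ← relLength_inf_left (Λ ⊔ W), inf_comm Λ' W,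
      sup_inf_assoc_of_le W h]
  rw [hsup, hinf, hfilter, hlower, hupper]
  ring

lemma relLength_pi {P : Type*} {L L' : P → Submodule R X} (s : Finset P)
    (hs : ∀ p ∉ s, L' p ≤ L p) :
    relLength (Submodule.pi Set.univ L) (Submodule.pi Set.univ L') =
      ∑ p ∈ s, relLength (L p) (L' p) := by
  classical
  rw [← Finset.sum_coe_sort, show ∑ p : s, relLength (L p) (L' p) =
    Module.length R (∀ p : s, (L' p) ⧸ (L p).comap (L' p).subtype) from
      (Module.length_pi_of_fintype ..).symm]
  refine relLength_eq_length_of_surjective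
    (LinearMap.pi fun p : s => ((L p).comap (L' p).subtype).mkQ ∘ₗ
      ((LinearMap.proj p.1).restrict fun x hx => hx p.1 trivial)) ?_ ?_
  · intro y
    choose z hz using fun p => Submodule.mkQ_surjective _ (y p)
    refine ⟨⟨fun p => if hp : p ∈ s then z ⟨p, hp⟩ else 0, fun p _ => ?_⟩, funext fun p => ?_⟩
    · dsimp only
      split_ifs with hp
      · exact (z ⟨p, hp⟩).2
      · exact zero_mem _
    · exact (congrArg _ (Subtype.ext (dif_pos p.2))).trans (hz p)
  · rintro ⟨x, hx⟩
    simp only [LinearMap.pi_apply, funext_iff, LinearMap.comp_apply, Submodule.mkQ_apply,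
      Pi.zero_apply, Submodule.Quotient.mk_eq_zero, Submodule.mem_comap, Submodule.mem_pi,
      Submodule.subtype_apply, Subtype.forall, Set.mem_univ, true_implies]
    refine ⟨fun h p => ?_, fun h p _ => h p⟩
    by_cases hp : p ∈ s
    · exact h p hp
    · exact hs p hp (hx p trivial)

lemma relLength_pi_const {ι : Type*} [Fintype ι] (M N : Submodule R X) :
    relLength (Submodule.pi Set.univ fun _ : ι => M) (Submodule.pi Set.univ fun _ : ι => N) =
      Fintype.card ι * relLength M N := by
  rw [relLength_pi Finset.univ fun p hp => absurd (Finset.mem_univ p) hp, Finset.sum_const,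
    Finset.card_univ, nsmul_eq_mul]

end RelLength

/-! ### Euler characteristics of families of lattices -/

section Euler

variable {R V : Type*} [Ring R] [AddCommGroup V] [Module R V] {P : Type*}

/-- The restricted product of copies of `V` with respect to a family of subspaces. -/
def restrictedPi (L : P → Submodule R V) : Submodule R (P → V) where
  carrier := {r | {p | r p ∉ L p}.Finite}
  add_mem' {r s} hr hs := (hr.union hs).subset fun p hp => by
    by_contra h
    rw [Set.mem_union, not_or] at h
    exact hp (add_mem (not_not.mp h.1) (not_not.mp h.2))
  zero_mem' := by simp
  smul_mem' c _ hr := hr.subset fun p hp h => hp (Submodule.smul_mem _ c h)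

lemma mem_restrictedPi {L : P → Submodule R V} {r : P → V} :
    r ∈ restrictedPi L ↔ {p | r p ∉ L p}.Finite := Iff.rfl

lemma pi_le_restrictedPi (L : P → Submodule R V) :
    Submodule.pi Set.univ L ≤ restrictedPi L := fun _ hr =>
  Set.finite_empty.subset fun p hp => hp (hr p trivial)

lemma restrictedPi_mono {L L' : P → Submodule R V} {s : Set P} (hs : s.Finite)
    (h : ∀ p ∉ s, L p ≤ L' p) : restrictedPi L ≤ restrictedPi L' := fun _ hr =>
  (hs.union hr).subset fun p hp => or_iff_not_imp_left.mpr fun hps hp' => hp (h p hps hp')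

lemma restrictedPi_congr {L L' : P → Submodule R V} {s : Set P} (hs : s.Finite)
    (h : ∀ p ∉ s, L p = L' p) : restrictedPi L = restrictedPi L' :=
  (restrictedPi_mono hs fun p hp => (h p hp).le).antisymm
    (restrictedPi_mono hs fun p hp => (h p hp).ge)

variable (R V P) in
/-- The diagonal copy of `V` in `P → V`: the global rational sections. -/
def constants : Submodule R (P → V) :=
  LinearMap.range (LinearMap.pi fun _ : P => (LinearMap.id : V →ₗ[R] V))

/-- The length of the space of global sections of a family of lattices `L`, that is of `⋂ p, L p`
embedded diagonally. -/
def hZero (L : P → Submodule R V) : ℕ∞ := relLength ⊥ (Submodule.pi Set.univ L ⊓ constants R V P)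

/-- The length of the first cohomology of a family of lattices, computed by repartitions. -/
def hOne (L : P → Submodule R V) : ℕ∞ :=
  relLength (Submodule.pi Set.univ L ⊔ constants R V P) (restrictedPi L)

/-- Every vector lies in almost all members of the family. -/
def MemAlmostAll (L : P → Submodule R V) : Prop := ∀ v : V, {p | v ∉ L p}.Finite

lemma MemAlmostAll.constants_le {L : P → Submodule R V} (h : MemAlmostAll L) :
    constants R V P ≤ restrictedPi L := by
  rintro _ ⟨v, rfl⟩
  exact h v

/- Enlarging `L` to `L'` changes `h⁰ - h¹` by the length of `L' / L`; the terms are moved so that no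
subtraction in `ℕ∞` occurs. -/
lemma hZero_add_hOne {L L' : P → Submodule R V} (h : ∀ p, L p ≤ L' p) (s : Finset P)
    (hs : ∀ p ∉ s, L p = L' p) (hL : MemAlmostAll L) :
    hZero L' + hOne L = hZero L + ∑ p ∈ s, relLength (L p) (L' p) + hOne L' := by
  have hrestr : restrictedPi L' = restrictedPi L :=
    (restrictedPi_congr s.finite_toSet fun p hp => hs p hp).symm
  have hpi : Submodule.pi Set.univ L ≤ Submodule.pi Set.univ L' := fun r hr p hp => h p (hr p hp)
  rw [hZero, hOne, hZero, hOne, hrestr, ← relLength_pi s fun p hp => (hs p hp).ge]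
  exact relLength_bot_inf_add_relLength_sup _ hpi (hrestr ▸ pi_le_restrictedPi L') hL.constants_le

section Map

variable {Q V' : Type*} [AddCommGroup V'] [Module R V'] {L : P → Submodule R V}
  {L' : Q → Submodule R V'} (e : V ≃ₗ[R] V') (σ : Q → P)

/-- The map of families `(P → V) → (Q → V')` induced by a map of index sets and an isomorphism of
modules. -/
def mapFamily : (P → V) →ₗ[R] (Q → V') :=
  LinearMap.pi fun q => e.toLinearMap ∘ₗ LinearMap.proj (σ q)

lemma mapFamily_apply (r : P → V) (q : Q) : mapFamily e σ r q = e (r (σ q)) := rfl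

variable {e σ} (hL : ∀ v p, v ∈ L p ↔ ∀ q, σ q = p → e v ∈ L' q)

include hL

lemma mapFamily_mem_restrictedPi (hσ : ∀ p, (σ ⁻¹' {p}).Finite) {r : P → V}
    (hr : r ∈ restrictedPi L) : mapFamily e σ r ∈ restrictedPi L' :=
  (Set.Finite.biUnion hr fun p _ => hσ p).subset fun q hq =>
    Set.mem_biUnion (x := σ q) (fun h => hq ((hL _ _).mp h q rfl)) rfl

lemma mapFamily_mem_pi_iff {r : P → V} :
    mapFamily e σ r ∈ Submodule.pi Set.univ L' ↔ r ∈ Submodule.pi Set.univ L := by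
  simp only [Submodule.mem_pi, Set.mem_univ, true_implies, mapFamily_apply, hL]
  exact ⟨fun h p q hq => hq ▸ h q, fun h q => h (σ q) q rfl⟩

lemma mapFamily_mem_pi_sup_constants_iff {r : P → V} :
    mapFamily e σ r ∈ Submodule.pi Set.univ L' ⊔ constants R V' Q ↔
      r ∈ Submodule.pi Set.univ L ⊔ constants R V P := by
  constructor
  · intro h
    obtain ⟨a, ha, _, ⟨v, rfl⟩, hab⟩ := Submodule.mem_sup.mp h
    refine Submodule.mem_sup.mpr ⟨r - fun _ => e.symm v, (mapFamily_mem_pi_iff hL).mp ?_,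
      fun _ => e.symm v, ⟨_, rfl⟩, sub_add_cancel _ _⟩
    have hv : mapFamily e σ (fun _ => e.symm v) = fun _ => v :=
      funext fun _ => e.apply_symm_apply v
    rw [map_sub, ← hab, hv]
    exact (add_sub_cancel_right a _).symm ▸ ha
  · intro h
    obtain ⟨a, ha, _, ⟨v, rfl⟩, rfl⟩ := Submodule.mem_sup.mp h
    rw [map_add]
    exact Submodule.add_mem_sup ((mapFamily_mem_pi_iff hL).mpr ha) ⟨e v, rfl⟩

/- The approximation hypothesis on the finite fibres of `σ` makes the induced map on `H¹`
surjective. -/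
lemma hOne_eq_of_map (hσ : ∀ p, (σ ⁻¹' {p}).Finite)
    (happrox : ∀ p (r : Q → V'), (∃ q, σ q = p ∧ r q ∉ L' q) →
      ∃ v, ∀ q, σ q = p → r q - e v ∈ L' q) :
    hOne L = hOne L' := by
  refine relLength_eq_of_map (mapFamily e σ) (fun r => mapFamily_mem_restrictedPi hL hσ)
    (fun r _ => mapFamily_mem_pi_sup_constants_iff hL) fun r hr => ?_
  classical
  choose v hv using fun p (h : ∃ q, σ q = p ∧ r q ∉ L' q) => happrox p r h
  refine ⟨fun p => if h : ∃ q, σ q = p ∧ r q ∉ L' q then v p h else 0, ?_, ?_⟩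
  · refine (Set.Finite.image σ hr).subset fun p hp => ?_
    by_contra h
    have hreg : ¬ ∃ q, σ q = p ∧ r q ∉ L' q := fun ⟨q, hq, hq'⟩ => h ⟨q, hq', hq⟩
    exact hp (by simp only [dif_neg hreg, zero_mem])
  · refine Submodule.mem_sup_left fun q _ => ?_
    rw [Pi.sub_apply, mapFamily_apply]
    split_ifs with h
    · exact hv (σ q) h q rfl
    · simpa using not_exists.mp h q

lemma hZero_eq_of_map (hσ : Function.Surjective σ) : hZero L = hZero L' := by
  refine relLength_eq_of_map (mapFamily e σ) ?_ ?_ ?_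
  · rintro _ ⟨hr, ⟨v, rfl⟩⟩
    exact ⟨(mapFamily_mem_pi_iff hL).mpr hr, ⟨e v, rfl⟩⟩
  · intro r _
    simp only [Submodule.mem_bot, funext_iff, mapFamily_apply, Pi.zero_apply,
      EmbeddingLike.map_eq_zero_iff]
    exact (hσ.forall (p := fun p => r p = 0)).symm
  · rintro _ ⟨hr, ⟨v, rfl⟩⟩
    have hv : mapFamily e σ (fun _ => e.symm v) = fun _ => v :=
      funext fun _ => e.apply_symm_apply v
    exact ⟨fun _ => e.symm v, ⟨(mapFamily_mem_pi_iff hL).mp (hv.symm ▸ hr), ⟨_, rfl⟩⟩,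
      (Submodule.mem_bot R).mpr (sub_eq_zero.mpr hv.symm)⟩

end Map

section Pi

variable {ι : Type*}

variable (R V P ι) in
/-- Exchange of the two arguments of a family of vectors in `ι → V`. -/
def swapFamily : (P → ι → V) →ₗ[R] (ι → P → V) :=
  LinearMap.pi fun i => LinearMap.pi fun p => LinearMap.proj i ∘ₗ LinearMap.proj p

variable (L : P → Submodule R V)

lemma swapFamily_mem_pi_iff {r : P → ι → V} :
    swapFamily R V P ι r ∈
        Submodule.pi Set.univ (fun _ => Submodule.pi Set.univ L ⊔ constants R V P) ↔
      r ∈ Submodule.pi Set.univ (fun p => Submodule.pi Set.univ fun _ => L p) ⊔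
        constants R (ι → V) P := by
  constructor
  · intro h
    choose a ha b hb hab using fun i => Submodule.mem_sup.mp (h i trivial)
    choose v hv using hb
    exact Submodule.mem_sup.mpr ⟨fun p i => a i p, fun p _ i _ => ha i p trivial,
      fun p i => b i p, ⟨v, funext₂ fun p i => congrFun (hv i) p⟩,
      funext₂ fun p i => congrFun (hab i) p⟩
  · intro h i _
    obtain ⟨a, ha, _, ⟨v, rfl⟩, rfl⟩ := Submodule.mem_sup.mp h
    exact Submodule.mem_sup.mpr ⟨fun p => a p i, fun p _ => ha p trivial i trivial,
      fun _ => v i, ⟨v i, rfl⟩, rfl⟩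

variable [Fintype ι]

lemma hZero_pi : hZero (fun p => Submodule.pi Set.univ fun _ : ι => L p) =
    Fintype.card ι * hZero L := by
  rw [hZero, hZero, ← relLength_pi_const]
  refine relLength_eq_of_map (swapFamily R V P ι) ?_ ?_ ?_
  · rintro _ ⟨hr, ⟨v, rfl⟩⟩ i _
    exact ⟨fun p _ => hr p trivial i trivial, ⟨v i, rfl⟩⟩
  · intro r _
    simp only [Submodule.mem_pi, Set.mem_univ, true_implies, Submodule.mem_bot, funext_iff]
    exact forall_comm
  · intro r hr
    choose hr v hv using fun i => hr i trivial
    refine ⟨fun p i => r i p, ⟨fun p _ i _ => hr i p trivial, v, ?_⟩, ?_⟩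
    · exact funext₂ fun p i => congrFun (hv i) p
    · exact (sub_self r).symm ▸ zero_mem (Submodule.pi Set.univ fun _ : ι => _)

lemma hOne_pi : hOne (fun p => Submodule.pi Set.univ fun _ : ι => L p) =
    Fintype.card ι * hOne L := by
  rw [hOne, hOne, ← relLength_pi_const]
  refine relLength_eq_of_map (swapFamily R V P ι) (fun r hr i _ => ?_)
    (fun r _ => swapFamily_mem_pi_iff L) fun r hr => ⟨fun p i => r i p, ?_, ?_⟩
  · exact Set.Finite.subset hr fun p hp h => hp (h i trivial)
  · refine (Set.finite_iUnion fun i => mem_restrictedPi.mp (hr i trivial)).subset fun p hp => ?_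
    by_contra h
    simp only [Set.mem_iUnion, Set.mem_ofPred_eq, not_exists, not_not] at h
    exact hp fun i _ => h i
  · exact (sub_self r).symm ▸ zero_mem (Submodule.pi Set.univ fun _ : ι => _)

end Pi

section Mono

variable {L L' : P → Submodule R V}

lemma hZero_mono (h : ∀ p, L p ≤ L' p) : hZero L ≤ hZero L' :=
  relLength_le_of_map LinearMap.id (fun _ hx => ⟨fun p hp => h p (hx.1 p hp), hx.2⟩) fun _ _ h => h

lemma hOne_anti (h : ∀ p, L p ≤ L' p) {s : Set P} (hs : s.Finite) (hs' : ∀ p ∉ s, L p = L' p) :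
    hOne L' ≤ hOne L := by
  rw [hOne, hOne, restrictedPi_congr hs hs']
  exact relLength_anti_left (sup_le_sup_right (fun _ hr p hp => h p (hr p hp)) _) _

lemma MemAlmostAll.congr (hL : MemAlmostAll L) {s : Set P} (hs : s.Finite)
    (h : ∀ p ∉ s, L p = L' p) : MemAlmostAll L' := by
  refine fun v => (hs.union (hL v)).subset fun p hp => ?_
  by_cases hps : p ∈ s
  · exact Or.inl hps
  · rw [Set.mem_ofPred_eq, ← h p hps] at hp
    exact Or.inr hp

end Mono

section EulerChar

variable {L L' : P → Submodule R V}

/-- Finiteness of the cohomology of a family of lattices. -/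
def FiniteCohomology (L : P → Submodule R V) : Prop := hZero L ≠ ⊤ ∧ hOne L ≠ ⊤

/-- The Euler characteristic `h⁰ - h¹` of a family of lattices with finite cohomology. -/
def eulerChar (L : P → Submodule R V) : ℤ := (hZero L).toNat - (hOne L).toNat

variable (h : ∀ p, L p ≤ L' p) (s : Finset P) (hs : ∀ p ∉ s, L p = L' p) (hL : MemAlmostAll L)

include h s hs hL

lemma finiteCohomology_iff_of_le (hidx : ∑ p ∈ s, relLength (L p) (L' p) ≠ ⊤) :
    FiniteCohomology L ↔ FiniteCohomology L' := by
  have heuler := hZero_add_hOne h s hs hL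
  refine ⟨fun ⟨h0, h1⟩ => ?_, fun ⟨h0, h1⟩ => ?_⟩
  · have h1' := ne_top_of_le_ne_top h1 (hOne_anti h s.finite_toSet hs)
    refine ⟨ne_top_of_le_ne_top ?_ (le_self_add.trans heuler.le), h1'⟩
    exact WithTop.add_ne_top.mpr ⟨WithTop.add_ne_top.mpr ⟨h0, hidx⟩, h1'⟩
  · have h0' := ne_top_of_le_ne_top h0 (hZero_mono h)
    refine ⟨h0', ne_top_of_le_ne_top ?_ (le_add_self.trans heuler.le)⟩
    exact WithTop.add_ne_top.mpr ⟨WithTop.add_ne_top.mpr ⟨h0', hidx⟩, h1⟩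

lemma eulerChar_eq_add_of_le (hfin : FiniteCohomology L) (hfin' : FiniteCohomology L')
    (hidx : ∑ p ∈ s, relLength (L p) (L' p) ≠ ⊤) :
    eulerChar L' = eulerChar L + (∑ p ∈ s, relLength (L p) (L' p)).toNat := by
  have heuler := congrArg ENat.toNat (hZero_add_hOne h s hs hL)
  have hsum : hZero L + ∑ p ∈ s, relLength (L p) (L' p) ≠ ⊤ :=
    WithTop.add_ne_top.mpr ⟨hfin.1, hidx⟩
  rw [ENat.toNat_add hfin'.1 hfin.2, ENat.toNat_add hsum hfin'.2,
    ENat.toNat_add hfin.1 hidx] at heuler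
  rw [eulerChar, eulerChar]
  lia

end EulerChar

end Euler

/-! ### Places of fields -/

lemma exists_algebraMap_eq_of_dominates {R F : Type*} [CommRing R] [IsDomain R] [ValuationRing R]
    [Field F] [Algebra R F] [IsFractionRing R F] (V : ValuationSubring F)
    (h : ∀ r ∈ IsLocalRing.maximalIdeal R, algebraMap R F r ∈ V.nonunits) {x : F} (hx : x ∈ V) :
    ∃ r : R, algebraMap R F r = x := by
  rcases ValuationRing.isInteger_or_isInteger R x with ⟨r, hr⟩ | ⟨r, hr⟩
  · exact ⟨r, hr⟩
  by_cases hu : IsUnit r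
  · exact ⟨(hu.unit⁻¹ : Rˣ), by rw [map_units_inv, hu.unit_spec, hr, inv_inv]⟩
  · have hnonunit := h r ((IsLocalRing.mem_maximalIdeal r).mpr hu)
    rw [hr, ValuationSubring.inv_mem_nonunits_iff] at hnonunit
    exact ⟨0, (map_zero _).trans (hnonunit.resolve_right (not_not_intro hx)).symm⟩

section ValuationSubring

variable {F : Type*} [Field F] {V W : ValuationSubring F} {x : F}

lemma mem_of_isIntegral (hx : IsIntegral V x) : x ∈ V := by
  obtain ⟨y, rfl⟩ := IsIntegrallyClosed.isIntegral_iff.mp hx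
  exact y.2

lemma inv_mem_of_notMem_nonunits (hx : x ∉ V.nonunits) : x⁻¹ ∈ V :=
  of_not_not fun h => hx (V.mem_nonunits_iff_or.mpr (Or.inr h))

lemma eq_of_le_of_ne_top [Ring.DimensionLEOne V] (h : V ≤ W) (hW : W ≠ ⊤) : V = W := by
  by_cases h0 : V.idealOfLE W h = ⊥
  · exact absurd (by rw [← V.ofPrime_idealOfLE W h, ← V.ofPrime_bot]; simp only [h0]) hW
  · have hmax : V.idealOfLE W h = IsLocalRing.maximalIdeal V :=
      IsLocalRing.eq_maximalIdeal (Ideal.IsPrime.isMaximal inferInstance h0)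
    rw [← V.ofPrime_idealOfLE W h]
    simp only [hmax, V.ofPrime_top]

end ValuationSubring

/-- A place of `F` over `K`: a valuation ring of `F` containing `K` and different from `F`. -/
@[ext]
structure Place (K F : Type*) [Field K] [Field F] [Algebra K F] where
  ring : ValuationSubring F
  algebraMap_mem : ∀ a : K, algebraMap K F a ∈ ring
  ne_top : ring ≠ ⊤

namespace Place

variable {K F : Type*} [Field K] [Field F] [Algebra K F]

/-- The valuation ring of a place as a subspace. -/
def lattice (w : Place K F) : Submodule K F where
  carrier := w.ring
  add_mem' := w.ring.add_mem _ _
  zero_mem' := w.ring.zero_mem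
  smul_mem' c x hx := by
    rw [Algebra.smul_def]
    exact w.ring.mul_mem _ _ (w.algebraMap_mem c) hx

@[simp] lemma mem_lattice {w : Place K F} {x : F} : x ∈ w.lattice ↔ x ∈ w.ring := Iff.rfl

lemma exists_notMem (w : Place K F) : ∃ x, x ∉ w.ring := by
  by_contra! h
  exact w.ne_top (SetLike.ext fun x => ⟨fun _ => ValuationSubring.mem_top x, fun _ => h x⟩)

lemma eq_of_le {v w : Place K F} [Ring.DimensionLEOne v.ring] (h : v.ring ≤ w.ring) : v = w :=
  Place.ext (eq_of_le_of_ne_top h w.ne_top)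

instance (w : Place K F) : Algebra K w.ring :=
  ((algebraMap K F).codRestrict w.ring.toSubring w.algebraMap_mem).toAlgebra

instance (F' : Type*) [Field F'] [Algebra K F'] [Algebra F F'] [IsScalarTower K F F']
    (w : Place K F) : IsScalarTower K w.ring F' :=
  .of_algebraMap_eq fun a => IsScalarTower.algebraMap_apply K F F' a

section Comap

variable (E : Type*) [Field E] [Algebra K E] [Algebra E F] [IsScalarTower K E F]
  [Algebra.IsAlgebraic E F]

/-- The restriction of a place to a subfield. -/
def comap (w : Place K F) : Place K E where
  ring := w.ring.comap (algebraMap E F)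
  algebraMap_mem a := by
    rw [ValuationSubring.mem_comap, ← IsScalarTower.algebraMap_apply]
    exact w.algebraMap_mem a
  ne_top h := by
    obtain ⟨x, hx⟩ := w.exists_notMem
    have hE : ∀ y : E, algebraMap E F y ∈ w.ring := fun y => by
      rw [← ValuationSubring.mem_comap, h]
      exact ValuationSubring.mem_top y
    refine hx (mem_of_isIntegral ?_)
    exact (Algebra.IsIntegral.isIntegral (R := E) x).map_of_comp_eq
      ((algebraMap E F).codRestrict w.ring.toSubring hE) (RingHom.id F) rfl

variable {E}

lemma mem_comap {w : Place K F} {x : E} : x ∈ (w.comap E).ring ↔ algebraMap E F x ∈ w.ring :=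
  Iff.rfl

lemma mem_nonunits_comap {w : Place K F} {x : E} :
    x ∈ (w.comap E).ring.nonunits ↔ algebraMap E F x ∈ w.ring.nonunits := by
  rw [ValuationSubring.mem_nonunits_iff_or, ValuationSubring.mem_nonunits_iff_or, mem_comap,
    map_inv₀, map_eq_zero]

/-- The ramification index of a place over its restriction: the largest power of the maximal ideal
of the place that contains the maximal ideal of the restriction. -/
def ram (E : Type*) [Field E] [Algebra E F] (w : Place K F) : ℕ :=
  sSup {n | ∀ (x : E) (hx : algebraMap E F x ∈ w.ring),
    ¬ IsUnit (⟨_, hx⟩ : w.ring) → (⟨_, hx⟩ : w.ring) ∈ IsLocalRing.maximalIdeal w.ring ^ n}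

end Comap

end Place

/-- The properties of the places of an algebraic function field in one variable over an
algebraically closed field. -/
class IsCurveField (K F : Type*) [Field K] [Field F] [Algebra K F] : Prop where
  dvr (w : Place K F) : IsDiscreteValuationRing w.ring
  residue (w : Place K F) : ∀ x ∈ w.ring, ∃ a : K, x - algebraMap K F a ∈ w.ring.nonunits
  finite (x : F) : {w : Place K F | x ∉ w.ring}.Finite

attribute [instance] IsCurveField.dvr

namespace Place

variable {K E F : Type*} [Field K] [Field E] [Field F] [Algebra K E] [Algebra K F]
  [Algebra E F] [IsScalarTower K E F] [FiniteDimensional E F]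

section Separable

variable [Algebra.IsSeparable E F]

variable (F) in
/-- The integral closure of the valuation ring of a place in an extension. -/
abbrev intCl (v : Place K E) : Subalgebra v.ring F := integralClosure v.ring F

variable (v : Place K E) [IsDiscreteValuationRing v.ring]

instance : IsDedekindDomain (v.intCl F) := integralClosure.isDedekindDomain v.ring E F

instance : IsFractionRing (v.intCl F) F :=
  integralClosure.isFractionRing_of_finite_extension E F

instance : Module.Finite v.ring (v.intCl F) := IsIntegralClosure.finite v.ring E F _

instance : Module.Free v.ring (v.intCl F) := IsIntegralClosure.module_free v.ring E F _

variable {v}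

omit [FiniteDimensional E F] [IsDiscreteValuationRing v.ring] in
lemma intCl_le {w : Place K F} (hw : w.comap E = v) (b : v.intCl F) : (b : F) ∈ w.ring := by
  refine mem_of_isIntegral ?_
  have h : ∀ y : v.ring, algebraMap v.ring F y ∈ w.ring := fun y =>
    (congrArg Place.ring hw).ge y.2
  exact b.2.map_of_comp_eq ((algebraMap v.ring F).codRestrict w.ring.toSubring h)
    (RingHom.id F) rfl

/-- The inclusion of the integral closure in the valuation ring of a place above. -/
def intClToRing {w : Place K F} (hw : w.comap E = v) : v.intCl F →+* w.ring :=
  (algebraMap (v.intCl F) F).codRestrict w.ring.toSubring (intCl_le hw)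

/-- The center of a place on the integral closure. -/
def center {w : Place K F} (hw : w.comap E = v) : Ideal (v.intCl F) :=
  (IsLocalRing.maximalIdeal w.ring).comap (intClToRing hw)

instance {w : Place K F} (hw : w.comap E = v) : (center hw).IsPrime :=
  Ideal.IsPrime.comap _

omit [FiniteDimensional E F] [IsDiscreteValuationRing v.ring] in
lemma mem_center {w : Place K F} (hw : w.comap E = v) (b : v.intCl F) :
    b ∈ center hw ↔ (b : F) ∈ w.ring.nonunits := by
  rw [center, Ideal.mem_comap, ValuationSubring.mem_nonunits_iff_exists_mem_maximalIdeal]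
  constructor
  · exact fun h => ⟨intCl_le hw b, h⟩
  · exact fun ⟨_, h⟩ => h

omit [IsDiscreteValuationRing v.ring] in
lemma center_ne_bot {w : Place K F} (hw : w.comap E = v) : center hw ≠ ⊥ := by
  intro h
  obtain ⟨x, hx⟩ := w.exists_notMem
  obtain ⟨a, b, hb, rfl⟩ := IsFractionRing.div_surjective (A := v.intCl F) x
  have hb0 : b ≠ 0 := nonZeroDivisors.ne_zero hb
  have hbc : (b : F) ∉ w.ring.nonunits := fun hb' =>
    hb0 (Ideal.mem_bot.mp (h ▸ (mem_center hw b).mpr hb'))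
  refine hx ?_
  rw [div_eq_mul_inv]
  exact w.ring.mul_mem _ _ (intCl_le hw a) (inv_mem_of_notMem_nonunits hbc)

lemma exists_div_of_mem {w : Place K F} (hw : w.comap E = v) {x : F} (hx : x ∈ w.ring) :
    ∃ a b : v.intCl F, b ∉ center hw ∧ x * b = a := by
  let S := (center hw).primeCompl
  have hS : S ≤ nonZeroDivisors (v.intCl F) := (center hw).primeCompl_le_nonZeroDivisors
  let R := Localization.subalgebra.ofField F S hS
  have : IsLocalization.AtPrime R (center hw) :=
    inferInstanceAs (IsLocalization S (Localization.subalgebra.ofField F S hS))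
  have : IsDiscreteValuationRing R :=
    IsLocalization.AtPrime.isDiscreteValuationRing_of_dedekind_domain _ (center_ne_bot hw) R
  have : IsLocalRing R := IsLocalization.AtPrime.isLocalRing R (center hw)
  have hR : ∀ r : R, ∃ a b : v.intCl F, b ∉ center hw ∧ (r : F) * b = a ∧
      (r ∈ IsLocalRing.maximalIdeal R → a ∈ center hw) := by
    intro r
    obtain ⟨⟨a, b⟩, h⟩ := IsLocalization.surj (M := S) r
    refine ⟨a, b, b.2, congrArg Subtype.val h, fun hr => ?_⟩
    rw [← IsLocalization.AtPrime.to_map_mem_maximal_iff R (center hw), ← h]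
    exact Ideal.mul_mem_right _ _ hr
  have hdom : ∀ r ∈ IsLocalRing.maximalIdeal R, algebraMap R F r ∈ w.ring.nonunits := by
    intro r hr
    obtain ⟨a, b, hb, h, ha⟩ := hR r
    have hab : (r : F) * b ∈ w.ring.nonunits := h ▸ (mem_center hw a).mp (ha hr)
    rw [mem_center, ValuationSubring.mem_nonunits_iff, not_lt] at hb
    rw [ValuationSubring.mem_nonunits_iff, map_mul] at hab
    exact (le_mul_of_one_le_right' hb).trans_lt hab
  obtain ⟨r, rfl⟩ := exists_algebraMap_eq_of_dominates (R := R) w.ring hdom hx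
  obtain ⟨a, b, hb, h, -⟩ := hR r
  exact ⟨a, b, hb, h⟩

lemma isLocalization_center {w : Place K F} (hw : w.comap E = v) :
    letI := (intClToRing hw).toAlgebra
    IsLocalization.AtPrime w.ring (center hw) := by
  let := (intClToRing hw).toAlgebra
  refine (isLocalization_iff _ _).mpr ⟨fun b => ?_, fun x => ?_, fun {x y} h => ⟨1, ?_⟩⟩
  · by_contra h
    exact b.2 ((IsLocalRing.mem_maximalIdeal _).mpr h)
  · obtain ⟨a, b, hb, h⟩ := exists_div_of_mem hw x.2
    exact ⟨⟨a, b, hb⟩, Subtype.ext h⟩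
  · rw [show x = y from Subtype.ext (congrArg (Subtype.val : w.ring → F) h)]

lemma isDiscreteValuationRing {w : Place K F} (hw : w.comap E = v) :
    IsDiscreteValuationRing w.ring := by
  let := (intClToRing hw).toAlgebra
  have := isLocalization_center hw
  exact IsLocalization.AtPrime.isDiscreteValuationRing_of_dedekind_domain _ (center_ne_bot hw) _

instance {w : Place K F} (hw : w.comap E = v) : (center hw).IsMaximal :=
  Ideal.IsPrime.isMaximal inferInstance (center_ne_bot hw)

lemma mem_center_pow {w : Place K F} (hw : w.comap E = v) (n : ℕ) (b : v.intCl F) :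
    b ∈ center hw ^ n ↔ intClToRing hw b ∈ IsLocalRing.maximalIdeal w.ring ^ n := by
  let := (intClToRing hw).toAlgebra
  have := isLocalization_center hw
  rw [← IsLocalization.AtPrime.under_maximalIdeal_pow (center hw) w.ring n]
  rfl

lemma eq_of_center_eq {w w' : Place K F} (hw : w.comap E = v) (hw' : w'.comap E = v)
    (h : center hw = center hw') : w = w' := by
  have := isDiscreteValuationRing hw
  refine eq_of_le fun x hx => ?_
  obtain ⟨a, b, hb, hab⟩ := exists_div_of_mem hw hx
  have hb0 : (b : F) ≠ 0 := fun hb0 =>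
    hb ((Subtype.ext hb0 : b = 0) ▸ zero_mem _)
  rw [h, mem_center] at hb
  rw [eq_div_of_mul_eq hb0 hab, div_eq_mul_inv]
  exact w'.ring.mul_mem _ _ (intCl_le hw' a) (inv_mem_of_notMem_nonunits hb)

omit [FiniteDimensional E F] [Algebra.IsSeparable E F] in
lemma exists_ring_eq_of_forall_algebraMap_mem [Algebra.IsAlgebraic E F] {V : ValuationSubring F}
    (hV : V ≠ ⊤) (hE : ∀ y ∈ v.ring, algebraMap E F y ∈ V) :
    ∃ w : Place K F, w.ring = V ∧ w.comap E = v := by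
  let w : Place K F := ⟨V, fun a => by
    rw [IsScalarTower.algebraMap_apply K E F]
    exact hE _ (v.algebraMap_mem a), hV⟩
  exact ⟨w, rfl, (eq_of_le (v := v) (w := w.comap E) hE).symm⟩

omit [FiniteDimensional E F] in
lemma exists_center_eq (P : Ideal (v.intCl F)) [hP : P.IsPrime] (hP0 : P ≠ ⊥) :
    ∃ (w : Place K F) (hw : w.comap E = v), center hw = P := by
  obtain ⟨V, hV, hPV⟩ := Ideal.image_subset_nonunits_valuationSubring
    (A := (v.intCl F).toSubring) P hP.ne_top
  obtain ⟨x, hx, hx0⟩ := Submodule.exists_mem_ne_zero_of_ne_bot hP0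
  have hxV : (x : F) ∈ V.nonunits := hPV ⟨x, hx, rfl⟩
  have hVtop : V ≠ ⊤ := by
    rintro rfl
    exact ((ValuationSubring.mem_nonunits_iff_or _).mp hxV).elim (fun h => hx0 (Subtype.ext h))
      fun h => h (ValuationSubring.mem_top _)
  obtain ⟨w, rfl, hw⟩ := exists_ring_eq_of_forall_algebraMap_mem hVtop fun y hy =>
    hV ((v.intCl F).algebraMap_mem ⟨y, hy⟩)
  refine ⟨w, hw, ((hP.isMaximal hP0).eq_of_le (Ideal.IsPrime.ne_top inferInstance)
    fun b hb => ?_).symm⟩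
  exact (mem_center hw b).mpr (hPV ⟨b, hb, rfl⟩)

variable (v)

lemma maximalIdeal_ne_bot : IsLocalRing.maximalIdeal v.ring ≠ ⊥ :=
  IsDiscreteValuationRing.not_a_field _

variable {v}

instance {w : Place K F} (hw : w.comap E = v) :
    (center hw).LiesOver (IsLocalRing.maximalIdeal v.ring) := by
  refine ⟨(IsLocalRing.eq_maximalIdeal ?_).symm⟩
  have : ((center hw).under v.ring).IsMaximal := Ideal.IsMaximal.under _ _
  infer_instance

lemma ram_eq {w : Place K F} (hw : w.comap E = v) :
    w.ram E = Ideal.ramificationIdx' (IsLocalRing.maximalIdeal v.ring) (center hw) := by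
  subst hw
  unfold ram Ideal.ramificationIdx'
  congr 1
  ext n
  simp only [Set.mem_ofPred_eq, Ideal.map_le_iff_le_comap, ← mem_nonunits_iff,
    ← IsLocalRing.mem_maximalIdeal, ← ValuationSubring.coe_mem_nonunits_iff]
  constructor
  · intro h x hx
    rw [Ideal.mem_comap, mem_center_pow]
    exact h x x.2 (mem_nonunits_comap.mp (ValuationSubring.coe_mem_nonunits_iff.mpr hx))
  · intro h x hx hxn
    have hmem := h (x := (⟨x, hx⟩ : (w.comap E).ring))
      (ValuationSubring.coe_mem_nonunits_iff.mp (mem_nonunits_comap.mpr hxn))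
    rwa [Ideal.mem_comap, mem_center_pow] at hmem

end Separable

end Place

lemma exists_sub_mem_of_isAlgClosed {K A B : Type*} [Field K] [IsAlgClosed K] [CommRing A]
    [CommRing B] [Algebra A B] [Algebra.IsIntegral A B] (ι : K →+* A) {m : Ideal A}
    (hι : ∀ x, ∃ a, x - ι a ∈ m) (P : Ideal B) [P.IsPrime] (h : m ≤ P.comap (algebraMap A B))
    (b : B) : ∃ c, b - algebraMap A B (ι c) ∈ P := by
  have hφ : Function.Surjective ((Ideal.Quotient.mk m).comp ι) := by
    intro y
    obtain ⟨y, rfl⟩ := Ideal.Quotient.mk_surjective y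
    obtain ⟨a, ha⟩ := hι y
    exact ⟨a, (Ideal.Quotient.eq.mpr ha).symm⟩
  have hψ : (Ideal.quotientMap P (algebraMap A B) h).IsIntegral := by
    refine RingHom.IsIntegral.tower_top (Ideal.Quotient.mk m) _ ?_
    rw [Ideal.quotientMap_comp_mk]
    exact RingHom.IsIntegral.trans _ _ Algebra.IsIntegral.isIntegral
      (RingHom.isIntegral_of_surjective _ Ideal.Quotient.mk_surjective)
  obtain ⟨c, hc⟩ := (IsAlgClosed.ringHom_bijective_of_isIntegral _
    (RingHom.IsIntegral.trans _ _ (RingHom.isIntegral_of_surjective _ hφ) hψ)).2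
      (Ideal.Quotient.mk _ b)
  refine ⟨c, ?_⟩
  rw [← Ideal.Quotient.eq, ← hc]
  rfl

lemma isIntegral_of_forall_coeff_minpoly_mem {E F : Type*} [Field E] [Field F] [Algebra E F]
    [Algebra.IsIntegral E F] {V : ValuationSubring E} {x : F}
    (h : ∀ n, (minpoly E x).coeff n ∈ V) : IsIntegral V x := by
  have hcoeffs : ↑(minpoly E x).coeffs ⊆ (V.toSubring : Set E) := by
    intro y hy
    obtain ⟨n, -, rfl⟩ := Polynomial.mem_coeffs_iff.mp hy
    exact h n
  refine ⟨(minpoly E x).toSubring _ hcoeffs, (Polynomial.monic_toSubring _ _ hcoeffs).mpr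
    (minpoly.monic (Algebra.IsIntegral.isIntegral x)), ?_⟩
  rw [← minpoly.aeval E x, Polynomial.aeval_def]
  conv_rhs => rw [← Polynomial.map_toSubring (minpoly E x) _ hcoeffs, Polynomial.eval₂_map]
  rfl

namespace Place

variable {K E F : Type*} [Field K] [Field E] [Field F] [Algebra K E] [Algebra K F]
  [Algebra E F] [IsScalarTower K E F] [FiniteDimensional E F] [Algebra.IsSeparable E F]

section Fibre

variable (v : Place K E) [IsDiscreteValuationRing v.ring]

variable (F) in
/-- The places above a place correspond to the maximal ideals of the integral closure. -/
def fibreEquiv : {w : Place K F // w.comap E = v} ≃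
    (IsLocalRing.maximalIdeal v.ring).primesOver (v.intCl F) :=
  Equiv.ofBijective (fun w => ⟨center w.2, inferInstance, inferInstance⟩) <| by
  constructor
  · rintro ⟨w, hw⟩ ⟨w', hw'⟩ h
    exact Subtype.ext (eq_of_center_eq hw hw' (congrArg Subtype.val h))
  · rintro ⟨P, hP, hPv⟩
    obtain ⟨w, hw, rfl⟩ := exists_center_eq P (Ideal.ne_bot_of_liesOver_of_ne_bot
      v.maximalIdeal_ne_bot P)
    exact ⟨⟨w, hw⟩, rfl⟩

instance : Finite ((IsLocalRing.maximalIdeal v.ring).primesOver (v.intCl F)) :=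
  Algebra.QuasiFinite.finite_primesOver _

lemma coe_fibreEquiv (w : {w : Place K F // w.comap E = v}) :
    (fibreEquiv F v w : Ideal (v.intCl F)) = center w.2 := rfl

instance : Finite {w : Place K F // w.comap E = v} := .of_equiv _ (fibreEquiv F v).symm

variable (F) in
lemma finite_fibre : {w : Place K F | w.comap E = v}.Finite :=
  Set.finite_coe_iff.mp (inferInstanceAs (Finite {w : Place K F // w.comap E = v}))

variable (F) in
/-- The places above a place. -/
def fibre (v : Place K E) [IsDiscreteValuationRing v.ring] : Finset (Place K F) :=
  (v.finite_fibre F).toFinset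

variable {v}

@[simp] lemma mem_fibre {w : Place K F} : w ∈ v.fibre F ↔ w.comap E = v := by
  simp [fibre]

lemma ram_pos {w : Place K F} (hw : w.comap E = v) : 0 < w.ram E := by
  rw [ram_eq hw]
  exact Nat.pos_of_ne_zero (Ideal.IsDedekindDomain.ramificationIdx'_ne_zero_of_liesOver _
    v.maximalIdeal_ne_bot)

variable (v) in
omit [FiniteDimensional E F] in
lemma mem_intCl_iff {x : F} : x ∈ v.intCl F ↔ ∀ w : Place K F, w.comap E = v → x ∈ w.ring := by
  refine ⟨fun h w hw => intCl_le hw ⟨x, h⟩, fun h => ?_⟩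
  by_contra hx
  have : IsIntegrallyClosedIn (v.intCl F).toSubring F :=
    inferInstanceAs (IsIntegrallyClosedIn (v.intCl F) F)
  obtain ⟨V, hV, hxV⟩ := Subring.exists_le_valuationSubring_of_isIntegrallyClosedIn
    (R := (v.intCl F).toSubring) hx
  have hVtop : V ≠ ⊤ := by
    rintro rfl
    exact hxV (ValuationSubring.mem_top _)
  obtain ⟨w, rfl, hw⟩ := exists_ring_eq_of_forall_algebraMap_mem hVtop fun y hy =>
    hV ((v.intCl F).algebraMap_mem ⟨y, hy⟩)
  exact hxV (h w hw)

lemma exists_forall_center_pow_div_mem {w : Place K F} (hw : w.comap E = v) {s : v.intCl F}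
    (hs : s ≠ 0) : ∃ n : ℕ, ∀ b ∈ center hw ^ n, (b : F) / s ∈ w.ring := by
  have hs0 : (s : F) ≠ 0 := fun h => hs (Subtype.ext h)
  have := isDiscreteValuationRing hw
  obtain ⟨ϖ, hϖ⟩ := IsDiscreteValuationRing.exists_irreducible w.ring
  obtain ⟨n, u, hu⟩ := IsDiscreteValuationRing.eq_unit_mul_pow_irreducible
    (x := intClToRing hw s) (fun h => hs0 (congrArg Subtype.val h)) hϖ
  refine ⟨n, fun b hb => ?_⟩
  rw [mem_center_pow, hϖ.maximalIdeal_eq, Ideal.span_singleton_pow,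
    Ideal.mem_span_singleton, ← Units.mul_left_dvd (u := u), ← hu] at hb
  obtain ⟨c, hc⟩ := hb
  have hbc : (b : F) = s * c := congrArg Subtype.val hc
  rw [hbc, mul_div_cancel_left₀ _ hs0]
  exact c.2

variable (v) in
/- A common denominator `s` of the finitely many values of `r` at the places above `v` reduces this
to the Chinese remainder theorem in the integral closure, modulo high powers of the centers. -/
lemma exists_sub_mem (r : Place K F → F) :
    ∃ f : F, ∀ w : Place K F, w.comap E = v → r w - f ∈ w.ring := by
  classical
  obtain ⟨⟨s, hs⟩, hsr⟩ := IsLocalization.exist_integer_multiples_of_finset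
    (nonZeroDivisors (v.intCl F)) ((v.fibre F).image r)
  have hs0 : s ≠ 0 := nonZeroDivisors.ne_zero hs
  have hs0' : (s : F) ≠ 0 := fun h => hs0 (Subtype.ext h)
  choose a ha using fun w : {w : Place K F // w.comap E = v} =>
    hsr (r w) (Finset.mem_image_of_mem r (mem_fibre.mpr w.2))
  choose n hn using fun w : {w : Place K F // w.comap E = v} =>
    exists_forall_center_pow_div_mem w.2 hs0
  have := Fintype.ofFinite {w : Place K F // w.comap E = v}
  obtain ⟨y, hy⟩ := IsDedekindDomain.exists_forall_sub_mem_ideal (s := Finset.univ)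
    (fun w : {w : Place K F // w.comap E = v} => center w.2) n
    (fun w _ => Ideal.prime_of_isPrime (center_ne_bot w.2) inferInstance)
    (fun w _ w' _ hww' h => hww' (Subtype.ext (eq_of_center_eq w.2 w'.2 h))) (fun w => a w)
  refine ⟨(y : F) / s, fun w hw => ?_⟩
  have hya := hn ⟨w, hw⟩ _ (hy ⟨w, hw⟩ (Finset.mem_univ _))
  have har : (a ⟨w, hw⟩ : F) = s * r w := (ha ⟨w, hw⟩).trans (by rw [Algebra.smul_def]; rfl)
  have hsub : r w - (y : F) / s = -(((y : F) - a ⟨w, hw⟩) / s) := by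
    rw [har]
    field_simp
    ring
  rw [hsub]
  exact neg_mem hya

variable [IsAlgClosed K] (hv : ∀ x ∈ v.ring, ∃ a : K, x - algebraMap K E a ∈ v.ring.nonunits)

include hv in
lemma exists_sub_mem_center {w : Place K F} (hw : w.comap E = v) (b : v.intCl F) :
    ∃ a : v.ring, (∃ c : K, algebraMap K E c = a) ∧
      b - algebraMap v.ring (v.intCl F) a ∈ center hw := by
  let ι : K →+* v.ring := (algebraMap K E).codRestrict v.ring.toSubring v.algebraMap_mem
  obtain ⟨c, hc⟩ := exists_sub_mem_of_isAlgClosed ι (m := IsLocalRing.maximalIdeal v.ring)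
    (fun y => (hv y y.2).imp fun a ha =>
      (ValuationSubring.mem_nonunits_iff_exists_mem_maximalIdeal.mp ha).2) (center hw)
    (Ideal.LiesOver.over (P := center hw) (p := IsLocalRing.maximalIdeal v.ring)).le b
  exact ⟨ι c, ⟨c, rfl⟩, hc⟩

include hv in
lemma inertiaDeg_center {w : Place K F} (hw : w.comap E = v) :
    (center hw).inertiaDeg v.ring = 1 := by
  rw [Ideal.inertiaDeg_eq_of_isMaximal (IsLocalRing.maximalIdeal v.ring)]
  let := Ideal.Quotient.field (IsLocalRing.maximalIdeal v.ring)
  rw [finrank_eq_one_iff_of_nonzero' 1 one_ne_zero]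
  intro y
  obtain ⟨b, rfl⟩ := Ideal.Quotient.mk_surjective y
  obtain ⟨a, -, ha⟩ := exists_sub_mem_center hv hw b
  refine ⟨Ideal.Quotient.mk _ a, ?_⟩
  rw [← Algebra.algebraMap_eq_smul_one, eq_comm]
  exact Ideal.Quotient.eq.mpr ha

include hv in
lemma sum_ram : ∑ w ∈ v.fibre F, w.ram E = Module.finrank E F := by
  have := Fintype.ofFinite {w : Place K F // w.comap E = v}
  have := Fintype.ofFinite ((IsLocalRing.maximalIdeal v.ring).primesOver (v.intCl F))
  rw [IsFractionRing.finrank_eq v.ring E (v.intCl F) F,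
    ← Ideal.sum_ramification_inertia_eq_finrank (IsLocalRing.maximalIdeal v.ring),
    Finset.sum_subtype (p := fun w => w.comap E = v) (v.fibre F) (fun w => mem_fibre)]
  refine Fintype.sum_equiv (fibreEquiv F v) _ _ fun w => ?_
  rw [coe_fibreEquiv, inertiaDeg_center hv, mul_one, ram_eq w.2,
    Ideal.ramificationIdx'_eq_ramificationIdx _ _ v.maximalIdeal_ne_bot]

include hv in
lemma residue_of_comap {w : Place K F} (hw : w.comap E = v) {x : F} (hx : x ∈ w.ring) :
    ∃ a : K, x - algebraMap K F a ∈ w.ring.nonunits := by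
  have h : ∀ b : v.intCl F, ∃ c : K, (b : F) - algebraMap K F c ∈ w.ring.nonunits := by
    intro b
    obtain ⟨a, ⟨c, hc⟩, ha⟩ := exists_sub_mem_center hv hw b
    refine ⟨c, ?_⟩
    rw [mem_center] at ha
    rw [IsScalarTower.algebraMap_apply K E F, hc]
    exact ha
  obtain ⟨a, b, hb, hab⟩ := exists_div_of_mem hw hx
  obtain ⟨c, hc⟩ := h a
  obtain ⟨d, hd⟩ := h b
  rw [mem_center] at hb
  have hd0 : algebraMap K F d ≠ 0 := by
    intro h0
    rw [h0, sub_zero] at hd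
    exact hb hd
  rw [ValuationSubring.mem_nonunits_iff] at hb hc hd
  refine ⟨c / d, (ValuationSubring.mem_nonunits_iff _).mpr ?_⟩
  have hmul : (x - algebraMap K F (c / d)) * b =
      ((a : F) - algebraMap K F c) - algebraMap K F (c / d) * (b - algebraMap K F d) := by
    rw [map_div₀, ← hab]
    field_simp
    ring
  have hlt : w.ring.valuation ((x - algebraMap K F (c / d)) * b) < 1 := by
    rw [hmul]
    refine Valuation.map_sub_lt _ hc ?_
    rw [map_mul]
    exact mul_lt_one_of_nonneg_of_lt_one_right
      ((w.ring.valuation_le_one_iff _).mpr (w.algebraMap_mem _)) zero_le hd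
  rw [map_mul] at hlt
  exact (le_mul_of_one_le_right' (not_lt.mp hb)).trans_lt hlt

end Fibre

end Place

section CurveField

variable {K E F : Type*} [Field K] [Field E] [Field F] [Algebra K E] [Algebra K F]
  [Algebra E F] [IsScalarTower K E F] [FiniteDimensional E F] [Algebra.IsSeparable E F]
  [IsAlgClosed K]

variable (K E F) in
lemma IsCurveField.of_finite_separable [IsCurveField K E] : IsCurveField K F where
  dvr w := Place.isDiscreteValuationRing (E := E) (w := w) rfl
  residue w x hx := Place.residue_of_comap (E := E) (w := w)
    (IsCurveField.residue (w.comap E)) rfl hx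
  finite x := by
    let bad : Set (Place K E) :=
      ⋃ n ∈ (minpoly E x).support, {v | (minpoly E x).coeff n ∉ v.ring}
    have hbad : bad.Finite :=
      (minpoly E x).support.finite_toSet.biUnion fun n _ => IsCurveField.finite _
    refine (hbad.biUnion fun v _ => v.finite_fibre F).subset fun w hw => ?_
    refine Set.mem_biUnion (x := w.comap E) (of_not_not fun hgood => hw ?_) rfl
    refine Place.intCl_le rfl ⟨x, isIntegral_of_forall_coeff_minpoly_mem (E := E) fun n => ?_⟩
    by_cases hn : n ∈ (minpoly E x).support
    · exact of_not_not fun hcoeff => hgood (Set.mem_biUnion hn hcoeff)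
    · rw [Polynomial.notMem_support_iff.mp hn]
      exact zero_mem _

lemma Place.hasFibreSum_ram [IsCurveField K E] :
    HasFibreSum (fun w : Place K F => w.comap E) (fun w => w.ram E) (Module.finrank E F) :=
  fun v => ⟨v.fibre F, fun _ => mem_fibre, sum_ram (IsCurveField.residue v)⟩

lemma Place.exists_notMem_of_notMem_range {x : F} (hx : x ∉ Set.range (algebraMap K F)) :
    ∃ w : Place K F, x ∉ w.ring := by
  have : IsIntegrallyClosedIn (⊥ : Subalgebra K F).toSubring F := by
    change IsIntegrallyClosedIn (⊥ : Subalgebra K F) F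
    rw [isIntegrallyClosedIn_iff]
    refine ⟨Subtype.val_injective, fun {y} hy => ?_⟩
    have hy' : IsIntegral K y := isIntegral_trans (A := (⊥ : Subalgebra K F)) y hy
    obtain ⟨a, rfl⟩ := minpoly.mem_range_of_degree_eq_one K y
      (IsAlgClosed.degree_eq_one_of_irreducible K (minpoly.irreducible hy'))
    exact ⟨algebraMap K _ a, rfl⟩
  obtain ⟨V, hV, hxV⟩ := Subring.exists_le_valuationSubring_of_isIntegrallyClosedIn
    (R := (⊥ : Subalgebra K F).toSubring) (x := x) hx
  exact ⟨⟨V, fun a => hV ⟨a, rfl⟩, by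
    rintro rfl
    exact hxV (ValuationSubring.mem_top _)⟩, hxV⟩

variable (K F) in
lemma hZero_lattice [Nonempty (Place K F)] : hZero (Place.lattice : Place K F → _) = 1 := by
  rw [← relLength_bot_top_self K]
  refine (relLength_eq_of_map (LinearMap.pi fun _ => Algebra.linearMap K F) ?_ ?_ ?_).symm
  · exact fun a _ => ⟨fun w _ => w.algebraMap_mem a, ⟨algebraMap K F a, rfl⟩⟩
  · intro a _
    simp [funext_iff]
  · rintro _ ⟨hr, ⟨x, rfl⟩⟩
    by_cases hx : x ∈ Set.range (algebraMap K F)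
    · obtain ⟨a, rfl⟩ := hx
      refine ⟨a, trivial, ?_⟩
      rw [Submodule.mem_bot, sub_eq_zero]
      rfl
    · obtain ⟨w, hw⟩ := Place.exists_notMem_of_notMem_range (K := K) hx
      exact absurd (hr w trivial) hw

variable (F) in
/-- The integral closure of the valuation ring of a place as a module over that ring. -/
abbrev Place.intClModule (v : Place K E) : Submodule v.ring F :=
  Subalgebra.toSubmodule (v.intCl F)

variable (F) in
/-- The family of integral closures as a family of lattices on the places of the base. -/
abbrev intClLattice (v : Place K E) : Submodule K F := (v.intClModule F).restrictScalars K

omit [IsAlgClosed K] in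
lemma hOne_intClLattice [IsCurveField K E] :
    hOne (intClLattice F : Place K E → Submodule K F) = hOne (Place.lattice : Place K F → _) :=
  hOne_eq_of_map (e := .refl K F) (σ := fun w => w.comap E)
    (fun _ v => Place.mem_intCl_iff v) (fun v => v.finite_fibre F)
    fun v r _ => Place.exists_sub_mem v r

omit [FiniteDimensional E F] [IsAlgClosed K] in
lemma Place.comap_surjective [IsCurveField K E] :
    Function.Surjective (fun w : Place K F => w.comap E) := by
  intro v
  by_contra! h
  obtain ⟨x, hx⟩ := v.exists_notMem
  have hint : algebraMap E F x ∈ v.intCl F :=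
    (Place.mem_intCl_iff v).mpr fun w hw => absurd hw (h w)
  exact hx (mem_of_isIntegral
    ((isIntegral_algebraMap_iff (algebraMap E F).injective).mp hint))

omit [FiniteDimensional E F] [IsAlgClosed K] in
lemma hZero_intClLattice [IsCurveField K E] :
    hZero (intClLattice F : Place K E → Submodule K F) = hZero (Place.lattice : Place K F → _) :=
  hZero_eq_of_map (e := .refl K F) (fun _ v => Place.mem_intCl_iff v) Place.comap_surjective

lemma memAlmostAll_intClLattice [IsCurveField K E] :
    MemAlmostAll (intClLattice F : Place K E → Submodule K F) := by
  intro x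
  have := IsCurveField.of_finite_separable K E F
  refine ((IsCurveField.finite (K := K) x).image fun w => w.comap E).subset fun v hv => ?_
  obtain ⟨w, hw, hx⟩ : ∃ w : Place K F, w.comap E = v ∧ x ∉ w.ring := by
    by_contra! h
    exact hv ((Place.mem_intCl_iff v).mpr h)
  exact ⟨w, hx, hw⟩

end CurveField

/-! ### Duality of lattices over a valuation ring -/

section Duality

variable {K E F : Type*} [Field K] [Field E] [Field F] [Algebra K E] [Algebra K F]
  [Algebra E F] [IsScalarTower K E F]

namespace Place

variable {v : Place K E}

lemma mem_one_iff {y : E} : y ∈ (1 : Submodule v.ring E) ↔ y ∈ v.ring := by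
  rw [Submodule.mem_one]
  exact ⟨fun ⟨a, ha⟩ => ha ▸ a.2, fun h => ⟨⟨y, h⟩, rfl⟩⟩

lemma mem_nonunits_of_mul {x y : E} (hx : x ∈ v.ring.nonunits) (hy : y ∈ v.ring) :
    x * y ∈ v.ring.nonunits := by
  rw [ValuationSubring.mem_nonunits_iff] at hx ⊢
  rw [map_mul]
  exact mul_lt_one_of_lt_of_le hx ((v.ring.valuation_le_one_iff y).mpr hy)

lemma algebraMap_mem_nonunits {a : K} (ha : algebraMap K E a ∈ v.ring.nonunits) : a = 0 := by
  refine (map_eq_zero (algebraMap K E)).mp ((v.ring.mem_nonunits_iff_or.mp ha).resolve_right ?_)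
  rw [← map_inv₀]
  exact not_not_intro (v.algebraMap_mem a⁻¹)

lemma coe_ne_zero_of_irreducible {ϖ : v.ring} (hϖ : Irreducible ϖ) : (ϖ : E) ≠ 0 := by
  simpa using hϖ.ne_zero

lemma inv_mul_mem_iff_mem_nonunits [IsDiscreteValuationRing v.ring] {ϖ : v.ring}
    (hϖ : Irreducible ϖ) {x : E} : (ϖ : E)⁻¹ * x ∈ v.ring ↔ x ∈ v.ring.nonunits := by
  have hϖ0 := coe_ne_zero_of_irreducible hϖ
  rw [ValuationSubring.mem_nonunits_iff_exists_mem_maximalIdeal, hϖ.maximalIdeal_eq]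
  simp only [Ideal.mem_span_singleton]
  constructor
  · intro h
    have hx : x = ϖ * ((ϖ : E)⁻¹ * x) := (mul_inv_cancel_left₀ hϖ0 x).symm
    exact ⟨hx ▸ v.ring.mul_mem _ _ ϖ.2 h, ⟨_, h⟩, Subtype.ext hx⟩
  · rintro ⟨hx, y, hy⟩
    rw [show x = ϖ * y from congrArg Subtype.val hy, inv_mul_cancel_left₀ hϖ0]
    exact y.2

/- Any functional killing the valuation ring but not the inverse of a uniformizer is a dualizing
functional, since the inverse of a uniformizer is a multiple of every `y` outside the ring. -/
lemma exists_dual (v : Place K E) [IsDiscreteValuationRing v.ring] :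
    ∃ l : E →ₗ[K] K, (∀ y ∈ v.ring, l y = 0) ∧
      ∀ y, (∀ a ∈ v.ring, l (a * y) = 0) → y ∈ v.ring := by
  obtain ⟨ϖ, hϖ⟩ := IsDiscreteValuationRing.exists_irreducible v.ring
  have hinv : (ϖ : E)⁻¹ ∉ v.lattice := fun h => hϖ.not_isUnit <| .of_mul_eq_one ⟨_, h⟩ <|
    Subtype.ext (mul_inv_cancel₀ (coe_ne_zero_of_irreducible hϖ))
  obtain ⟨l, hl, hl'⟩ := Submodule.exists_dual_map_eq_bot_of_notMem hinv inferInstance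
  refine ⟨l, fun y hy => (Submodule.mem_bot K).mp (hl' ▸ ⟨y, hy, rfl⟩), fun y hy => ?_⟩
  by_contra hyv
  have hy0 : y ≠ 0 := fun h => hyv (h ▸ v.ring.zero_mem)
  have hynonunit : y⁻¹ ∈ v.ring.nonunits :=
    v.ring.inv_mem_nonunits_iff.mpr (Or.inr hyv)
  apply hl
  simpa [hy0] using hy _ ((inv_mul_mem_iff_mem_nonunits hϖ).mpr hynonunit)

end Place

lemma relLength_dualSubmodule_le {v : Place K E} [IsDiscreteValuationRing v.ring]
    (B : LinearMap.BilinForm E F) (N M : Submodule v.ring F) :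
    relLength ((B.dualSubmodule M).restrictScalars K) ((B.dualSubmodule N).restrictScalars K) ≤
      relLength (N.restrictScalars K) (M.restrictScalars K) := by
  by_cases hfin : relLength (N.restrictScalars K) (M.restrictScalars K) = ⊤
  · exact hfin ▸ le_top
  obtain ⟨l, hl, hl'⟩ := v.exists_dual
  let W : Submodule K (M.restrictScalars K) :=
    (N.restrictScalars K).comap (M.restrictScalars K).subtype
  have : Module.Finite K (M.restrictScalars K ⧸ W) :=
    have := (isFiniteLength_iff_isNoetherian_isArtinian.mp (Module.length_ne_top_iff.mp hfin)).1
    inferInstance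
  let Φ : F →ₗ[K] Module.Dual K (M.restrictScalars K) :=
    { toFun x := l ∘ₗ ((B x).restrictScalars K) ∘ₗ (M.restrictScalars K).subtype
      map_add' x y := by ext; simp
      map_smul' c x := by
        ext m
        simp only [LinearMap.comp_apply, LinearMap.restrictScalars_apply, RingHom.id_apply,
          LinearMap.smul_apply, ← algebraMap_smul E c x, map_smul]
        rw [algebraMap_smul, map_smul] }
  calc _ ≤ relLength ⊥ W.dualAnnihilator := relLength_le_of_map Φ ?_ ?_
    _ = relLength (N.restrictScalars K) (M.restrictScalars K) := by
      rw [relLength_bot_left, ← W.dualQuotEquivDualAnnihilator.length_eq, relLength,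
        Module.length_eq_finrank, Module.length_eq_finrank, Subspace.dual_finrank_eq]
  · intro x hx
    rw [Submodule.mem_dualAnnihilator]
    exact fun m hm => hl _ (Place.mem_one_iff.mp (hx m hm))
  · intro x _ hx0 m hm
    refine Place.mem_one_iff.mpr (hl' _ fun a ha => ?_)
    have hBsmul : B x ((⟨a, ha⟩ : v.ring) • m) = a * B x m :=
      (B x).map_smul a m
    rw [← hBsmul]
    exact LinearMap.congr_fun hx0 ⟨(⟨a, ha⟩ : v.ring) • m, M.smul_mem _ hm⟩

namespace Place

/-- The multiples of a nonzero `s` by the elements of the valuation ring; everything for `s = 0`. -/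
def scaled (v : Place K E) (s : E) : Submodule K E := v.lattice.comap (LinearMap.mulLeft K s⁻¹)

variable {v : Place K E}

lemma mem_scaled {s x : E} : x ∈ v.scaled s ↔ s⁻¹ * x ∈ v.ring := Iff.rfl

lemma scaled_one : v.scaled 1 = v.lattice := by
  ext x
  simp [mem_scaled]

lemma scaled_mul_of_unit {s : E} (u : v.ringˣ) : v.scaled (s * (u : v.ring)) = v.scaled s := by
  ext x
  have hu : (((u⁻¹ : v.ringˣ) : v.ring) : E) = ((u : v.ring) : E)⁻¹ :=
    eq_inv_of_mul_eq_one_left (by exact_mod_cast u.inv_mul)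
  have hu0 : ((u : v.ring) : E) ≠ 0 := by simp
  rw [mem_scaled, mem_scaled, mul_inv_rev, mul_assoc, ← hu]
  refine ⟨fun h => ?_, v.ring.mul_mem _ _ (Subtype.prop _)⟩
  simpa [hu, hu0] using v.ring.mul_mem _ _ (u : v.ring).2 h

lemma scaled_mul_le {s a : E} (ha : a ∈ v.ring) (ha0 : a ≠ 0) : v.scaled (s * a) ≤ v.scaled s := by
  intro x hx
  rw [mem_scaled, mul_inv_rev, mul_assoc] at hx
  rw [mem_scaled, ← mul_inv_cancel_left₀ ha0 (s⁻¹ * x)]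
  exact v.ring.mul_mem _ _ ha hx

end Place

variable [IsCurveField K E] (v : Place K E) {ϖ : v.ring} (hϖ : Irreducible ϖ) {s : E}

include hϖ in
lemma relLength_scaled_mul (hs : s ≠ 0) : relLength (v.scaled (s * ϖ)) (v.scaled s) = 1 := by
  have hmem : ∀ x, x ∈ v.scaled (s * ϖ) ↔ s⁻¹ * x ∈ v.ring.nonunits := fun x => by
    rw [Place.mem_scaled, mul_inv_rev, mul_assoc, Place.inv_mul_mem_iff_mem_nonunits hϖ]
  rw [← relLength_bot_top_self K]
  refine (relLength_eq_of_map ((LinearMap.mulLeft K s) ∘ₗ Algebra.linearMap K E) ?_ ?_ ?_).symm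
  · intro a _
    simpa [Place.mem_scaled, hs] using v.algebraMap_mem a
  · intro a _
    rw [hmem]
    simp only [LinearMap.comp_apply, LinearMap.mulLeft_apply, Algebra.linearMap_apply,
      inv_mul_cancel_left₀ hs, Submodule.mem_bot]
    exact ⟨Place.algebraMap_mem_nonunits, fun h => by simp [h]⟩
  · intro y hy
    obtain ⟨a, ha⟩ := IsCurveField.residue v _ hy
    refine ⟨a, trivial, ?_⟩
    rw [hmem]
    simpa [mul_sub, hs] using ha

include hϖ in
lemma relLength_scaled_mul_pow (hs : s ≠ 0) (n : ℕ) :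
    relLength (v.scaled (s * (ϖ : E) ^ n)) (v.scaled s) = n := by
  have hϖ0 := Place.coe_ne_zero_of_irreducible hϖ
  induction n with
  | zero => simp [relLength_eq_zero_of_le]
  | succ n ih =>
    rw [pow_succ, ← mul_assoc, relLength_add (Place.scaled_mul_le ϖ.2 hϖ0)
      (Place.scaled_mul_le (pow_mem ϖ.2 n) (pow_ne_zero n hϖ0)), ih,
      relLength_scaled_mul v hϖ (mul_ne_zero hs (pow_ne_zero n hϖ0)), Nat.cast_succ, add_comm]

lemma relLength_scaled_ne_top (hs : s ∈ v.ring) (hs0 : s ≠ 0) :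
    relLength (v.scaled s) v.lattice ≠ ⊤ := by
  obtain ⟨ϖ, hϖ⟩ := IsDiscreteValuationRing.exists_irreducible v.ring
  obtain ⟨n, u, hu⟩ := IsDiscreteValuationRing.eq_unit_mul_pow_irreducible
    (x := (⟨s, hs⟩ : v.ring)) (by simpa [Subtype.ext_iff] using hs0) hϖ
  have hs' : s = 1 * (ϖ : E) ^ n * (u : v.ring) := by
    rw [one_mul, mul_comm]
    exact congrArg Subtype.val hu
  rw [hs', Place.scaled_mul_of_unit, ← Place.scaled_one, relLength_scaled_mul_pow v hϖ one_ne_zero]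
  exact ENat.natCast_ne_top n

end Duality

section SpanBasis

variable {K E F : Type*} [Field K] [Field E] [Field F] [Algebra K E] [Algebra K F]
  [Algebra E F] [IsScalarTower K E F] {ι κ : Type*}

omit [Algebra K F] [IsScalarTower K E F] in
lemma mem_span_basis_iff {v : Place K E} (b : Module.Basis ι E F) {x : F} :
    x ∈ Submodule.span v.ring (Set.range b) ↔ ∀ i, b.repr x i ∈ v.ring := by
  rw [Module.Basis.mem_span_iff_repr_mem]
  exact forall_congr' fun i => ⟨fun ⟨a, ha⟩ => ha ▸ a.2, fun h => ⟨⟨_, h⟩, rfl⟩⟩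

lemma Place.exists_mul_mem [Finite ι] (v : Place K E) (f : ι → E) :
    ∃ s ∈ v.ring, s ≠ 0 ∧ ∀ i, s * f i ∈ v.ring := by
  cases nonempty_fintype ι
  obtain ⟨⟨s, hs⟩, h⟩ := IsLocalization.exist_integer_multiples (nonZeroDivisors v.ring)
    Finset.univ f
  refine ⟨s, s.2, by simpa using nonZeroDivisors.ne_zero hs, fun i => ?_⟩
  obtain ⟨a, ha⟩ := h i (Finset.mem_univ i)
  have hmul : (a : E) = s * f i := ha.trans (Algebra.smul_def _ _)
  exact hmul ▸ a.2

lemma relLength_span_basis_ne_top [Finite ι] [Finite κ] [IsCurveField K E] (v : Place K E)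
    (b : Module.Basis ι E F) (c : Module.Basis κ E F) :
    relLength ((Submodule.span v.ring (Set.range b)).restrictScalars K)
      ((Submodule.span v.ring (Set.range c)).restrictScalars K) ≠ ⊤ := by
  cases nonempty_fintype κ
  obtain ⟨s, hs, hs0, hmem⟩ := v.exists_mul_mem fun ij : ι × κ => b.repr (c ij.2) ij.1
  have hle : relLength ((Submodule.span v.ring (Set.range b)).restrictScalars K)
      ((Submodule.span v.ring (Set.range c)).restrictScalars K) ≤
      relLength (Submodule.pi Set.univ fun _ : κ => v.scaled s)
        (Submodule.pi Set.univ fun _ : κ => v.lattice) := by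
    refine relLength_le_of_map (c.equivFun.restrictScalars K).toLinearMap ?_ ?_
    · exact fun x hx i _ => (mem_span_basis_iff c).mp hx i
    · intro x _ hx
      rw [Submodule.restrictScalars_mem, ← c.sum_repr x]
      refine sum_mem fun j _ => (mem_span_basis_iff b).mpr fun i => ?_
      have hrepr : b.repr (c.repr x j • c j) i = (s⁻¹ * c.repr x j) * (s * b.repr (c j) i) := by
        rw [map_smul, Finsupp.smul_apply, smul_eq_mul]
        field_simp
      rw [hrepr]
      exact v.ring.mul_mem _ _ (hx j trivial) (hmem (i, j))
  refine ne_top_of_le_ne_top ?_ hle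
  rw [relLength_pi_const]
  exact WithTop.mul_ne_top (ENat.natCast_ne_top _) (relLength_scaled_ne_top v hs hs0)

lemma relLength_dualSubmodule_span [Finite ι] [Finite κ] {v : Place K E}
    [IsDiscreteValuationRing v.ring] {B : LinearMap.BilinForm E F} (hB : B.Nondegenerate)
    (hsymm : B.IsSymm) (b : Module.Basis ι E F) (c : Module.Basis κ E F) :
    relLength ((B.dualSubmodule (Submodule.span v.ring (Set.range c))).restrictScalars K)
        ((B.dualSubmodule (Submodule.span v.ring (Set.range b))).restrictScalars K) =
      relLength ((Submodule.span v.ring (Set.range b)).restrictScalars K)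
        ((Submodule.span v.ring (Set.range c)).restrictScalars K) := by
  refine le_antisymm (relLength_dualSubmodule_le B _ _) ?_
  simpa only [B.dualSubmodule_dualSubmodule_of_basis hB hsymm] using
    relLength_dualSubmodule_le B (B.dualSubmodule (Submodule.span v.ring (Set.range c)))
      (B.dualSubmodule (Submodule.span v.ring (Set.range b)))

end SpanBasis

section Different

variable {K E F : Type*} [Field K] [Field E] [Field F] [Algebra K E] [Algebra K F]
  [Algebra E F] [IsScalarTower K E F] [FiniteDimensional E F] [Algebra.IsSeparable E F]

instance (v : Place K E) :
    IsLocalization (Algebra.algebraMapSubmonoid (v.intCl F) (nonZeroDivisors v.ring)) F :=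
  IsIntegralClosure.isLocalization v.ring E F _

namespace Place

omit [Algebra K F] [IsScalarTower K E F] in
variable (F) in
lemma exists_basis_intClModule (v : Place K E) [IsDiscreteValuationRing v.ring] :
    ∃ c : Module.Basis (Fin (Module.finrank E F)) E F,
      Submodule.span v.ring (Set.range c) = v.intClModule F := by
  let c := (Module.finBasis v.ring (v.intCl F)).localizationLocalization E
    (nonZeroDivisors v.ring) F
  have hcard : Module.finrank v.ring (v.intCl F) = Module.finrank E F := by
    rw [Module.finrank_eq_card_basis c, Fintype.card_fin]
  refine ⟨c.reindex (finCongr hcard), ?_⟩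
  rw [Module.Basis.range_reindex, Module.Basis.localizationLocalization_span]
  ext x
  simp only [LinearMap.mem_range, Subalgebra.mem_toSubmodule]
  exact ⟨fun ⟨y, hy⟩ => hy ▸ y.2, fun h => ⟨⟨x, h⟩, rfl⟩⟩

variable {v : Place K E}

omit [Algebra K F] [IsScalarTower K E F] [Algebra.IsSeparable E F] in
lemma intClModule_le_dualSubmodule :
    v.intClModule F ≤ (Algebra.traceForm E F).dualSubmodule (v.intClModule F) :=
  fun _ hx _ hy =>
    mem_one_iff.mpr (mem_of_isIntegral (Algebra.isIntegral_trace ((v.intCl F).mul_mem hx hy)))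

variable [IsDiscreteValuationRing v.ring]

omit [FiniteDimensional E F] in
lemma mem_radical_map_maximalIdeal {y : v.intCl F}
    (hy : ∀ w : Place K F, w.comap E = v → (y : F) ∈ w.ring.nonunits) :
    y ∈ (Ideal.map (algebraMap v.ring (v.intCl F))
      (IsLocalRing.maximalIdeal v.ring)).radical := by
  rw [Ideal.radical_eq_sInf, Ideal.mem_sInf]
  rintro P ⟨hP, _⟩
  have hinj : Function.Injective (algebraMap v.ring (v.intCl F)) := fun a b hab =>
    Subtype.ext ((algebraMap E F).injective (congrArg Subtype.val hab))
  have hP0 : P ≠ ⊥ := by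
    rintro rfl
    exact v.maximalIdeal_ne_bot
      ((Ideal.map_eq_bot_iff_of_injective hinj).mp (le_bot_iff.mp hP))
  obtain ⟨w, hw, rfl⟩ := exists_center_eq P hP0
  exact (mem_center hw y).mpr (hy w hw)

/- Such an element is nilpotent modulo the maximal ideal of the base, so its trace vanishes
there. -/
lemma trace_mem_nonunits {x : F}
    (hx : ∀ w : Place K F, w.comap E = v → x ∈ w.ring.nonunits) :
    Algebra.trace E F x ∈ v.ring.nonunits := by
  have hint : x ∈ v.intCl F := (mem_intCl_iff v).mpr fun w hw => w.ring.nonunits_le (hx w hw)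
  let y : v.intCl F := ⟨x, hint⟩
  let I := Ideal.map (algebraMap v.ring (v.intCl F)) (IsLocalRing.maximalIdeal v.ring)
  have hnil : IsNilpotent (Ideal.Quotient.mk I y) := by
    obtain ⟨n, hn⟩ := mem_radical_map_maximalIdeal (y := y) hx
    exact ⟨n, by rwa [← map_pow, Ideal.Quotient.eq_zero_iff_mem]⟩
  let := Ideal.Quotient.field (IsLocalRing.maximalIdeal v.ring)
  have htrace : Algebra.trace (v.ring ⧸ IsLocalRing.maximalIdeal v.ring) (v.intCl F ⧸ I)
      (Ideal.Quotient.mk I y) = 0 := (Algebra.isNilpotent_trace_of_isNilpotent hnil).eq_zero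
  rw [Algebra.trace_quotient_mk, Ideal.Quotient.eq_zero_iff_mem] at htrace
  have hloc : Algebra.trace E F x = algebraMap v.ring E (Algebra.trace v.ring (v.intCl F) y) :=
    Algebra.trace_localization v.ring (nonZeroDivisors v.ring) (Rₘ := E) (Sₘ := F) y
  rw [ValuationSubring.mem_nonunits_iff_exists_mem_maximalIdeal, hloc]
  exact ⟨Subtype.prop _, htrace⟩

lemma coe_mem_maximalIdeal_pow_ram {w : Place K F} (hw : w.comap E = v) {x : v.ring}
    (hx : x ∈ IsLocalRing.maximalIdeal v.ring) :
    ∃ h : algebraMap E F x ∈ w.ring,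
      (⟨_, h⟩ : w.ring) ∈ IsLocalRing.maximalIdeal w.ring ^ w.ram E := by
  have h := Ideal.le_pow_ramificationIdx' (p := IsLocalRing.maximalIdeal v.ring)
    (P := center hw) (Ideal.mem_map_of_mem _ hx)
  rw [← ram_eq hw, mem_center_pow] at h
  exact ⟨_, h⟩

end Place

section PoleLattice

variable (w : Place K F) (n : ℕ)

/-- The space of elements having a pole of order at most `n` at a place. -/
def Place.poleLattice : Submodule K F where
  carrier := {x | ∀ a ∈ IsLocalRing.maximalIdeal w.ring ^ n, (a : F) * x ∈ w.ring}
  add_mem' hx hy a ha := by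
    rw [mul_add]
    exact add_mem (hx a ha) (hy a ha)
  zero_mem' a _ := by
    rw [mul_zero]
    exact zero_mem _
  smul_mem' c x hx a ha := by
    rw [mul_smul_comm]
    exact w.lattice.smul_mem c (hx a ha)

variable {w n}

lemma Place.lattice_le_poleLattice : w.lattice ≤ w.poleLattice n :=
  fun _ hx a _ => mul_mem a.2 hx

lemma Place.mem_poleLattice_iff [IsDiscreteValuationRing w.ring] {t : w.ring}
    (ht : Irreducible t) {x : F} : x ∈ w.poleLattice n ↔ (t : F) ^ n * x ∈ w.ring := by
  change (∀ a ∈ IsLocalRing.maximalIdeal w.ring ^ n, (a : F) * x ∈ w.ring) ↔ _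
  simp only [ht.maximalIdeal_eq, Ideal.span_singleton_pow, Ideal.mem_span_singleton]
  refine ⟨fun h => h (t ^ n) dvd_rfl, ?_⟩
  rintro h _ ⟨z, rfl⟩
  have hmem := mul_mem z.2 h
  rwa [← mul_assoc, mul_comm (z : F)] at hmem

lemma Place.mul_mem_nonunits_of_mem_poleLattice [IsDiscreteValuationRing w.ring] {x : F}
    (hx : x ∈ w.poleLattice n) {a : w.ring} (ha : a ∈ IsLocalRing.maximalIdeal w.ring ^ (n + 1)) :
    (a : F) * x ∈ w.ring.nonunits := by
  obtain ⟨t, ht⟩ := IsDiscreteValuationRing.exists_irreducible w.ring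
  rw [ht.maximalIdeal_eq, Ideal.span_singleton_pow, Ideal.mem_span_singleton] at ha
  obtain ⟨z, rfl⟩ := ha
  have hmul : ((t ^ (n + 1) * z : w.ring) : F) * x = t * ((t ^ n * x) * z) := by
    push_cast
    ring
  rw [hmul, ← Place.inv_mul_mem_iff_mem_nonunits ht,
    inv_mul_cancel_left₀ (Place.coe_ne_zero_of_irreducible ht)]
  exact mul_mem ((Place.mem_poleLattice_iff ht).mp hx) z.2

omit [Algebra E F] [IsScalarTower K E F] [FiniteDimensional E F] [Algebra.IsSeparable E F] in
lemma relLength_lattice_poleLattice [IsCurveField K F] (w : Place K F) (n : ℕ) :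
    relLength w.lattice (w.poleLattice n) = n := by
  obtain ⟨t, ht⟩ := IsDiscreteValuationRing.exists_irreducible w.ring
  have htn0 : (t : F) ^ n ≠ 0 := pow_ne_zero n (Place.coe_ne_zero_of_irreducible ht)
  have hpole : w.poleLattice n = w.scaled ((t : F) ^ n)⁻¹ := by
    ext x
    rw [Place.mem_poleLattice_iff ht, Place.mem_scaled, inv_inv]
  have hlattice : w.lattice = w.scaled (((t : F) ^ n)⁻¹ * (t : F) ^ n) := by
    rw [inv_mul_cancel₀ htn0, Place.scaled_one]
  rw [hpole, hlattice, relLength_scaled_mul_pow w ht (inv_ne_zero htn0)]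

end PoleLattice

/-- The space of elements having a pole of order at most `n w` at every place `w` above `v`. -/
def poleBounded (v : Place K E) (n : Place K F → ℕ) : Submodule K F :=
  ⨅ w : {w : Place K F // w.comap E = v}, w.1.poleLattice (n w)

omit [FiniteDimensional E F] in
lemma mem_poleBounded {v : Place K E} {n : Place K F → ℕ} {x : F} :
    x ∈ poleBounded v n ↔ ∀ w : Place K F, w.comap E = v → x ∈ w.poleLattice (n w) := by
  simp [poleBounded]

variable [IsAlgClosed K] [IsCurveField K E]

lemma relLength_intClLattice_poleBounded (v : Place K E) (n : Place K F → ℕ) :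
    relLength (intClLattice F v) (poleBounded v n) = ((∑ w ∈ v.fibre F, n w : ℕ) : ℕ∞) := by
  classical
  have := IsCurveField.of_finite_separable K E F
  let := Fintype.ofFinite {w : Place K F // w.comap E = v}
  rw [Finset.sum_subtype (p := fun w => w.comap E = v) (v.fibre F) (fun w => Place.mem_fibre),
    Nat.cast_sum, ← Finset.sum_congr rfl fun (w : {w : Place K F // w.comap E = v}) _ =>
      relLength_lattice_poleLattice w.1 (n w),
    ← relLength_pi (L := fun w : {w : Place K F // w.comap E = v} => w.1.lattice)
    (L' := fun w => w.1.poleLattice (n w)) Finset.univ (by simp)]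
  refine relLength_eq_of_map (LinearMap.pi fun _ => LinearMap.id) ?_ ?_ ?_
  · exact fun x hx w _ => mem_poleBounded.mp hx w w.2
  · intro x _
    refine Iff.trans ?_ (Place.mem_intCl_iff v).symm
    simp
  · intro y hy
    obtain ⟨x, hx⟩ := Place.exists_sub_mem v
      (fun w => if hw : w.comap E = v then y ⟨w, hw⟩ else 0)
    have hyx : ∀ w : {w : Place K F // w.comap E = v}, y w - x ∈ w.1.lattice := fun w => by
      simpa [w.2] using hx w w.2
    refine ⟨x, mem_poleBounded.mpr fun w hw => ?_, fun w _ => hyx w⟩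
    simpa using sub_mem (hy ⟨w, hw⟩ trivial) (Place.lattice_le_poleLattice (hyx ⟨w, hw⟩))

/- For `ϖ` a uniformizer at `v`, the product of `ϖ` and an element of the left-hand side vanishes at
all places above `v`, so its trace is divisible by `ϖ`. -/
lemma poleBounded_ram_sub_one_le_dualSubmodule (v : Place K E) :
    poleBounded v (fun w : Place K F => w.ram E - 1) ≤
      ((Algebra.traceForm E F).dualSubmodule (v.intClModule F)).restrictScalars K := by
  have := IsCurveField.of_finite_separable K E F
  intro x (hx : x ∈ poleBounded v _) b hb
  obtain ⟨ϖ, hϖ⟩ := IsDiscreteValuationRing.exists_irreducible v.ring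
  have hnonunits : ∀ w : Place K F, w.comap E = v →
      algebraMap E F ϖ * (x * b) ∈ w.ring.nonunits := by
    intro w hw
    obtain ⟨hϖw, hpow⟩ := Place.coe_mem_maximalIdeal_pow_ram hw
      (hϖ.maximalIdeal_eq ▸ Ideal.mem_span_singleton_self ϖ)
    rw [← Nat.sub_add_cancel (Place.ram_pos hw)] at hpow
    rw [← mul_assoc]
    exact Place.mem_nonunits_of_mul
      (Place.mul_mem_nonunits_of_mem_poleLattice (mem_poleBounded.mp hx w hw) hpow)
      (Place.intCl_le hw ⟨b, hb⟩)
  have htrace := Place.trace_mem_nonunits hnonunits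
  rw [← Algebra.smul_def, map_smul, smul_eq_mul, ← Place.inv_mul_mem_iff_mem_nonunits hϖ,
    inv_mul_cancel_left₀ (Place.coe_ne_zero_of_irreducible hϖ)] at htrace
  exact Place.mem_one_iff.mpr htrace

lemma sum_ram_sub_one_le_relLength (v : Place K E) :
    ((∑ w ∈ v.fibre F, (w.ram E - 1) : ℕ) : ℕ∞) ≤ relLength (intClLattice F v)
      (((Algebra.traceForm E F).dualSubmodule (v.intClModule F)).restrictScalars K) :=
  (relLength_intClLattice_poleBounded v _).ge.trans
    (relLength_mono_right _ (poleBounded_ram_sub_one_le_dualSubmodule v))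

end Different

section Bundle

variable {K E F : Type*} [Field K] [Field E] [Field F] [Algebra K E] [Algebra K F]
  [Algebra E F] [IsScalarTower K E F]

/-- A family of modules over the valuation rings, regarded as a family of `K`-subspaces. -/
abbrev toSubspaces (M : ∀ v : Place K E, Submodule v.ring F) (v : Place K E) : Submodule K F :=
  (M v).restrictScalars K

section Free

variable {ι : Type*} (b : Module.Basis ι E F)

/-- The family of lattices spanned by a basis. -/
abbrev freeLattice (v : Place K E) : Submodule v.ring F := Submodule.span v.ring (Set.range b)

lemma memAlmostAll_freeLattice [Finite ι] [IsCurveField K E] :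
    MemAlmostAll (toSubspaces (freeLattice b : ∀ v : Place K E, _)) := by
  intro x
  refine (Set.finite_iUnion fun i => IsCurveField.finite (K := K) (b.repr x i)).subset
    fun v hv => ?_
  rw [Set.mem_ofPred_eq, Submodule.restrictScalars_mem, mem_span_basis_iff, not_forall] at hv
  exact Set.mem_iUnion.mpr hv

lemma mem_freeLattice_iff_equivFun_mem_pi [Finite ι] (x : F) (v : Place K E) :
    x ∈ toSubspaces (freeLattice b) v ↔ ∀ v', id v' = v →
      b.equivFun.restrictScalars K x ∈ Submodule.pi Set.univ fun _ => v'.lattice := by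
  rw [Submodule.restrictScalars_mem, mem_span_basis_iff]
  simp [Submodule.mem_pi, Place.mem_lattice]

variable [Fintype ι]

lemma hZero_freeLattice :
    hZero (toSubspaces (freeLattice b : ∀ v : Place K E, _)) =
      Fintype.card ι * hZero (Place.lattice : Place K E → _) := by
  rw [← hZero_pi]
  exact hZero_eq_of_map (mem_freeLattice_iff_equivFun_mem_pi b) Function.surjective_id

lemma hOne_freeLattice :
    hOne (toSubspaces (freeLattice b : ∀ v : Place K E, _)) =
      Fintype.card ι * hOne (Place.lattice : Place K E → _) := by
  rw [← hOne_pi]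
  refine hOne_eq_of_map (mem_freeLattice_iff_equivFun_mem_pi b) (fun v => by simp)
    fun v r _ => ⟨(b.equivFun.restrictScalars K).symm (r v), ?_⟩
  rintro _ rfl
  rw [LinearEquiv.apply_symm_apply, id, sub_self]
  exact zero_mem _

end Free

/-- A vector bundle on the complete nonsingular curve with function field `E`, given by its generic
fibre `F` and its stalks inside `F`: the stalks are free of full rank, and any basis of the generic
fibre spans almost all of them. -/
structure IsBundle (M : ∀ v : Place K E, Submodule v.ring F) : Prop where
  exists_basis : ∀ v, ∃ b : Module.Basis (Fin (Module.finrank E F)) E F, freeLattice b v = M v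
  finite_ne_freeLattice : ∀ b : Module.Basis (Fin (Module.finrank E F)) E F,
    {v | M v ≠ freeLattice b v}.Finite

section CurveField

variable [IsCurveField K E]

lemma finite_freeLattice_ne {ι κ : Type*} [Finite ι] [Finite κ] (b : Module.Basis ι E F)
    (c : Module.Basis κ E F) : {v : Place K E | freeLattice b v ≠ freeLattice c v}.Finite := by
  refine ((Set.finite_iUnion fun i => memAlmostAll_freeLattice (K := K) c (b i)).union
    (Set.finite_iUnion fun j => memAlmostAll_freeLattice (K := K) b (c j))).subset fun v hv => ?_
  by_contra hmem
  simp only [Set.mem_union, Set.mem_iUnion, Set.mem_ofPred_eq, not_or, not_exists, not_not] at hmem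
  refine hv (le_antisymm (Submodule.span_le.mpr ?_) (Submodule.span_le.mpr ?_))
  · exact Set.range_subset_iff.mpr hmem.1
  · exact Set.range_subset_iff.mpr hmem.2

namespace IsBundle

variable {M N : ∀ v : Place K E, Submodule v.ring F}

lemma of_finite_ne (hbasis : ∀ v, ∃ b : Module.Basis (Fin (Module.finrank E F)) E F,
      freeLattice b v = M v) {b : Module.Basis (Fin (Module.finrank E F)) E F}
    (hfin : {v | M v ≠ freeLattice b v}.Finite) : IsBundle M where
  exists_basis := hbasis
  finite_ne_freeLattice c := (hfin.union (finite_freeLattice_ne b c)).subset fun v hv => by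
    by_contra hmem
    simp only [Set.mem_union, Set.mem_ofPred_eq, not_or, not_not] at hmem
    exact hv (hmem.1.trans hmem.2)

lemma freeLattice (b : Module.Basis (Fin (Module.finrank E F)) E F) :
    IsBundle (CurveCorr.freeLattice b : ∀ v : Place K E, _) :=
  of_finite_ne (fun _ => ⟨b, rfl⟩) (b := b) (by simp)

lemma relLength_ne_top (hN : IsBundle N) (hM : IsBundle M) (v : Place K E) :
    relLength (toSubspaces N v) (toSubspaces M v) ≠ ⊤ := by
  obtain ⟨b, hb⟩ := hN.exists_basis v
  obtain ⟨c, hc⟩ := hM.exists_basis v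
  rw [toSubspaces, toSubspaces, ← hb, ← hc]
  exact relLength_span_basis_ne_top v b c

variable [FiniteDimensional E F]

omit [Algebra K F] [IsScalarTower K E F] [IsCurveField K E] in
lemma finite_ne (hN : IsBundle N) (hM : IsBundle M) : {v | N v ≠ M v}.Finite := by
  let b := Module.finBasis E F
  refine ((hN.finite_ne_freeLattice b).union (hM.finite_ne_freeLattice b)).subset fun v hv => ?_
  by_contra hmem
  simp only [Set.mem_union, Set.mem_ofPred_eq, not_or, not_not] at hmem
  exact hv (hmem.1.trans hmem.2.symm)

lemma memAlmostAll (hM : IsBundle M) : MemAlmostAll (toSubspaces M) :=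
  let b := Module.finBasis E F
  (memAlmostAll_freeLattice b).congr (hM.finite_ne_freeLattice b) fun _ hv =>
    congrArg _ (not_not.mp hv).symm

lemma exists_le (hM : IsBundle M) (hN : IsBundle N) :
    ∃ N', IsBundle N' ∧ (∀ v, N' v ≤ M v) ∧ ∀ v, N' v ≤ N v := by
  have hlocal : ∀ v, ∃ N' : Submodule v.ring F,
      (∃ b : Module.Basis (Fin (Module.finrank E F)) E F, CurveCorr.freeLattice b v = N') ∧
        (M v = N v → N' = M v) ∧ N' ≤ M v ∧ N' ≤ N v := by
    intro v
    by_cases heq : M v = N v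
    · exact ⟨M v, hM.exists_basis v, fun _ => rfl, le_rfl, heq.le⟩
    obtain ⟨b, hb⟩ := hM.exists_basis v
    obtain ⟨c, hc⟩ := hN.exists_basis v
    obtain ⟨s, hs, hs0, hmem⟩ := v.exists_mul_mem fun ij : _ × _ => c.repr (b ij.1) ij.2
    refine ⟨_, ⟨b.unitsSMul fun _ => Units.mk0 s hs0, rfl⟩, fun h => absurd h heq, ?_, ?_⟩
    · rw [← hb, Submodule.span_le]
      rintro _ ⟨i, rfl⟩
      rw [Module.Basis.unitsSMul_apply]
      exact Submodule.smul_mem _ (⟨s, hs⟩ : v.ring) (Submodule.subset_span ⟨i, rfl⟩)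
    · rw [← hc, Submodule.span_le]
      rintro _ ⟨i, rfl⟩
      rw [Module.Basis.unitsSMul_apply, SetLike.mem_coe, mem_span_basis_iff]
      exact fun j => by simpa [Units.smul_def] using hmem (i, j)
  choose N' hbasis heq hleM hleN using hlocal
  let b := Module.finBasis E F
  refine ⟨N', of_finite_ne hbasis (b := b) (((hM.finite_ne hN).union
    (hM.finite_ne_freeLattice b)).subset fun v hv => ?_), hleM, hleN⟩
  by_contra hmem
  simp only [Set.mem_union, Set.mem_ofPred_eq, not_or, not_not] at hmem
  exact hv ((heq v hmem.1).trans hmem.2)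

section Le

variable (hN : IsBundle N) (hM : IsBundle M) (hle : ∀ v, N v ≤ M v)
include hN hM hle

lemma finiteCohomology_iff_of_le :
    FiniteCohomology (toSubspaces N) ↔ FiniteCohomology (toSubspaces M) :=
  CurveCorr.finiteCohomology_iff_of_le hle (hN.finite_ne hM).toFinset
    (fun v hv => congrArg _ (by simpa using hv)) hN.memAlmostAll
    (WithTop.sum_ne_top.mpr fun v _ => hN.relLength_ne_top hM v)

lemma eulerChar_eq_add_of_le {s : Finset (Place K E)} (hs : ∀ v ∉ s, N v = M v)
    (hfin : FiniteCohomology (toSubspaces M)) :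
    eulerChar (toSubspaces M) = eulerChar (toSubspaces N) +
      (∑ v ∈ s, relLength (toSubspaces N v) (toSubspaces M v)).toNat :=
  CurveCorr.eulerChar_eq_add_of_le hle s (fun v hv => congrArg _ (hs v hv)) hN.memAlmostAll
    ((hN.finiteCohomology_iff_of_le hM hle).mpr hfin) hfin
    (WithTop.sum_ne_top.mpr fun v _ => hN.relLength_ne_top hM v)

end Le

lemma finiteCohomology_iff (hM : IsBundle M) (hN : IsBundle N) :
    FiniteCohomology (toSubspaces M) ↔ FiniteCohomology (toSubspaces N) := by
  obtain ⟨N', hN', hle, hle'⟩ := hM.exists_le hN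
  exact (hN'.finiteCohomology_iff_of_le hM hle).symm.trans
    (hN'.finiteCohomology_iff_of_le hN hle')

end IsBundle

end CurveField

section Dual

variable (B : LinearMap.BilinForm E F)

/-- The dual family of lattices with respect to a bilinear form. -/
abbrev dualFamily (M : ∀ v : Place K E, Submodule v.ring F) (v : Place K E) : Submodule v.ring F :=
  B.dualSubmodule (M v)

variable {B} (hB : B.Nondegenerate)
include hB

omit [Algebra K F] [IsScalarTower K E F] in
lemma dualFamily_freeLattice {ι : Type*} [Finite ι] [DecidableEq ι] (b : Module.Basis ι E F) :
    dualFamily B (freeLattice b : ∀ v : Place K E, Submodule v.ring F) =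
      freeLattice (B.dualBasis hB b) :=
  funext fun _ => B.dualSubmodule_span_of_basis hB b

variable [FiniteDimensional E F] [IsCurveField K E] {M N : ∀ v : Place K E, Submodule v.ring F}

lemma IsBundle.dualFamily (hM : IsBundle M) : IsBundle (dualFamily B M) := by
  let b := Module.finBasis E F
  refine .of_finite_ne (b := B.dualBasis hB b) (fun v => ?_)
    ((hM.finite_ne_freeLattice b).subset fun v hv heq => hv ?_)
  · obtain ⟨c, hc⟩ := hM.exists_basis v
    exact ⟨B.dualBasis hB c, by rw [← dualFamily_freeLattice hB c, CurveCorr.dualFamily, hc]⟩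
  · rw [CurveCorr.dualFamily, heq, ← dualFamily_freeLattice hB b]

variable (hsymm : B.IsSymm)
include hsymm

lemma eulerChar_add_eulerChar_dualFamily_of_le (hN : IsBundle N) (hM : IsBundle M)
    (hle : ∀ v, N v ≤ M v) (hfin : FiniteCohomology (toSubspaces M)) :
    eulerChar (toSubspaces N) + eulerChar (toSubspaces (dualFamily B N)) =
      eulerChar (toSubspaces M) + eulerChar (toSubspaces (dualFamily B M)) := by
  have hN' := hN.dualFamily hB
  have hM' := hM.dualFamily hB
  let s := (hN.finite_ne hM).toFinset
  have hs : ∀ v ∉ s, N v = M v := fun v hv => by simpa [s] using hv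
  have hdual : ∀ v, relLength (toSubspaces (dualFamily B M) v) (toSubspaces (dualFamily B N) v) =
      relLength (toSubspaces N v) (toSubspaces M v) := by
    intro v
    obtain ⟨b, hb⟩ := hN.exists_basis v
    obtain ⟨c, hc⟩ := hM.exists_basis v
    simpa only [toSubspaces, dualFamily, ← hb, ← hc] using relLength_dualSubmodule_span hB hsymm b c
  have heuler := hN.eulerChar_eq_add_of_le hM hle hs hfin
  have heuler' := hM'.eulerChar_eq_add_of_le hN' (fun _ _ hx y hy => hx y (hle _ hy)) (s := s)
    (fun v hv => congrArg _ (hs v hv).symm) ((hM.finiteCohomology_iff hN').mp hfin)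
  rw [Finset.sum_congr rfl fun v _ => hdual v] at heuler'
  linarith

lemma eulerChar_add_eulerChar_dualFamily_eq (hM : IsBundle M) (hN : IsBundle N)
    (hfin : FiniteCohomology (toSubspaces M)) :
    eulerChar (toSubspaces M) + eulerChar (toSubspaces (dualFamily B M)) =
      eulerChar (toSubspaces N) + eulerChar (toSubspaces (dualFamily B N)) := by
  obtain ⟨N', hN', hle, hle'⟩ := hM.exists_le hN
  rw [← eulerChar_add_eulerChar_dualFamily_of_le hB hsymm hN' hM hle hfin,
    eulerChar_add_eulerChar_dualFamily_of_le hB hsymm hN' hN hle'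
      ((hM.finiteCohomology_iff hN).mp hfin)]

end Dual

end Bundle

/-! ### The Riemann–Hurwitz inequality -/

section RiemannHurwitz

variable {K E F : Type*} [Field K] [Field E] [Field F] [Algebra K E] [Algebra K F]
  [Algebra E F] [IsScalarTower K E F] [FiniteDimensional E F] [Algebra.IsSeparable E F]
  [IsAlgClosed K] [IsCurveField K E]

section FreeLattice

variable {ι : Type*} [Nonempty (Place K E)] (b : Module.Basis ι E F)

omit [FiniteDimensional E F] [Algebra.IsSeparable E F] [IsCurveField K E] in
lemma finiteCohomology_freeLattice [Finite ι] (hE : hOne (Place.lattice : Place K E → _) ≠ ⊤) :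
    FiniteCohomology (toSubspaces (freeLattice b : ∀ v : Place K E, _)) := by
  cases nonempty_fintype ι
  rw [FiniteCohomology, hZero_freeLattice, hOne_freeLattice, hZero_lattice K E]
  exact ⟨WithTop.mul_ne_top (ENat.natCast_ne_top _) ENat.one_ne_top,
    WithTop.mul_ne_top (ENat.natCast_ne_top _) hE⟩

omit [FiniteDimensional E F] [Algebra.IsSeparable E F] [IsCurveField K E] in
lemma eulerChar_freeLattice [Fintype ι] :
    eulerChar (toSubspaces (freeLattice b : ∀ v : Place K E, _)) =
      Fintype.card ι * (1 - ((hOne (Place.lattice : Place K E → _)).toNat : ℤ)) := by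
  rw [eulerChar, hZero_freeLattice, hOne_freeLattice, hZero_lattice K E]
  simp [ENat.toNat_mul, mul_sub]

end FreeLattice

/- Almost everywhere a basis `b` and its dual basis `b'` are integral and span the same module, so
that `⟨b⟩ ≤ intClModule ≤ intClModuleᵛ ≤ ⟨b⟩ᵛ = ⟨b'⟩ = ⟨b⟩`. -/
variable (K E F) in
lemma isBundle_intClModule : IsBundle fun v : Place K E => v.intClModule F := by
  let b := Module.finBasis E F
  let b' := (Algebra.traceForm E F).dualBasis (traceForm_nondegenerate E F) b
  refine .of_finite_ne (b := b) (fun v => v.exists_basis_intClModule F)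
    (((finite_freeLattice_ne b b').union (Set.finite_iUnion fun i =>
      memAlmostAll_intClLattice (K := K) (b i))).subset fun v hv => ?_)
  by_contra hmem
  simp only [Set.mem_union, Set.mem_iUnion, Set.mem_ofPred_eq, not_or, not_exists, not_not] at hmem
  have hle : freeLattice b v ≤ v.intClModule F :=
    Submodule.span_le.mpr (Set.range_subset_iff.mpr hmem.2)
  refine hv (le_antisymm ?_ hle)
  rw [hmem.1, ← dualFamily_freeLattice (traceForm_nondegenerate E F) b]
  exact Place.intClModule_le_dualSubmodule.trans fun x hx y hy => hx y (hle hy)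

section Genus

variable [Nonempty (Place K E)] (hE : hOne (Place.lattice : Place K E → _) ≠ ⊤)
include hE

variable (F) in
lemma finiteCohomology_intClModule :
    FiniteCohomology (toSubspaces fun v : Place K E => v.intClModule F) :=
  ((IsBundle.freeLattice (Module.finBasis E F)).finiteCohomology_iff
    (isBundle_intClModule K E F)).mp (finiteCohomology_freeLattice _ hE)

variable (F) in
lemma hOne_lattice_ne_top_of_finite_separable : hOne (Place.lattice : Place K F → _) ≠ ⊤ :=
  hOne_intClLattice (K := K) (E := E) (F := F) ▸ (finiteCohomology_intClModule F hE).2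

variable (F) in
/- The Euler characteristics of `intClModule` and its trace dual add up to those of a free bundle
and its dual, and they differ by the degree of the different. -/
lemma exists_sum_relLength_dualSubmodule_eq : ∃ s : Finset (Place K E), ∀ t : Finset (Place K E),
    s ⊆ t → ((∑ v ∈ t, relLength (intClLattice F v)
        (((Algebra.traceForm E F).dualSubmodule (v.intClModule F)).restrictScalars K)).toNat : ℤ) =
      2 * ((hOne (Place.lattice : Place K F → _)).toNat : ℤ) - 2 -
        Module.finrank E F * (2 * ((hOne (Place.lattice : Place K E → _)).toNat : ℤ) - 2) := by
  let B := Algebra.traceForm E F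
  have hB : B.Nondegenerate := traceForm_nondegenerate E F
  have := IsCurveField.of_finite_separable K E F
  have : Nonempty (Place K F) := Place.comap_surjective (K := K) (E := E) |>.nonempty
  have hL := isBundle_intClModule K E F
  have hL' := hL.dualFamily hB
  have hfin := finiteCohomology_intClModule (K := K) F hE
  let b := Module.finBasis E F
  have hsum := eulerChar_add_eulerChar_dualFamily_eq hB (Algebra.traceForm_isSymm E) hL
    (.freeLattice b) hfin
  have hchar : eulerChar (toSubspaces fun v : Place K E => v.intClModule F) =
      1 - ((hOne (Place.lattice : Place K F → _)).toNat : ℤ) := by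
    rw [eulerChar, hZero_intClLattice, hOne_intClLattice, hZero_lattice K F]
    simp
  refine ⟨(hL.finite_ne hL').toFinset, fun t ht => ?_⟩
  have hdiff := hL.eulerChar_eq_add_of_le hL' (fun v => Place.intClModule_le_dualSubmodule) (s := t)
    (fun v hv => by simpa using fun hne => hv (ht ((hL.finite_ne hL').mem_toFinset.mpr hne)))
    ((hL.finiteCohomology_iff hL').mp hfin)
  rw [dualFamily_freeLattice hB, eulerChar_freeLattice, eulerChar_freeLattice, hchar, hdiff, hchar,
    Fintype.card_fin] at hsum
  linarith

theorem sum_ram_sub_one_le (t : Finset (Place K F)) : (∑ w ∈ t, ((w.ram E : ℤ) - 1)) ≤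
    2 * ((hOne (Place.lattice : Place K F → _)).toNat : ℤ) - 2 -
      Module.finrank E F * (2 * ((hOne (Place.lattice : Place K E → _)).toNat : ℤ) - 2) := by
  classical
  obtain ⟨s, hs⟩ := exists_sum_relLength_dualSubmodule_eq F hE
  let T : Finset (Place K E) := s ∪ t.image fun w => w.comap E
  have hfibres : ∑ w ∈ t, (w.ram E - 1) ≤ ∑ v ∈ T, ∑ w ∈ v.fibre F, (w.ram E - 1) := by
    rw [← Finset.sum_biUnion fun v _ v' _ hne => Finset.disjoint_left.mpr fun w hw hw' =>
      hne ((Place.mem_fibre.mp hw).symm.trans (Place.mem_fibre.mp hw'))]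
    refine Finset.sum_le_sum_of_subset fun w hw => Finset.mem_biUnion.mpr ⟨w.comap E, ?_, ?_⟩
    · exact Finset.mem_union_right _ (Finset.mem_image_of_mem _ hw)
    · exact Place.mem_fibre.mpr rfl
  have hdegree : ∑ v ∈ T, ∑ w ∈ v.fibre F, (w.ram E - 1) ≤ (∑ v ∈ T, relLength (intClLattice F v)
      (((Algebra.traceForm E F).dualSubmodule (v.intClModule F)).restrictScalars K)).toNat := by
    have hL := isBundle_intClModule K E F
    have hfin : ∑ v ∈ T, relLength (intClLattice F v)
        (((Algebra.traceForm E F).dualSubmodule (v.intClModule F)).restrictScalars K) ≠ ⊤ :=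
      WithTop.sum_ne_top.mpr fun v _ =>
        hL.relLength_ne_top (hL.dualFamily (traceForm_nondegenerate E F)) v
    rw [← ENat.natCast_le_natCast, ENat.natCast_toNat hfin, Nat.cast_sum]
    exact Finset.sum_le_sum fun v _ => sum_ram_sub_one_le_relLength v
  have hcast : ∑ w ∈ t, ((w.ram E : ℤ) - 1) = ((∑ w ∈ t, (w.ram E - 1) : ℕ) : ℤ) := by
    rw [Nat.cast_sum]
    exact Finset.sum_congr rfl fun w _ => by
      rw [Nat.cast_sub (Place.ram_pos (v := w.comap E) rfl), Nat.cast_one]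
  rw [hcast, ← hs T Finset.subset_union_left]
  exact_mod_cast hfibres.trans hdegree

end Genus

end RiemannHurwitz

/-! ### Rational function fields -/

section Rational

open IntermediateField Polynomial

variable {K E : Type*} [Field K] [Field E] [Algebra K E]

lemma adjoin_sub_algebraMap_eq_top {x : E} (hx : K⟮x⟯ = ⊤) (a : K) :
    K⟮x - algebraMap K E a⟯ = ⊤ := by
  refine top_le_iff.mp (hx.ge.trans (adjoin_simple_le_iff.mpr ?_))
  simpa using add_mem (mem_adjoin_simple_self K (x - algebraMap K E a))
    (IntermediateField.algebraMap_mem K⟮x - algebraMap K E a⟯ a)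

lemma adjoin_inv_eq_top {x : E} (hx : K⟮x⟯ = ⊤) : K⟮x⁻¹⟯ = ⊤ := by
  refine top_le_iff.mp (hx.ge.trans (adjoin_simple_le_iff.mpr ?_))
  simpa using inv_mem (mem_adjoin_simple_self K x⁻¹)

lemma exists_aeval_eq_pow_mul {y : E} {p : K[X]} (hp : p ≠ 0) :
    ∃ (n : ℕ) (q : K[X]), q.eval 0 ≠ 0 ∧ aeval y p = y ^ n * aeval y q := by
  obtain ⟨q, hq, hdvd⟩ := exists_eq_pow_rootMultiplicity_mul_and_not_dvd p hp 0
  refine ⟨rootMultiplicity 0 p, q, fun h => hdvd (dvd_iff_isRoot.mpr h), ?_⟩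
  simpa using congrArg (aeval y) hq

namespace Place

variable {v w : Place K E} {y : E}

lemma ne_zero_of_adjoin_eq_top (hgen : K⟮y⟯ = ⊤) (v : Place K E) : y ≠ 0 := by
  rintro rfl
  obtain ⟨x, hx⟩ := v.exists_notMem
  obtain ⟨a, rfl⟩ : x ∈ (⊥ : IntermediateField K E) := (adjoin_zero.symm.trans hgen) ▸ mem_top
  exact hx (v.algebraMap_mem a)

lemma mem_of_sub_mem_nonunits {u : E} {a : K} (h : u - algebraMap K E a ∈ v.ring.nonunits) :
    u ∈ v.ring := by
  simpa using v.ring.add_mem _ _ (v.ring.nonunits_le h) (v.algebraMap_mem a)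

lemma notMem_nonunits_of_sub_mem {u : E} {a : K} (ha : a ≠ 0)
    (h : u - algebraMap K E a ∈ v.ring.nonunits) : u ∉ v.ring.nonunits := fun hu =>
  ha (algebraMap_mem_nonunits (by simpa using sub_mem hu h))

lemma div_sub_mem_nonunits {f g : E} {a b : K} (hb : b ≠ 0)
    (hf : f - algebraMap K E a ∈ v.ring.nonunits) (hg : g - algebraMap K E b ∈ v.ring.nonunits) :
    f / g - algebraMap K E (a / b) ∈ v.ring.nonunits := by
  have hgu : g ∉ v.ring.nonunits := notMem_nonunits_of_sub_mem hb hg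
  have hg0 : g ≠ 0 := fun h => hgu (h ▸ v.ring.nonunits.zero_mem)
  have hb0 : algebraMap K E b ≠ 0 := by simpa using hb
  have hdiff : f / g - algebraMap K E (a / b) =
      ((f - algebraMap K E a) - (g - algebraMap K E b) * algebraMap K E (a / b)) * g⁻¹ := by
    rw [map_div₀]
    field_simp
    ring
  rw [hdiff]
  exact mem_nonunits_of_mul (sub_mem hf (mem_nonunits_of_mul hg (v.algebraMap_mem _)))
    (inv_mem_of_notMem_nonunits hgu)

lemma aeval_mem (hy : y ∈ v.ring) (p : K[X]) : aeval y p ∈ v.ring := by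
  rw [aeval_eq_sum_range]
  refine sum_mem fun i _ => ?_
  rw [Algebra.smul_def]
  exact v.ring.mul_mem _ _ (v.algebraMap_mem _) (pow_mem hy i)

lemma aeval_sub_mem_nonunits (hy : y ∈ v.ring) {a : K}
    (h : y - algebraMap K E a ∈ v.ring.nonunits) (p : K[X]) :
    aeval y p - algebraMap K E (p.eval a) ∈ v.ring.nonunits := by
  obtain ⟨q, hq⟩ := X_sub_C_dvd_sub_C_eval (a := a) (p := p)
  have hfactor : aeval y p - algebraMap K E (p.eval a) = (y - algebraMap K E a) * aeval y q := by
    simpa using congrArg (aeval y) hq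
  exact hfactor ▸ mem_nonunits_of_mul h (aeval_mem hy q)

/- The unit `u` has a nonzero constant value at every zero of `y`; stating this for all places at
once gives the uniqueness of the zero of `y`. -/
lemma exists_eq_zpow_mul (hy0 : y ≠ 0) (hgen : K⟮y⟯ = ⊤) {z : E} (hz : z ≠ 0) :
    ∃ (n : ℤ) (u : E) (a : K), a ≠ 0 ∧ z = y ^ n * u ∧
      ∀ w : Place K E, y ∈ w.ring.nonunits → u - algebraMap K E a ∈ w.ring.nonunits := by
  obtain ⟨p, q, rfl⟩ := mem_adjoin_simple_iff K z |>.mp (hgen ▸ mem_top)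
  have hp : p ≠ 0 := fun h => hz (by simp [h])
  have hq : q ≠ 0 := fun h => hz (by simp [h])
  obtain ⟨m, p', hp', hm⟩ := exists_aeval_eq_pow_mul (y := y) hp
  obtain ⟨n, q', hq', hn⟩ := exists_aeval_eq_pow_mul (y := y) hq
  refine ⟨m - n, aeval y p' / aeval y q', p'.eval 0 / q'.eval 0, div_ne_zero hp' hq', ?_, ?_⟩
  · rw [hm, hn, zpow_sub₀ hy0, zpow_natCast, zpow_natCast, mul_div_mul_comm]
  · intro w hw
    have hw0 : y - algebraMap K E 0 ∈ w.ring.nonunits := by simpa using hw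
    exact div_sub_mem_nonunits hq' (aeval_sub_mem_nonunits (w.ring.nonunits_le hw) hw0 p')
      (aeval_sub_mem_nonunits (w.ring.nonunits_le hw) hw0 q')

variable (hy : y ∈ v.ring.nonunits) (hgen : K⟮y⟯ = ⊤)
include hy hgen

lemma exists_eq_pow_mul {z : E} (hz : z ≠ 0) (hzv : z ∈ v.ring) :
    ∃ (n : ℕ) (u : E) (a : K), a ≠ 0 ∧ z = y ^ n * u ∧
      ∀ w : Place K E, y ∈ w.ring.nonunits → u - algebraMap K E a ∈ w.ring.nonunits := by
  have hy0 := ne_zero_of_adjoin_eq_top hgen v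
  obtain ⟨n, u, a, ha, rfl, hu⟩ := exists_eq_zpow_mul hy0 hgen hz
  suffices 0 ≤ n by
    lift n to ℕ using this
    exact ⟨n, u, a, ha, by rw [zpow_natCast], hu⟩
  by_contra! hn
  obtain ⟨m, rfl⟩ : ∃ m : ℕ, n = -(m + 1 : ℕ) := ⟨(-n - 1).toNat, by lia⟩
  refine notMem_nonunits_of_sub_mem ha (hu v hy) ?_
  have hu_eq : u = y ^ (m + 1) * (y ^ (-(m + 1 : ℕ) : ℤ) * u) := by
    rw [zpow_neg, zpow_natCast, mul_inv_cancel_left₀ (pow_ne_zero _ hy0)]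
  rw [hu_eq, pow_succ', mul_assoc]
  exact mem_nonunits_of_mul hy
    (v.ring.mul_mem _ _ (v.ring.toSubring.pow_mem (v.ring.nonunits_le hy) m) hzv)

lemma eq_of_mem_nonunits_of_adjoin_eq_top (hw : y ∈ w.ring.nonunits) : v = w := by
  have ring_le {v w : Place K E} (hv : y ∈ v.ring.nonunits) (hw : y ∈ w.ring.nonunits) :
      v.ring ≤ w.ring := by
    intro z hz
    rcases eq_or_ne z 0 with rfl | hz0
    · exact w.ring.zero_mem
    · obtain ⟨n, u, a, -, rfl, hu⟩ := exists_eq_pow_mul hv hgen hz0 hz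
      exact w.ring.mul_mem _ _ (w.ring.toSubring.pow_mem (w.ring.nonunits_le hw) n)
        (mem_of_sub_mem_nonunits (hu w hw))
  exact Place.ext (le_antisymm (ring_le hy hw) (ring_le hw hy))

lemma exists_associated_pow {z : v.ring} (hz : z ≠ 0) :
    ∃ n : ℕ, Associated (⟨y, v.ring.nonunits_le hy⟩ ^ n) z := by
  obtain ⟨n, u, a, ha, hzu, hu⟩ := exists_eq_pow_mul hy hgen (by simpa using hz) z.2
  have hu_mem := mem_of_sub_mem_nonunits (hu v hy)
  have hunit : IsUnit (⟨u, hu_mem⟩ : v.ring) := by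
    by_contra h
    exact notMem_nonunits_of_sub_mem ha (hu v hy)
      (ValuationSubring.mem_nonunits_iff_exists_mem_maximalIdeal.mpr ⟨hu_mem, h⟩)
  exact ⟨n, hunit.unit, Subtype.ext hzu.symm⟩

lemma irreducible_of_adjoin_eq_top : Irreducible (⟨y, v.ring.nonunits_le hy⟩ : v.ring) := by
  have hy0 : (⟨y, v.ring.nonunits_le hy⟩ : v.ring) ≠ 0 := by
    simpa [← Subtype.coe_inj] using ne_zero_of_adjoin_eq_top hgen v
  obtain ⟨_, hy_mem⟩ := ValuationSubring.mem_nonunits_iff_exists_mem_maximalIdeal.mp hy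
  have hspan : Ideal.span {(⟨y, v.ring.nonunits_le hy⟩ : v.ring)} =
      IsLocalRing.maximalIdeal v.ring := by
    refine le_antisymm ((Ideal.span_singleton_le_iff_mem _).mpr hy_mem) fun z hz => ?_
    rw [Ideal.mem_span_singleton]
    rcases eq_or_ne z 0 with rfl | hz0
    · exact dvd_zero _
    obtain ⟨_ | n, hn⟩ := exists_associated_pow hy hgen hz0
    · exact absurd (hn.isUnit (by simp)) hz
    · exact (dvd_pow_self _ n.succ_ne_zero).trans hn.dvd
  exact ((Ideal.span_singleton_prime hy0).mp (hspan ▸ inferInstance)).irreducible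

lemma isDiscreteValuationRing_of_adjoin_eq_top : IsDiscreteValuationRing v.ring :=
  .ofHasUnitMulPowIrreducibleFactorization
    ⟨_, irreducible_of_adjoin_eq_top hy hgen, exists_associated_pow hy hgen⟩

lemma exists_sub_mem_nonunits_of_adjoin_eq_top {z : E} (hz : z ∈ v.ring) :
    ∃ a : K, z - algebraMap K E a ∈ v.ring.nonunits := by
  rcases eq_or_ne z 0 with rfl | hz0
  · exact ⟨0, by simp⟩
  obtain ⟨_ | n, u, a, -, rfl, hu⟩ := exists_eq_pow_mul hy hgen hz0 hz
  · exact ⟨a, by simpa using hu v hy⟩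
  · refine ⟨0, ?_⟩
    rw [map_zero, sub_zero, pow_succ', mul_assoc]
    exact mem_nonunits_of_mul hy (v.ring.mul_mem _ _
      (v.ring.toSubring.pow_mem (v.ring.nonunits_le hy) n) (mem_of_sub_mem_nonunits (hu v hy)))

lemma inv_mem_of_ne_of_adjoin_eq_top (hw : w ≠ v) : y⁻¹ ∈ w.ring :=
  inv_mem_of_notMem_nonunits fun h => hw (eq_of_mem_nonunits_of_adjoin_eq_top h hgen hy)

lemma exists_inv_pow_mul_sub_mem (n : ℕ) {u : E} (hu : u ∈ v.ring) :
    ∃ f : E, y⁻¹ ^ n * u - f ∈ v.ring ∧ ∀ w : Place K E, w ≠ v → f ∈ w.ring := by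
  induction n generalizing u with
  | zero => exact ⟨0, by simpa using hu, fun w _ => w.ring.zero_mem⟩
  | succ n ih =>
    have := isDiscreteValuationRing_of_adjoin_eq_top hy hgen
    obtain ⟨a, ha⟩ := exists_sub_mem_nonunits_of_adjoin_eq_top hy hgen hu
    obtain ⟨f, hf, hf_mem⟩ :=
      ih ((inv_mul_mem_iff_mem_nonunits (irreducible_of_adjoin_eq_top hy hgen)).mpr ha)
    refine ⟨f + y⁻¹ ^ (n + 1) * algebraMap K E a, ?_, fun w hw => ?_⟩
    · convert hf using 1
      ring
    · exact w.ring.add_mem _ _ (hf_mem w hw) (w.ring.mul_mem _ _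
        (pow_mem (inv_mem_of_ne_of_adjoin_eq_top hy hgen hw) _) (w.algebraMap_mem a))

lemma exists_sub_mem_of_adjoin_eq_top (z : E) :
    ∃ f : E, z - f ∈ v.ring ∧ ∀ w : Place K E, w ≠ v → f ∈ w.ring := by
  rcases eq_or_ne z 0 with rfl | hz0
  · exact ⟨0, by simp, fun w _ => w.ring.zero_mem⟩
  obtain ⟨n, u, a, -, rfl, hu⟩ :=
    exists_eq_zpow_mul (ne_zero_of_adjoin_eq_top hgen v) hgen hz0
  have hu_mem := mem_of_sub_mem_nonunits (hu v hy)
  obtain ⟨n, rfl | rfl⟩ := n.eq_nat_or_neg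
  · refine ⟨0, ?_, fun w _ => w.ring.zero_mem⟩
    rw [sub_zero, zpow_natCast]
    exact v.ring.mul_mem _ _ (v.ring.toSubring.pow_mem (v.ring.nonunits_le hy) n) hu_mem
  · rw [zpow_neg, zpow_natCast, ← inv_pow]
    exact exists_inv_pow_mul_sub_mem hy hgen n hu_mem

end Place

variable [IsAlgClosed K] {x : E} (hgen : K⟮x⟯ = ⊤)
include hgen

namespace Place

/- Otherwise every nonzero polynomial in `x`, being a product of linear factors, would be a unit at
`v`, and the valuation ring would be the whole field. -/
lemma exists_sub_mem_nonunits_of_mem {v : Place K E} (hx : x ∈ v.ring) :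
    ∃ a : K, x - algebraMap K E a ∈ v.ring.nonunits := by
  by_contra! hunit
  have inv_aeval_mem (p : K[X]) : (aeval x p)⁻¹ ∈ v.ring := by
    rw [(IsAlgClosed.splits p).eq_prod_roots, map_mul, aeval_C, mul_inv, ← map_inv₀,
      map_multiset_prod, Multiset.map_map, ← Multiset.prod_map_inv']
    refine v.ring.mul_mem _ _ (v.algebraMap_mem _) (multiset_prod_mem _ fun z hz => ?_)
    simp only [Multiset.map_map, Multiset.mem_map, Function.comp_apply, map_sub, aeval_X,
      aeval_C] at hz
    obtain ⟨a, -, rfl⟩ := hz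
    exact inv_mem_of_notMem_nonunits (hunit a)
  obtain ⟨z, hz⟩ := v.exists_notMem
  obtain ⟨p, q, rfl⟩ := mem_adjoin_simple_iff K z |>.mp (hgen ▸ mem_top)
  rw [div_eq_mul_inv] at hz
  exact hz (v.ring.mul_mem _ _ (aeval_mem hx p) (inv_aeval_mem q))

lemma exists_uniformizer_of_adjoin_eq_top (v : Place K E) :
    ∃ y ∈ v.ring.nonunits, K⟮y⟯ = ⊤ := by
  by_cases hx : x ∈ v.ring
  · obtain ⟨a, ha⟩ := exists_sub_mem_nonunits_of_mem hgen hx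
    exact ⟨_, ha, adjoin_sub_algebraMap_eq_top hgen a⟩
  · exact ⟨_, v.ring.inv_mem_nonunits_iff.mpr (.inr hx), adjoin_inv_eq_top hgen⟩

/- A pole of `p(x) / q(x)` is a pole of `x` or a zero of `x - a` for a root `a` of `q`. -/
lemma finite_setOf_notMem_of_adjoin_eq_top (z : E) : {v : Place K E | z ∉ v.ring}.Finite := by
  classical
  have finite_zeros {y : E} (hy : K⟮y⟯ = ⊤) : {v : Place K E | y ∈ v.ring.nonunits}.Finite :=
    Set.Subsingleton.finite fun v hv w hw => eq_of_mem_nonunits_of_adjoin_eq_top hv hy hw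
  obtain ⟨p, q, rfl⟩ := mem_adjoin_simple_iff K z |>.mp (hgen ▸ mem_top)
  refine ((finite_zeros (adjoin_inv_eq_top hgen)).union (q.roots.toFinset.finite_toSet.biUnion
    fun a _ => finite_zeros (adjoin_sub_algebraMap_eq_top hgen a))).subset fun v hv => ?_
  rw [Set.mem_ofPred_eq, div_eq_mul_inv] at hv
  by_cases hx : x ∈ v.ring
  · obtain ⟨a, ha⟩ := exists_sub_mem_nonunits_of_mem hgen hx
    refine Or.inr (Set.mem_biUnion (x := a) ?_ ha)
    have hq : q ≠ 0 := fun hq => hv (by simp [hq])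
    rw [Finset.mem_coe, Multiset.mem_toFinset, mem_roots hq, IsRoot.def]
    by_contra hroot
    exact hv (v.ring.mul_mem _ _ (aeval_mem hx p) (inv_mem_of_notMem_nonunits
      (notMem_nonunits_of_sub_mem hroot (aeval_sub_mem_nonunits hx ha q))))
  · exact Or.inl (v.ring.inv_mem_nonunits_iff.mpr (.inr hx))

end Place

lemma IsCurveField.of_adjoin_eq_top : IsCurveField K E where
  dvr v := by
    obtain ⟨y, hy, hy_gen⟩ := v.exists_uniformizer_of_adjoin_eq_top hgen
    exact Place.isDiscreteValuationRing_of_adjoin_eq_top hy hy_gen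
  residue v z hz := by
    obtain ⟨y, hy, hy_gen⟩ := v.exists_uniformizer_of_adjoin_eq_top hgen
    exact Place.exists_sub_mem_nonunits_of_adjoin_eq_top hy hy_gen hz
  finite := Place.finite_setOf_notMem_of_adjoin_eq_top hgen

/- Partial fractions: subtracting all principal parts of a repartition makes it regular. -/
lemma hOne_eq_zero_of_adjoin_eq_top : hOne (Place.lattice : Place K E → _) = 0 := by
  classical
  have exists_principalPart (r : Place K E → E) (p : Place K E) :
      ∃ f : E, r p - f ∈ p.ring ∧ ∀ w : Place K E, w ≠ p → f ∈ w.ring := by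
    obtain ⟨y, hy, hy_gen⟩ := p.exists_uniformizer_of_adjoin_eq_top hgen
    exact Place.exists_sub_mem_of_adjoin_eq_top hy hy_gen (r p)
  refine relLength_eq_zero_of_le fun r (hr : {p : Place K E | r p ∉ p.ring}.Finite) => ?_
  choose f hf hf_mem using exists_principalPart r
  let g := ∑ p ∈ hr.toFinset, f p
  rw [← sub_add_cancel r fun _ => g]
  refine Submodule.add_mem_sup (fun q _ => ?_) ⟨g, rfl⟩
  change r q - g ∈ q.ring
  by_cases hq : r q ∈ q.ring
  · refine sub_mem hq (sum_mem fun p hp => hf_mem p q ?_)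
    rintro rfl
    exact (hr.mem_toFinset.mp hp) hq
  · have hg : g = f q + ∑ p ∈ hr.toFinset.erase q, f p :=
      (Finset.add_sum_erase _ _ (hr.mem_toFinset.mpr hq)).symm
    rw [hg, ← sub_sub]
    exact sub_mem (hf q) (sum_mem fun p hp => hf_mem p q (Finset.ne_of_mem_erase hp).symm)

end Rational

/-! ### Local rings of smooth algebras of relative dimension one -/

section LocalAlgebra

/- By Krull's intersection theorem `x` lies outside some power of the maximal ideal. -/
lemma exists_eq_pow_mul_isUnit {S : Type*} [CommRing S] [IsLocalRing S] [IsNoetherianRing S] {t : S}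
    (ht : IsLocalRing.maximalIdeal S = Ideal.span {t}) {x : S} (hx : x ≠ 0) :
    ∃ (n : ℕ) (u : S), IsUnit u ∧ x = t ^ n * u := by
  have hfin : FiniteMultiplicity t x := by
    by_contra h
    rw [FiniteMultiplicity.not_iff_forall] at h
    refine hx ((Submodule.mem_bot S).mp ?_)
    rw [← Ideal.iInf_pow_eq_bot_of_isLocalRing _ (IsLocalRing.maximalIdeal.isMaximal S).ne_top]
    refine (Submodule.mem_iInf _).mpr fun n => ?_
    rw [ht, Ideal.span_singleton_pow, Ideal.mem_span_singleton]
    exact h n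
  obtain ⟨u, hu, hdvd⟩ := hfin.exists_eq_pow_mul_and_not_dvd
  refine ⟨multiplicity t x, u, ?_, hu⟩
  rwa [← Ideal.mem_span_singleton, ← ht, IsLocalRing.mem_maximalIdeal, mem_nonunits_iff,
    not_not] at hdvd

lemma isDomain_of_maximalIdeal_eq_span {S : Type*} [CommRing S] [IsLocalRing S]
    [IsNoetherianRing S] {t : S} (ht : IsLocalRing.maximalIdeal S = Ideal.span {t})
    (hreg : t ∈ nonZeroDivisors S) : IsDomain S := by
  have : NoZeroDivisors S := ⟨fun {x y} hxy => by
    by_contra! h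
    obtain ⟨n, u, hu, rfl⟩ := exists_eq_pow_mul_isUnit ht h.1
    obtain ⟨m, w, hw, rfl⟩ := exists_eq_pow_mul_isUnit ht h.2
    rw [mul_mul_mul_comm, ← pow_add, (hu.mul hw).mul_left_eq_zero] at hxy
    exact nonZeroDivisors.ne_zero (pow_mem hreg (n + m)) hxy⟩
  exact NoZeroDivisors.to_isDomain S

lemma isDiscreteValuationRing_of_maximalIdeal_eq_span {S : Type*} [CommRing S] [IsDomain S]
    [IsLocalRing S] [IsNoetherianRing S] {t : S}
    (ht : IsLocalRing.maximalIdeal S = Ideal.span {t}) (ht0 : t ≠ 0) :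
    IsDiscreteValuationRing S := by
  have hfield : ¬ IsField S := by
    rwa [IsLocalRing.isField_iff_maximalIdeal_eq, ht, Ideal.span_singleton_eq_bot]
  have hprincipal : (IsLocalRing.maximalIdeal S).IsPrincipal := ⟨t, ht⟩
  exact ((IsDiscreteValuationRing.TFAE S hfield).out 0 4).mpr hprincipal

lemma isField_or_isDiscreteValuationRing_of_etale (R : Type*) {A : Type*}
    [CommRing R] [IsDomain R] [IsPrincipalIdealRing R] [CommRing A] [Algebra R A]
    [Algebra.Etale R A] (q : Ideal A) [q.IsPrime] :
    IsField (Localization.AtPrime q) ∨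
      ∃ _ : IsDomain (Localization.AtPrime q),
        IsDiscreteValuationRing (Localization.AtPrime q) := by
  let p := q.under R
  let := Localization.AtPrime.algebraOfLiesOver p q
  have : IsNoetherianRing A := Algebra.FiniteType.isNoetherianRing R A
  have hmap := ((Algebra.isUnramifiedAt_iff_map_eq R p q).mp inferInstance).2
  obtain ⟨g, hg⟩ := IsPrincipalIdealRing.principal p
  rw [hg, Ideal.submodule_span_eq, Ideal.map_span, Set.image_singleton] at hmap
  by_cases hg0 : g = 0
  · left
    rw [hg0, map_zero, Ideal.span_singleton_eq_bot.mpr rfl] at hmap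
    exact IsLocalRing.isField_iff_maximalIdeal_eq.mpr hmap.symm
  · right
    have : Module.Flat R (Localization.AtPrime q) := Module.Flat.trans R A _
    have hreg : algebraMap R (Localization.AtPrime q) g ∈ nonZeroDivisors _ := by
      have hsmul : IsSMulRegular (Localization.AtPrime q)
          (algebraMap R (Localization.AtPrime q) g) :=
        IsSMulRegular.of_flat fun a b hab => mul_left_cancel₀ hg0 hab
      rw [mem_nonZeroDivisors_iff_right]
      exact fun x hx => hsmul.right_eq_zero_of_smul ((mul_comm _ x).trans hx)
    have := isDomain_of_maximalIdeal_eq_span hmap.symm hreg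
    exact ⟨this, isDiscreteValuationRing_of_maximalIdeal_eq_span hmap.symm
      (nonZeroDivisors.ne_zero hreg)⟩

lemma finiteDimensional_and_isSeparable_of_etale (R A E F : Type*) [CommRing R] [CommRing A]
    [Field E] [Field F] [Algebra R A] [Algebra.Etale R A] [Algebra A F] [IsFractionRing A F]
    [Algebra R F] [IsScalarTower R A F] [Algebra R E] [Algebra E F] [IsScalarTower R E F] :
    FiniteDimensional E F ∧ Algebra.IsSeparable E F := by
  have : Algebra.FormallyUnramified A F := .of_isLocalization (nonZeroDivisors A)
  have : Algebra.FormallyUnramified R F := .comp R A F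
  have : Algebra.FormallyUnramified E F := .of_restrictScalars R E F
  have : Algebra.EssFiniteType A F := .of_isLocalization F (nonZeroDivisors A)
  have : Algebra.EssFiniteType R F := .comp R A F
  have : Algebra.EssFiniteType E F := .of_comp R E F
  exact ⟨Algebra.FormallyUnramified.finite_of_free E F,
    Algebra.FormallyUnramified.isSeparable E F⟩

section StandardSmooth

variable (K : Type*) {A : Type*} [Field K] [CommRing A] [Algebra K A]
  [Algebra.IsStandardSmoothOfRelativeDimension 1 K A]

include K

lemma isField_or_isDiscreteValuationRing_of_isStandardSmooth (q : Ideal A) [q.IsPrime] :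
    IsField (Localization.AtPrime q) ∨
      ∃ _ : IsDomain (Localization.AtPrime q),
        IsDiscreteValuationRing (Localization.AtPrime q) := by
  obtain ⟨g, hg⟩ :=
    Algebra.IsStandardSmoothOfRelativeDimension.exists_etale_mvPolynomial (n := 1) (R := K) (S := A)
  let := g.toRingHom.toAlgebra
  have : Algebra.Etale (MvPolynomial (Fin 1) K) A := hg
  have : IsPrincipalIdealRing (MvPolynomial (Fin 1) K) :=
    IsPrincipalIdealRing.of_surjective (MvPolynomial.uniqueAlgEquiv K (Fin 1)).symm.toRingEquiv
      (MvPolynomial.uniqueAlgEquiv K (Fin 1)).symm.surjective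
  exact isField_or_isDiscreteValuationRing_of_etale (MvPolynomial (Fin 1) K) q

variable (A) [IsDomain A]

/- Otherwise the polynomial ring over which `A` is étale would be a field by the
Nullstellensatz. -/
lemma not_isField_of_isStandardSmooth : ¬ IsField A := fun hA => by
  obtain ⟨g, hg⟩ :=
    Algebra.IsStandardSmoothOfRelativeDimension.exists_etale_mvPolynomial (n := 1) (R := K) (S := A)
  let R := MvPolynomial (Fin 1) K
  let := g.toRingHom.toAlgebra
  have : Algebra.Etale R A := hg
  let := hA.toField
  have : Module.Finite R A := finite_of_finite_type_of_isJacobsonRing R A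
  have hR : IsField R :=
    isField_of_isIntegral_of_isField (FaithfulSMul.algebraMap_injective R A) hA
  exact Polynomial.not_isField K
    ((MvPolynomial.uniqueAlgEquiv K (Fin 1)).symm.toMulEquiv.isField hR)

open IntermediateField in
lemma exists_adjoin_isSeparable_of_isStandardSmooth (F : Type*) [Field F] [Algebra A F]
    [Algebra K F] [IsScalarTower K A F] [IsFractionRing A F] :
    ∃ t : F, t ∉ Set.range (algebraMap K F) ∧ FiniteDimensional K⟮t⟯ F ∧
      Algebra.IsSeparable K⟮t⟯ F := by
  obtain ⟨g, hg⟩ :=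
    Algebra.IsStandardSmoothOfRelativeDimension.exists_etale_mvPolynomial (n := 1) (R := K) (S := A)
  let R := MvPolynomial (Fin 1) K
  let := g.toRingHom.toAlgebra
  have : Algebra.Etale R A := hg
  let t := algebraMap A F (g (MvPolynomial.X 0))
  refine ⟨t, ?_, ?_⟩
  · rintro ⟨a, ha⟩
    rw [IsScalarTower.algebraMap_apply K A F] at ha
    have hg_eq : g (MvPolynomial.C a) = g (MvPolynomial.X 0) :=
      (g.commutes a).trans (IsFractionRing.injective A F ha)
    have hC_eq : (MvPolynomial.C a : R) = MvPolynomial.X 0 :=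
      FaithfulSMul.algebraMap_injective R A hg_eq
    simpa using congrArg MvPolynomial.totalDegree hC_eq
  · let φ : R →ₐ[K] K⟮t⟯ := MvPolynomial.aeval fun _ => AdjoinSimple.gen K t
    let := φ.toRingHom.toAlgebra
    let := ((algebraMap A F).comp (algebraMap R A)).toAlgebra
    have : IsScalarTower R A F := .of_algebraMap_eq fun _ => rfl
    have : IsScalarTower R K⟮t⟯ F := by
      refine .of_algebraMap_eq' (MvPolynomial.ringHom_ext (fun a => ?_) fun i => ?_)
      · change algebraMap A F (g (MvPolynomial.C a)) = algebraMap K⟮t⟯ F (φ (MvPolynomial.C a))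
        rw [← MvPolynomial.algebraMap_eq, AlgHom.commutes, AlgHom.commutes,
          ← IsScalarTower.algebraMap_apply, ← IsScalarTower.algebraMap_apply]
      · change algebraMap A F (g (MvPolynomial.X i)) = algebraMap K⟮t⟯ F (φ (MvPolynomial.X i))
        rw [MvPolynomial.aeval_X, Subsingleton.elim i 0]
        rfl
    exact finiteDimensional_and_isSeparable_of_etale R A K⟮t⟯ F

end StandardSmooth

end LocalAlgebra

/-! ### Function fields of curves and their places -/

section CurveStalks

variable {k : Type u} [Field k] {X : Scheme.{u}} (f : X ⟶ Spec (.of k))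

/-- The structure map of the sections of a `k`-scheme over an open subset, as a ring homomorphism
from `k`. -/
def toSection (U : X.Opens) : k →+* Γ(X, U) :=
  (f.appLE ⊤ U le_top).hom.comp (Scheme.ΓSpecIso (.of k)).inv.hom

lemma germ_toSection (U : X.Opens) (x : X) (hx : x ∈ U) (a : k) :
    X.presheaf.germ U x hx (toSection f U a) = toStalk f x a := by
  simp only [toStalk, toSection, Scheme.Hom.appLE, CommRingCat.hom_comp, RingHom.comp_apply]
  exact TopCat.Presheaf.germ_res_apply ..

lemma exists_isStandardSmooth [hf : IsCurve f] (x : X) :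
    ∃ U : X.Opens, IsAffineOpen U ∧ x ∈ U ∧
      (toSection f U).IsStandardSmoothOfRelativeDimension 1 := by
  obtain ⟨V, -, U, hU, hx, e, h⟩ := hf.smooth.exists_isStandardSmoothOfRelativeDimension x
  obtain rfl : V = ⊤ := top_le_iff.mp fun y _ => Subsingleton.elim (f x) y ▸ e hx
  refine ⟨U, hU, hx, ?_⟩
  exact RingHom.isStandardSmoothOfRelativeDimension_respectsIso.2 _
    (Scheme.ΓSpecIso (.of k)).symm.commRingCatIsoToRingEquiv h

lemma isField_or_isDiscreteValuationRing_stalk [IsCurve f] (x : X) :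
    IsField (X.presheaf.stalk x) ∨
      ∃ _ : IsDomain (X.presheaf.stalk x), IsDiscreteValuationRing (X.presheaf.stalk x) := by
  obtain ⟨U, hU, hx, h⟩ := exists_isStandardSmooth f x
  let := (toSection f U).toAlgebra
  have : Algebra.IsStandardSmoothOfRelativeDimension 1 k Γ(X, U) := h
  let := X.presheaf.algebra_section_stalk (⟨x, hx⟩ : U)
  have := hU.isLocalization_stalk ⟨x, hx⟩
  let q := (hU.primeIdealOf ⟨x, hx⟩).asIdeal
  let e := (IsLocalization.algEquiv q.primeCompl (Localization.AtPrime q)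
    (X.presheaf.stalk x)).toRingEquiv
  obtain h | ⟨h, h'⟩ :=
    isField_or_isDiscreteValuationRing_of_isStandardSmooth k q
  · exact Or.inl (e.symm.toMulEquiv.isField h)
  · have : IsDomain (X.presheaf.stalk x) := e.symm.toMulEquiv.isDomain _
    exact Or.inr ⟨this, IsDiscreteValuationRing.RingEquivClass.isDiscreteValuationRing e⟩

lemma IsCurve.isIntegral [hf : IsCurve f] : IsIntegral X := by
  have := IsCurve.irreducibleSpace f
  have : ∀ x : X, _root_.IsReduced (X.presheaf.stalk x) := fun x => by
    obtain h | ⟨h, -⟩ := isField_or_isDiscreteValuationRing_stalk f x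
    · have := h.isDomain
      infer_instance
    · infer_instance
  have := isReduced_of_isReduced_stalk X
  exact isIntegral_of_irreducibleSpace_of_isReduced X

end CurveStalks

section FunctionField

variable {k : Type u} [Field k] {X : Scheme.{u}} (f : X ⟶ Spec (.of k)) [hf : IsCurve f]

/-- The function field of a curve; irreducibility comes from the structure morphism. -/
def FunctionField : Type u :=
  haveI := IsCurve.irreducibleSpace f
  X.functionField

instance : Field (FunctionField f) :=
  haveI := IsCurve.isIntegral f
  inferInstanceAs (Field X.functionField)

instance : Algebra k (FunctionField f) :=
  haveI := IsCurve.irreducibleSpace f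
  functionFieldAlgebra f

instance (x : X) : Algebra (X.presheaf.stalk x) (FunctionField f) :=
  haveI := IsCurve.irreducibleSpace f
  inferInstanceAs (Algebra (X.presheaf.stalk x) X.functionField)

instance (x : X) : IsFractionRing (X.presheaf.stalk x) (FunctionField f) :=
  haveI := IsCurve.isIntegral f
  inferInstanceAs (IsFractionRing (X.presheaf.stalk x) X.functionField)

end FunctionField

section Points

variable {k : Type u} [Field k] {X : Scheme.{u}} (f : X ⟶ Spec (.of k)) [hf : IsCurve f]

/-- The generic point of a curve. -/
def generic : X :=
  haveI := IsCurve.irreducibleSpace f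
  genericPoint X

lemma generic_specializes (x : X) : generic f ⤳ x := by
  have := IsCurve.irreducibleSpace f
  exact (genericPoint_spec X).specializes trivial

lemma algebraMap_functionField (x : X) : algebraMap (X.presheaf.stalk x) (FunctionField f) =
    (X.presheaf.stalkSpecializes (generic_specializes f x)).hom := rfl

lemma algebraMap_stalk_toStalk (x : X) (a : k) :
    algebraMap (X.presheaf.stalk x) (FunctionField f) (toStalk f x a) =
      algebraMap k (FunctionField f) a := by
  have := IsCurve.irreducibleSpace f
  exact algebraMap_toStalk f x a

lemma algebraMap_stalkSpecializes {x y : X} (h : x ⤳ y) (a : X.presheaf.stalk y) :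
    algebraMap (X.presheaf.stalk x) (FunctionField f) (X.presheaf.stalkSpecializes h a) =
      algebraMap (X.presheaf.stalk y) (FunctionField f) a := by
  rw [algebraMap_functionField, algebraMap_functionField,
    ← TopCat.Presheaf.stalkSpecializes_comp X.presheaf (generic_specializes f x) h]
  rfl

lemma algebraMap_stalk_injective (x : X) :
    Function.Injective (algebraMap (X.presheaf.stalk x) (FunctionField f)) :=
  have := IsCurve.isIntegral f
  IsFractionRing.injective _ _

lemma primeIdealOf_eq_bot {X : Scheme.{u}} [IsIntegral X] {U : X.Opens} (hU : IsAffineOpen U)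
    {y : X} (hy : y ∈ U) (h : IsField (X.presheaf.stalk y)) :
    (hU.primeIdealOf ⟨y, hy⟩).asIdeal = ⊥ := by
  let := X.presheaf.algebra_section_stalk (⟨y, hy⟩ : U)
  have := hU.isLocalization_stalk ⟨y, hy⟩
  rw [eq_bot_iff]
  intro a ha
  by_contra ha0
  have hgerm := (IsLocalization.AtPrime.to_map_mem_maximal_iff (X.presheaf.stalk y)
    (hU.primeIdealOf ⟨y, hy⟩).asIdeal a).mpr ha
  rw [IsLocalRing.isField_iff_maximalIdeal_eq.mp h, Ideal.mem_bot] at hgerm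
  have hinj : Function.Injective (X.presheaf.germ U y hy) := germ_injective_of_isIntegral X y hy
  exact ha0 (hinj (hgerm.trans (map_zero _).symm))

lemma isField_stalk_generic : IsField (X.presheaf.stalk (generic f)) :=
  Field.toIsField (FunctionField f)

lemma isField_stalk_iff (x : X) : IsField (X.presheaf.stalk x) ↔ x = generic f := by
  have := IsCurve.isIntegral f
  constructor
  · intro h
    obtain ⟨U, hU, hx, -⟩ := exists_isStandardSmooth f x
    have hη : generic f ∈ U := (generic_specializes f x).mem_open U.2 hx
    have heq : hU.primeIdealOf ⟨x, hx⟩ = hU.primeIdealOf ⟨generic f, hη⟩ :=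
      PrimeSpectrum.ext ((primeIdealOf_eq_bot hU hx h).trans
        (primeIdealOf_eq_bot hU hη (isField_stalk_generic f)).symm)
    simpa only [hU.fromSpec_primeIdealOf] using congrArg hU.fromSpec heq
  · rintro rfl
    exact isField_stalk_generic f

lemma isDiscreteValuationRing_stalk [IsIntegral X] {x : X} (hx : x ≠ generic f) :
    IsDiscreteValuationRing (X.presheaf.stalk x) := by
  obtain h | ⟨_, h⟩ := isField_or_isDiscreteValuationRing_stalk f x
  · exact absurd ((isField_stalk_iff f x).mp h) hx
  · exact h

lemma exists_algebraMap_stalk_ne {x : X} (hx : x ≠ generic f) :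
    ∃ z : FunctionField f, z ∉ Set.range (algebraMap (X.presheaf.stalk x) (FunctionField f)) := by
  by_contra! h
  refine hx ((isField_stalk_iff f x).mp ?_)
  exact (RingEquiv.ofBijective (algebraMap (X.presheaf.stalk x) (FunctionField f))
    ⟨algebraMap_stalk_injective f x, h⟩).toMulEquiv.isField (Field.toIsField _)

/-- The place of the function field given by a point of a curve other than the generic one. -/
def placeOf {x : X} (hx : x ≠ generic f) : Place k (FunctionField f) :=
  haveI := IsCurve.isIntegral f
  haveI := isDiscreteValuationRing_stalk f hx
  { ring :=
      { (algebraMap (X.presheaf.stalk x) (FunctionField f)).range with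
        mem_or_inv_mem' := fun z =>
          ValuationRing.isInteger_or_isInteger (X.presheaf.stalk x) z }
    algebraMap_mem := fun a => ⟨toStalk f x a, algebraMap_stalk_toStalk f x a⟩
    ne_top := fun h => by
      obtain ⟨z, hz⟩ := exists_algebraMap_stalk_ne f hx
      exact hz (h.ge (ValuationSubring.mem_top z)) }

/-- A local ring of a curve is the valuation ring of the corresponding place. -/
def stalkEquiv {x : X} (hx : x ≠ generic f) : X.presheaf.stalk x ≃+* (placeOf f hx).ring :=
  RingEquiv.ofBijective
    ((algebraMap (X.presheaf.stalk x) (FunctionField f)).codRestrict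
      (placeOf f hx).ring.toSubring fun a => ⟨a, rfl⟩)
    ⟨fun _ _ h => algebraMap_stalk_injective f x (congrArg Subtype.val h),
      fun ⟨_, a, ha⟩ => ⟨a, Subtype.ext ha⟩⟩

lemma isDiscreteValuationRing_placeOf {x : X} (hx : x ≠ generic f) :
    IsDiscreteValuationRing (placeOf f hx).ring :=
  have := IsCurve.isIntegral f
  have := isDiscreteValuationRing_stalk f hx
  IsDiscreteValuationRing.RingEquivClass.isDiscreteValuationRing (stalkEquiv f hx)

lemma SpecMap_fromSpecStalk_closedPoint {X : Scheme.{u}} {x : X} {R : CommRingCat.{u}}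
    [IsLocalRing R] (φ : X.presheaf.stalk x ⟶ R) [IsLocalHom φ.hom] :
    (Spec.map φ ≫ X.fromSpecStalk x) (IsLocalRing.closedPoint R) = x := by
  have h : Spec.map φ (IsLocalRing.closedPoint R) = IsLocalRing.closedPoint (X.presheaf.stalk x) :=
    Spec_closedPoint (f := φ)
  exact (congrArg (X.fromSpecStalk x) h).trans Scheme.fromSpecStalk_closedPoint

lemma bijective_stalkSpecializes_of_placeOf_eq {x y : X} {hx : x ≠ generic f} {hy : y ≠ generic f}
    (hxy : x ⤳ y) (h : placeOf f hy = placeOf f hx) :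
    Function.Bijective (X.presheaf.stalkSpecializes hxy).hom := by
  constructor
  · intro a b hab
    refine algebraMap_stalk_injective f y ?_
    rw [← algebraMap_stalkSpecializes f hxy, ← algebraMap_stalkSpecializes f hxy]
    exact congrArg _ hab
  · intro b
    obtain ⟨a, ha⟩ : algebraMap _ (FunctionField f) b ∈ (placeOf f hy).ring := h ▸ ⟨b, rfl⟩
    refine ⟨a, algebraMap_stalk_injective f x ?_⟩
    rw [← ha]
    exact algebraMap_stalkSpecializes f hxy a

lemma eq_of_bijective_stalkSpecializes {X : Scheme.{u}} {x y : X} (hxy : x ⤳ y)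
    (h : Function.Bijective (X.presheaf.stalkSpecializes hxy).hom) : x = y := by
  have : IsLocalHom (X.presheaf.stalkSpecializes hxy).hom :=
    ⟨fun _ ha => (MulEquiv.isUnit_map (RingEquiv.ofBijective _ h)).mp ha⟩
  have hpoint := SpecMap_fromSpecStalk_closedPoint (X.presheaf.stalkSpecializes hxy)
  rwa [Scheme.SpecMap_stalkSpecializes_fromSpecStalk, Scheme.fromSpecStalk_closedPoint] at hpoint

/- The local ring of a specialization is contained in the local ring of the point, and there are no
strict inclusions between discrete valuation rings of a field. -/
lemma isClosed_of_ne_generic {x : X} (hx : x ≠ generic f) : IsClosed {x} := by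
  refine isClosed_of_closure_subset fun y hy => ?_
  have hxy : x ⤳ y := specializes_iff_mem_closure.mpr hy
  have hyη : y ≠ generic f := by
    rintro rfl
    exact hx (hxy.antisymm (generic_specializes f x)).eq
  have hle : (placeOf f hyη).ring ≤ (placeOf f hx).ring := by
    rintro z ⟨a, rfl⟩
    exact ⟨_, algebraMap_stalkSpecializes f hxy a⟩
  have := isDiscreteValuationRing_placeOf f hyη
  exact (eq_of_bijective_stalkSpecializes hxy
    (bijective_stalkSpecializes_of_placeOf_eq f hxy (Place.eq_of_le hle))).symm

/- An affine neighbourhood of a closed generic point would be the spectrum of a field. -/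
lemma ne_generic_of_isClosed {x : X} (hx : IsClosed {x}) : x ≠ generic f := by
  rintro rfl
  have := IsCurve.isIntegral f
  obtain ⟨U, hU, hη, hsmooth⟩ := exists_isStandardSmooth f (generic f)
  have : Nonempty U := ⟨⟨_, hη⟩⟩
  let := (toSection f U).toAlgebra
  have : Algebra.IsStandardSmoothOfRelativeDimension 1 k Γ(X, U) := hsmooth
  have hmax := hU.primeIdealOf_isMaximal_of_isClosed ⟨_, hη⟩ hx
  rw [primeIdealOf_eq_bot hU hη (isField_stalk_generic f)] at hmax
  exact not_isField_of_isStandardSmooth k Γ(X, U) (Ring.isField_iff_maximal_bot.mpr hmax)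

lemma exists_adjoin_isSeparable :
    ∃ t : FunctionField f, t ∉ Set.range (algebraMap k (FunctionField f)) ∧
      FiniteDimensional (IntermediateField.adjoin k {t}) (FunctionField f) ∧
      Algebra.IsSeparable (IntermediateField.adjoin k {t}) (FunctionField f) := by
  have := IsCurve.isIntegral f
  obtain ⟨U, hU, hη, hsmooth⟩ := exists_isStandardSmooth f (generic f)
  have : Nonempty U := ⟨⟨_, hη⟩⟩
  let := (toSection f U).toAlgebra
  have : Algebra.IsStandardSmoothOfRelativeDimension 1 k Γ(X, U) := hsmooth
  let : Algebra Γ(X, U) (FunctionField f) := inferInstanceAs (Algebra Γ(X, U) X.functionField)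
  have : IsFractionRing Γ(X, U) (FunctionField f) :=
    functionField_isFractionRing_of_isAffineOpen X U hU
  have : IsScalarTower k Γ(X, U) (FunctionField f) :=
    .of_algebraMap_eq fun a => (germ_toSection f U _ hη a).symm
  exact exists_adjoin_isSeparable_of_isStandardSmooth k Γ(X, U) (FunctionField f)

end Points

section Centers

lemma fromSpecStalk_comp {k : Type u} [Field k] {X : Scheme.{u}} (f : X ⟶ Spec (.of k)) (x : X) :
    X.fromSpecStalk x ≫ f = Spec.map (CommRingCat.ofHom (toStalk f x)) := by
  have toStalk_eq : CommRingCat.ofHom (toStalk f x) =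
      (Scheme.ΓSpecIso (.of k)).inv ≫ f.appTop ≫ X.presheaf.germ ⊤ x trivial := rfl
  rw [toStalk_eq, Spec.map_comp, Spec.map_comp, ← Scheme.fromSpecStalk_toSpecΓ, Category.assoc,
    Category.assoc, ← Scheme.toSpecΓ_naturality_assoc, ← SpecMap_ΓSpecIso_hom, ← Spec.map_comp,
    Iso.inv_hom_id, Spec.map_id, Category.comp_id]

variable {k : Type u} [Field k] {X : Scheme.{u}} (f : X ⟶ Spec (.of k)) [hf : IsCurve f]

/-- The inclusion of the generic point of a curve. -/
def fromSpecFunctionField : Spec (.of (FunctionField f)) ⟶ X := X.fromSpecStalk (generic f)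

lemma SpecMap_algebraMap_fromSpecStalk (x : X) :
    Spec.map (CommRingCat.ofHom (algebraMap (X.presheaf.stalk x) (FunctionField f))) ≫
      X.fromSpecStalk x = fromSpecFunctionField f :=
  Scheme.SpecMap_stalkSpecializes_fromSpecStalk (generic_specializes f x)

/-- The square of the valuative criterion given by a place of the function field. -/
def valuativeCommSq (w : Place k (FunctionField f)) : ValuativeCommSq f where
  R := w.ring
  K := FunctionField f
  i₁ := fromSpecFunctionField f
  i₂ := Spec.map (CommRingCat.ofHom
    ((algebraMap k (FunctionField f)).codRestrict w.ring.toSubring w.algebraMap_mem))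
  commSq := ⟨by
    refine (fromSpecStalk_comp f _).trans ?_
    rw [← Spec.map_comp]
    rfl⟩

lemma valuativeCriterion : ValuativeCriterion f := by
  have := hf.isProper
  rw [IsProper.eq_valuativeCriterion] at this
  exact this.1.1.1

lemma algebraMap_stalk_surjective_of_eq_generic {x : X} (hx : x = generic f) :
    Function.Surjective (algebraMap (X.presheaf.stalk x) (FunctionField f)) := by
  have := IsCurve.isIntegral f
  exact (IsFractionRing.surjective_iff_isField
    (R := X.presheaf.stalk x) (K := FunctionField f)).mpr ((isField_stalk_iff f x).mpr hx)

lemma exists_stalk_ringHom_of_lift {w : Place k (FunctionField f)} {l : Spec (.of w.ring) ⟶ X}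
    (hl : Spec.map (CommRingCat.ofHom (algebraMap w.ring (FunctionField f))) ≫ l =
      fromSpecFunctionField f) :
    ∃ φ : X.presheaf.stalk (l (IsLocalRing.closedPoint w.ring)) →+* w.ring,
      ∀ a, (φ a : FunctionField f) = algebraMap _ _ a := by
  let φ : X.presheaf.stalk (l (IsLocalRing.closedPoint w.ring)) ⟶ .of w.ring :=
    Scheme.stalkClosedPointTo l
  have SpecMap_comp : Spec.map φ ≫ X.fromSpecStalk _ = l :=
    Scheme.Spec_stalkClosedPointTo_fromSpecStalk l
  have hφ : φ ≫ CommRingCat.ofHom (algebraMap w.ring (FunctionField f)) =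
      CommRingCat.ofHom (algebraMap (X.presheaf.stalk _) (FunctionField f)) := by
    apply Spec.map_injective
    rw [← cancel_mono (X.fromSpecStalk _), Spec.map_comp, Category.assoc, SpecMap_comp,
      SpecMap_algebraMap_fromSpecStalk]
    exact hl
  exact ⟨φ.hom, fun a => congrArg (fun ψ => ψ.hom a) hφ⟩

lemma placeOf_surjective (w : Place k (FunctionField f)) :
    ∃ (x : X) (hx : x ≠ generic f), placeOf f hx = w := by
  obtain ⟨⟨l, hl, -⟩⟩ := (CommSq.HasLift.iff _).mp ((valuativeCriterion f).existence
    (valuativeCommSq f w))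
  change Spec (.of w.ring) ⟶ X at l
  obtain ⟨φ, hφ⟩ := exists_stalk_ringHom_of_lift f hl
  have hx : l (IsLocalRing.closedPoint w.ring) ≠ generic f := by
    intro hx
    obtain ⟨z, hz⟩ := w.exists_notMem
    obtain ⟨a, rfl⟩ := algebraMap_stalk_surjective_of_eq_generic f hx z
    exact hz (hφ a ▸ (φ a).2)
  have := isDiscreteValuationRing_placeOf f hx
  refine ⟨_, hx, Place.eq_of_le ?_⟩
  rintro _ ⟨a, rfl⟩
  exact hφ a ▸ (φ a).2

lemma exists_liftStruct_of_placeOf_eq {x : X} {hx : x ≠ generic f} {w : Place k (FunctionField f)}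
    (hw : placeOf f hx = w) : ∃ l : (valuativeCommSq f w).commSq.LiftStruct,
      l.l (IsLocalRing.closedPoint w.ring) = x := by
  subst hw
  let φ : X.presheaf.stalk x ⟶ .of (placeOf f hx).ring :=
    CommRingCat.ofHom (stalkEquiv f hx).toRingHom
  have : IsLocalHom φ.hom := ⟨fun a ha => (MulEquiv.isUnit_map (stalkEquiv f hx)).mp ha⟩
  refine ⟨⟨Spec.map φ ≫ X.fromSpecStalk x, ?_, ?_⟩, SpecMap_fromSpecStalk_closedPoint φ⟩
  · have hφ : φ ≫ CommRingCat.ofHom (algebraMap (placeOf f hx).ring (FunctionField f)) =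
      CommRingCat.ofHom (algebraMap (X.presheaf.stalk x) (FunctionField f)) := rfl
    have := SpecMap_algebraMap_fromSpecStalk f x
    rw [← hφ, Spec.map_comp, Category.assoc] at this
    exact this
  · rw [Category.assoc, fromSpecStalk_comp]
    refine (Spec.map_comp _ _).symm.trans (congrArg Spec.map ?_)
    ext a
    exact Subtype.ext (algebraMap_stalk_toStalk f x a)

lemma eq_of_placeOf_eq {x y : X} {hx : x ≠ generic f} {hy : y ≠ generic f}
    (h : placeOf f hx = placeOf f hy) : x = y := by
  obtain ⟨l, hl⟩ := exists_liftStruct_of_placeOf_eq f h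
  obtain ⟨l', hl'⟩ := exists_liftStruct_of_placeOf_eq f (rfl : placeOf f hy = _)
  have := (valuativeCriterion f).uniqueness (valuativeCommSq f (placeOf f hy))
  obtain rfl := Subsingleton.elim l l'
  exact hl.symm.trans hl'

/-- The closed points of a curve are the places of its function field. -/
def closedPointsEquiv : closedPoints X ≃ Place k (FunctionField f) :=
  Equiv.ofBijective (fun x => placeOf f (ne_generic_of_isClosed f x.2))
    ⟨fun _ _ h => Subtype.ext (eq_of_placeOf_eq f h), fun w => by
      obtain ⟨x, hx, rfl⟩ := placeOf_surjective f w
      exact ⟨⟨x, isClosed_of_ne_generic f hx⟩, rfl⟩⟩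

end Centers

section Genus

open IntermediateField

lemma adjoin_gen_eq_top {K F : Type*} [Field K] [Field F] [Algebra K F] (t : F) :
    K⟮AdjoinSimple.gen K t⟯ = ⊤ := by
  apply IntermediateField.lift_injective
  rw [lift_adjoin_simple, lift_top]
  rfl

variable {k : Type u} [Field k] [IsAlgClosed k] {X : Scheme.{u}} (f : X ⟶ Spec (.of k))
  [hf : IsCurve f]

instance : IsCurveField k (FunctionField f) := by
  obtain ⟨t, -, hfin, hsep⟩ := exists_adjoin_isSeparable f
  have : IsCurveField k k⟮t⟯ := IsCurveField.of_adjoin_eq_top (adjoin_gen_eq_top t)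
  exact IsCurveField.of_finite_separable k k⟮t⟯ _

instance : Nonempty (Place k (FunctionField f)) := by
  obtain ⟨t, ht, -, -⟩ := exists_adjoin_isSeparable f
  obtain ⟨w, -⟩ := Place.exists_notMem_of_notMem_range (K := k) ht
  exact ⟨w⟩

lemma hOne_ne_top : hOne (Place.lattice : Place k (FunctionField f) → _) ≠ ⊤ := by
  obtain ⟨t, ht, hfin, hsep⟩ := exists_adjoin_isSeparable f
  have hgen := adjoin_gen_eq_top (K := k) t
  have : IsCurveField k k⟮t⟯ := IsCurveField.of_adjoin_eq_top hgen
  have gen_notMem_range : AdjoinSimple.gen k t ∉ Set.range (algebraMap k k⟮t⟯) := by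
    rintro ⟨a, ha⟩
    exact ht ⟨a, congrArg Subtype.val ha⟩
  have : Nonempty (Place k k⟮t⟯) :=
    (Place.exists_notMem_of_notMem_range gen_notMem_range).nonempty
  refine hOne_lattice_ne_top_of_finite_separable (E := k⟮t⟯) _ ?_
  rw [hOne_eq_zero_of_adjoin_eq_top hgen]
  exact ENat.zero_ne_top

omit [IsAlgClosed k] in
lemma hOne_localSubspace_eq [IrreducibleSpace X] :
    hOne (R := k) (V := FunctionField f) (fun x : closedPoints X => localSubspace f x) =
      hOne (Place.lattice : Place k (FunctionField f) → _) := by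
  refine hOne_eq_of_map (e := LinearEquiv.refl k _) (σ := (closedPointsEquiv f).symm)
    (fun z x => ⟨?_, fun h => ?_⟩) (fun x => ?_) fun x r _ => ⟨r (closedPointsEquiv f x), ?_⟩
  · rintro h w rfl
    obtain ⟨x, rfl⟩ := (closedPointsEquiv f).surjective w
    rw [Equiv.symm_apply_apply] at h
    exact h
  · exact h (closedPointsEquiv f x) ((closedPointsEquiv f).symm_apply_apply x)
  · exact (Set.finite_singleton x).preimage (closedPointsEquiv f).symm.injective.injOn
  · rintro w rfl
    have sub_eq_zero : r w - r w = 0 := sub_self _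
    rw [Equiv.apply_symm_apply]
    exact sub_eq_zero ▸ zero_mem w.lattice

lemma genusOver_eq [IrreducibleSpace X] :
    genusOver f = (hOne (Place.lattice : Place k (FunctionField f) → _)).toNat := by
  let := functionFieldAlgebra f
  have length_H1 :
      Module.length k (H1 f) = hOne (Place.lattice : Place k (FunctionField f) → _) :=
    hOne_localSubspace_eq f
  have : Module.Finite k (H1 f) := by
    have hne : Module.length k (H1 f) ≠ ⊤ := length_H1 ▸ hOne_ne_top f
    have := (isFiniteLength_iff_isNoetherian_isArtinian.mp (Module.length_ne_top_iff.mp hne)).1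
    infer_instance
  rw [← length_H1, Module.length_eq_finrank, ENat.toNat_natCast]
  rfl

end Genus

lemma isSeparable_iff_of_isField {A E F : Type*} [CommRing A] (hA : IsField A) [Field E] [Field F]
    [Algebra A F] [Algebra E F] (e : A ≃+* E) (he : ∀ a, algebraMap E F (e a) = algebraMap A F a) :
    Algebra.IsSeparable A F ↔ Algebra.IsSeparable E F := by
  let := hA.toField
  exact Algebra.IsSeparable.iff_of_equiv_equiv e (RingEquiv.refl F) (RingHom.ext he)

section FieldMap

variable {k k' : Type u} [Field k] [Field k'] {X Y : Scheme.{u}} (f : X ⟶ Spec (.of k))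
  (g : Y ⟶ Spec (.of k')) [IsCurve f] [IsCurve g] (π : X ⟶ Y)

lemma map_generic (h : IsNonconstant π) : π (generic f) = generic g := by
  by_contra hne
  refine h ⟨π (generic f), fun x => ?_⟩
  have specializes_map : π (generic f) ⤳ π x := (generic_specializes f x).map π.continuous
  rwa [specializes_iff_mem_closure, (isClosed_of_ne_generic g hne).closure_eq] at specializes_map

variable {f g π} (h : π (generic f) = generic g)

/-- The map of function fields given by a dominant morphism of curves. -/
def fieldMap : FunctionField g →+* FunctionField f :=
  (π.stalkMap (generic f)).hom.comp (Y.presheaf.stalkSpecializes (specializes_of_eq h)).hom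

lemma algebraMap_stalkMap (x : X) (a : Y.presheaf.stalk (π x)) :
    algebraMap _ (FunctionField f) (π.stalkMap x a) = fieldMap h (algebraMap _ _ a) := by
  refine (Scheme.Hom.stalkSpecializes_stalkMap_apply π _ _ (generic_specializes f x) a).symm.trans
    (congrArg (π.stalkMap (generic f)) ?_)
  exact (ConcreteCategory.congr_hom (TopCat.Presheaf.stalkSpecializes_comp Y.presheaf
    (specializes_of_eq h) (generic_specializes g (π x))) a).symm

lemma stalkMap_toStalk {g : Y ⟶ Spec (.of k)} (hπ : π ≫ g = f) (x : X) (a : k) :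
    π.stalkMap x (toStalk g (π x) a) = toStalk f x a := by
  subst hπ
  simp only [toStalk, RingHom.comp_apply]
  refine (Scheme.Hom.germ_stalkMap_apply π ⊤ x trivial _).trans ?_
  rw [Scheme.Hom.comp_appTop]
  rfl

lemma fieldMap_algebraMap {g : Y ⟶ Spec (.of k)} [IsCurve g] (h : π (generic f) = generic g)
    (hπ : π ≫ g = f) (a : k) : fieldMap h (algebraMap k _ a) = algebraMap k _ a := by
  rw [← algebraMap_stalk_toStalk g (π (generic f)), ← algebraMap_stalkMap, stalkMap_toStalk hπ,
    algebraMap_stalk_toStalk]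

/-- The stalk at the image of the generic point is the function field. -/
def imageStalkEquiv : Y.presheaf.stalk (π (generic f)) ≃+* FunctionField g :=
  (Y.presheaf.stalkCongr (.of_eq h)).commRingCatIsoToRingEquiv

lemma fieldMap_imageStalkEquiv (a : Y.presheaf.stalk (π (generic f))) :
    fieldMap h (imageStalkEquiv h a) = π.stalkMap (generic f) a := by
  refine congrArg (π.stalkMap (generic f)) ?_
  exact (imageStalkEquiv h).symm_apply_apply a

lemma degree_eq [IrreducibleSpace X] :
    letI := (fieldMap h).toAlgebra
    degree π = Module.finrank (FunctionField g) (FunctionField f) := by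
  let := (fieldMap h).toAlgebra
  let := functionFieldExt π
  refine Algebra.finrank_eq_of_equiv_equiv (imageStalkEquiv h) (RingEquiv.refl (FunctionField f)) ?_
  ext a
  exact fieldMap_imageStalkEquiv h a

lemma isSeparableMap_iff [IrreducibleSpace X] :
    letI := (fieldMap h).toAlgebra
    IsSeparableMap π ↔ Algebra.IsSeparable (FunctionField g) (FunctionField f) := by
  let := (fieldMap h).toAlgebra
  have isField_stalk : IsField (Y.presheaf.stalk (π (generic f))) :=
    (imageStalkEquiv h).toMulEquiv.isField (Field.toIsField _)
  let : Algebra (Y.presheaf.stalk (π (generic f))) (FunctionField f) := functionFieldExt π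
  exact isSeparable_iff_of_isField isField_stalk (imageStalkEquiv h) (fieldMap_imageStalkEquiv h)

end FieldMap

section Finite

open IntermediateField

variable {k : Type u} [Field k] {X : Scheme.{u}} (f : X ⟶ Spec (.of k)) [IsCurve f]

lemma essFiniteType_functionField : Algebra.EssFiniteType k (FunctionField f) := by
  obtain ⟨t, -, hfin, -⟩ := exists_adjoin_isSeparable f
  have : Algebra.EssFiniteType k k⟮t⟯ := by
    rw [IntermediateField.essFiniteType_iff]
    exact ⟨{t}, by simp⟩
  exact Algebra.EssFiniteType.comp k k⟮t⟯ _

lemma finiteDimensional_of_isSeparable {E : Type*} [Field E] [Algebra k E]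
    [Algebra E (FunctionField f)] [IsScalarTower k E (FunctionField f)]
    [Algebra.IsSeparable E (FunctionField f)] : FiniteDimensional E (FunctionField f) := by
  have := essFiniteType_functionField f
  have := Algebra.EssFiniteType.of_comp k E (FunctionField f)
  have := Algebra.FormallyUnramified.of_isSeparable E (FunctionField f)
  exact Algebra.FormallyUnramified.finite_of_free _ _

end Finite

section Ramification

variable {k : Type u} [Field k] {X Y : Scheme.{u}} {f : X ⟶ Spec (.of k)}
  {g : Y ⟶ Spec (.of k)} [IsCurve f] [IsCurve g] {π : X ⟶ Y} (h : π (generic f) = generic g)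
  (hπ : π ≫ g = f)

include hπ in
lemma isScalarTower_fieldMap :
    letI := (fieldMap h).toAlgebra
    IsScalarTower k (FunctionField g) (FunctionField f) :=
  let := (fieldMap h).toAlgebra
  .of_algebraMap_eq fun a => (fieldMap_algebraMap h hπ a).symm

lemma isUnit_stalkMap_iff (x : X) (a : Y.presheaf.stalk (π x)) :
    IsUnit (π.stalkMap x a) ↔ IsUnit a :=
  isUnit_map_iff (π.stalkMap x).hom a

lemma map_ne_generic [letI := (fieldMap h).toAlgebra
    Algebra.IsAlgebraic (FunctionField g) (FunctionField f)] {x : X} (hx : x ≠ generic f) :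
    π x ≠ generic g := by
  let := (fieldMap h).toAlgebra
  intro hy
  have fieldMap_mem : ∀ z : FunctionField g, fieldMap h z ∈ (placeOf f hx).ring := by
    intro z
    obtain ⟨a, rfl⟩ := algebraMap_stalk_surjective_of_eq_generic g hy z
    exact ⟨_, algebraMap_stalkMap h x a⟩
  obtain ⟨z, hz⟩ := (placeOf f hx).exists_notMem
  refine hz (mem_of_isIntegral ?_)
  exact (Algebra.IsIntegral.isIntegral (R := FunctionField g) z).map_of_comp_eq
    ((fieldMap h).codRestrict (placeOf f hx).ring.toSubring fieldMap_mem) (RingHom.id _) rfl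

lemma comap_placeOf [letI := (fieldMap h).toAlgebra
    Algebra.IsAlgebraic (FunctionField g) (FunctionField f)] {x : X} (hx : x ≠ generic f)
    (hy : π x ≠ generic g) :
    letI := (fieldMap h).toAlgebra
    haveI := isScalarTower_fieldMap h hπ
    (placeOf f hx).comap (FunctionField g) = placeOf g hy := by
  let := (fieldMap h).toAlgebra
  have := isScalarTower_fieldMap h hπ
  have := isDiscreteValuationRing_placeOf g hy
  refine (Place.eq_of_le ?_).symm
  rintro _ ⟨a, rfl⟩
  exact ⟨_, algebraMap_stalkMap h x a⟩

lemma stalkEquiv_mem_maximalIdeal_pow {x : X} (hx : x ≠ generic f) (n : ℕ)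
    (a : X.presheaf.stalk x) :
    stalkEquiv f hx a ∈ IsLocalRing.maximalIdeal (placeOf f hx).ring ^ n ↔
      a ∈ IsLocalRing.maximalIdeal (X.presheaf.stalk x) ^ n := by
  rw [← IsLocalRing.map_ringEquiv_maximalIdeal (stalkEquiv f hx), ← Ideal.map_pow]
  exact Ideal.apply_mem_of_equiv_iff

lemma mk_fieldMap_eq_stalkEquiv {x : X} (hx : x ≠ generic f) (a : Y.presheaf.stalk (π x))
    (ha : fieldMap h (algebraMap _ _ a) ∈ (placeOf f hx).ring) :
    letI := (fieldMap h).toAlgebra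
    (⟨algebraMap (FunctionField g) _ (algebraMap _ _ a), ha⟩ : (placeOf f hx).ring) =
      stalkEquiv f hx (π.stalkMap x a) :=
  Subtype.ext (algebraMap_stalkMap h x a).symm

include hπ in
lemma ramIdx_eq [letI := (fieldMap h).toAlgebra
    Algebra.IsAlgebraic (FunctionField g) (FunctionField f)] {x : X} (hx : x ≠ generic f) :
    letI := (fieldMap h).toAlgebra
    ramIdx π x = (placeOf f hx).ram (FunctionField g) := by
  let := (fieldMap h).toAlgebra
  have := isScalarTower_fieldMap h hπ
  unfold ramIdx Place.ram Ideal.ramificationIdx'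
  congr 1
  ext n
  rw [Set.mem_ofPred_eq, Set.mem_ofPred_eq, Ideal.map_le_iff_le_comap]
  constructor
  · intro le_comap z hz hu
    obtain ⟨a, rfl⟩ : z ∈ (placeOf g (map_ne_generic h hx)).ring := by
      rw [← comap_placeOf h hπ hx]
      exact hz
    rw [mk_fieldMap_eq_stalkEquiv h hx a hz, MulEquiv.isUnit_map, isUnit_stalkMap_iff] at hu
    rw [mk_fieldMap_eq_stalkEquiv h hx a hz, stalkEquiv_mem_maximalIdeal_pow]
    exact le_comap hu
  · intro mem_pow a ha
    have hz : fieldMap h (algebraMap _ _ a) ∈ (placeOf f hx).ring :=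
      ⟨_, algebraMap_stalkMap h x a⟩
    have := mem_pow _ hz
    rw [mk_fieldMap_eq_stalkEquiv h hx a hz, MulEquiv.isUnit_map, isUnit_stalkMap_iff,
      stalkEquiv_mem_maximalIdeal_pow] at this
    exact this ha

end Ramification

section AlgClosed

variable {k : Type u} [Field k] [IsAlgClosed k] {X Y : Scheme.{u}} {f : X ⟶ Spec (.of k)}
  {g : Y ⟶ Spec (.of k)} [IsCurve f] [IsCurve g] [IrreducibleSpace X]
  {π : X ⟶ Y} (hπ : π ≫ g = f) (hc : IsNonconstant π) (hs : IsSeparableMap π)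

include hπ hc hs

lemma hasFibreSum_ramIdx {t : closedPoints X → closedPoints Y} (ht : ∀ x, (t x : Y) = π x) :
    HasFibreSum t (fun x => ramIdx π x) (degree π) := by
  have h := map_generic f g π hc
  let := (fieldMap h).toAlgebra
  have := isScalarTower_fieldMap h hπ
  have := (isSeparableMap_iff h).mp hs
  have := finiteDimensional_of_isSeparable f (E := FunctionField g)
  rw [degree_eq h]
  refine Place.hasFibreSum_ram.of_equiv (closedPointsEquiv f) (closedPointsEquiv g)
    (fun x => ?_) fun x => (ramIdx_eq h hπ (ne_generic_of_isClosed f x.2)).symm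
  have hx := ne_generic_of_isClosed f x.2
  refine (comap_placeOf h hπ hx (map_ne_generic h hx)).trans ?_
  simp only [← ht]
  rfl

lemma sum_ramIdx_sub_one_le [IrreducibleSpace Y] (Z : Finset (closedPoints X)) :
    ∑ x ∈ Z, ((ramIdx π x : ℤ) - 1) ≤
      2 * (genusOver f : ℤ) - 2 - degree π * (2 * (genusOver g : ℤ) - 2) := by
  have h := map_generic f g π hc
  let := (fieldMap h).toAlgebra
  have := isScalarTower_fieldMap h hπ
  have := (isSeparableMap_iff h).mp hs
  have := finiteDimensional_of_isSeparable f (E := FunctionField g)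
  rw [genusOver_eq, genusOver_eq, degree_eq h]
  refine le_of_eq_of_le ?_ (sum_ram_sub_one_le (hOne_ne_top g)
    (Z.map (closedPointsEquiv f).toEmbedding))
  rw [Finset.sum_map]
  refine Finset.sum_congr rfl fun x _ => ?_
  rw [ramIdx_eq h hπ (ne_generic_of_isClosed f x.2)]
  rfl

lemma ramIdx_pos (x : closedPoints X) : 0 < ramIdx π x := by
  have h := map_generic f g π hc
  let := (fieldMap h).toAlgebra
  have := isScalarTower_fieldMap h hπ
  have := (isSeparableMap_iff h).mp hs
  have := finiteDimensional_of_isSeparable f (E := FunctionField g)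
  rw [ramIdx_eq h hπ (ne_generic_of_isClosed f x.2)]
  exact Place.ram_pos (v := (closedPointsEquiv f x).comap (FunctionField g)) rfl

end AlgClosed

/-! ### Base change of function fields -/

section FieldBaseChange

/-- `F'` is the field of fractions of `K ⊗ F`, for field extensions `K` and `F` of `k`. The
injectivity of `K ⊗ F → F'` is encoded as the linear independence over `F` of a basis of `K`, and
its image only has to contain a ring `R` with field of fractions `F'`. -/
structure IsFieldBaseChange (k K F F' : Type*) [Field k] [Field K] [Field F] [Field F']
    [Algebra k K] [Algebra K F'] [Algebra F F'] : Prop where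
  linearIndependent :
    LinearIndependent F fun i => algebraMap K F' (Module.Basis.ofVectorSpace k K i)
  exists_subring : ∃ R : Subring F', IsFractionRing R F' ∧ ∀ z ∈ R,
    z ∈ Submodule.span F (Set.range fun i => algebraMap K F' (Module.Basis.ofVectorSpace k K i))

namespace IsFieldBaseChange

section OfIsPushout

variable (k K A B F F' : Type*) [Field k] [Field K] [CommRing A] [CommRing B] [Field F] [Field F']
  [Algebra k K] [Algebra k A] [Algebra A B] [Algebra K B] [Algebra k B] [IsScalarTower k A B]
  [IsScalarTower k K B] [Algebra.IsPushout k A K B] [Algebra A F] [IsFractionRing A F]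
  [Algebra B F'] [IsFractionRing B F'] [Algebra K F'] [Algebra F F'] [Algebra A F']
  [IsScalarTower A F F'] [IsScalarTower A B F'] [IsScalarTower K B F']

include A B

theorem of_isPushout : IsFieldBaseChange k K F F' := by
  have isBaseChange := Algebra.IsPushout.out (R := k) (S := A) (R' := K) (S' := B)
  let b := isBaseChange.basis (Module.Basis.ofVectorSpace k K)
  let ι : B →ₗ[A] F' := (IsScalarTower.toAlgHom A B F').toLinearMap
  have hb : ∀ i, ι (b i) = algebraMap K F' (Module.Basis.ofVectorSpace k K i) := fun i => by
    rw [IsScalarTower.algebraMap_apply K B F']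
    exact congrArg (algebraMap B F') (isBaseChange.basis_apply _ i)
  refine ⟨?_, (algebraMap B F').range, ?_, ?_⟩
  · rw [← LinearIndependent.iff_fractionRing A]
    simp_rw [← hb]
    exact b.linearIndependent.map' ι (LinearMap.ker_eq_bot.mpr (IsFractionRing.injective B F'))
  · refine IsFractionRing.of_field _ _ fun z => ?_
    obtain ⟨a, c, -, rfl⟩ := IsFractionRing.div_surjective (A := B) z
    exact ⟨⟨_, a, rfl⟩, ⟨_, c, rfl⟩, rfl⟩
  · let M : Submodule F F' :=
      Submodule.span F (Set.range fun i => algebraMap K F' (Module.Basis.ofVectorSpace k K i))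
    have range_le : LinearMap.range ι ≤ M.restrictScalars A := by
      rw [LinearMap.range_eq_map, ← b.span_eq, Submodule.map_span_le]
      rintro _ ⟨i, rfl⟩
      rw [hb]
      exact Submodule.subset_span ⟨i, rfl⟩
    rintro _ ⟨a, rfl⟩
    exact range_le ⟨a, rfl⟩

end OfIsPushout

variable {k K E F E' F' : Type*} [Field k] [Field K] [Field E] [Field F] [Field E'] [Field F']
  [Algebra k K] [Algebra K E'] [Algebra K F'] [Algebra F F'] [Algebra E' F']
  [IsScalarTower K E' F'] (hF : IsFieldBaseChange k K F F')

include hF in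
lemma eq_top (L : IntermediateField E' F') (hL : ∀ x : F, algebraMap F F' x ∈ L) : L = ⊤ := by
  obtain ⟨R, hR, hspan⟩ := hF.exists_subring
  have hRL : ∀ z ∈ R, z ∈ L := fun z hz => by
    refine Submodule.span_induction ?_ L.zero_mem (fun _ _ _ _ => L.add_mem) ?_ (hspan z hz)
    · rintro _ ⟨i, rfl⟩
      beta_reduce
      rw [IsScalarTower.algebraMap_apply K E' F']
      exact L.algebraMap_mem _
    · intro a x _ hx
      rw [Algebra.smul_def]
      exact L.mul_mem (hL a) hx
  refine top_le_iff.mp fun z _ => ?_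
  obtain ⟨a, b, -, rfl⟩ := IsFractionRing.div_surjective (A := R) z
  exact L.div_mem (hRL _ a.2) (hRL _ b.2)

variable [Algebra E E'] [Algebra E F] [Algebra E F'] [IsScalarTower E E' F'] [IsScalarTower E F F']

include hF in
lemma isSeparable [Algebra.IsSeparable E F] : Algebra.IsSeparable E' F' := by
  rw [← separableClosure.eq_top_iff]
  refine hF.eq_top _ fun x => ?_
  rw [mem_separableClosure_iff]
  exact ((Algebra.IsSeparable.isSeparable E x).map (IsScalarTower.toAlgHom E F F')
    (algebraMap F F').injective).tower_top E'

include hF in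
lemma span_range_algebraMap_eq_top [Algebra.IsAlgebraic E' F'] :
    Submodule.span E' (Set.range (algebraMap F F')) = ⊤ := by
  have adjoin_eq_top : IntermediateField.adjoin E' (Set.range (algebraMap F F')) = ⊤ :=
    hF.eq_top _ fun x => IntermediateField.subset_adjoin _ _ ⟨x, rfl⟩
  have range_eq_closure :
      Set.range (algebraMap F F') = Submonoid.closure (Set.range (algebraMap F F')) :=
    congrArg SetLike.coe (Submonoid.closure_eq (MonoidHom.mrange (algebraMap F F'))).symm
  rw [range_eq_closure, ← Algebra.adjoin_eq_span,
    ← IntermediateField.adjoin_toSubalgebra_of_isAlgebraic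
      fun x _ => Algebra.IsAlgebraic.isAlgebraic x,
    adjoin_eq_top, IntermediateField.top_toSubalgebra, Algebra.top_toSubmodule]

include hF in
lemma span_range_basis_eq_top [Algebra.IsSeparable E F] {ι : Type*} (b : Module.Basis ι E F) :
    Submodule.span E' (Set.range fun i => algebraMap F F' (b i)) = ⊤ := by
  have := hF.isSeparable (E := E) (E' := E')
  let M : Submodule E' F' := Submodule.span E' (Set.range fun i => algebraMap F F' (b i))
  have range_le :
      LinearMap.range (IsScalarTower.toAlgHom E F F').toLinearMap ≤ M.restrictScalars E := by
    rw [LinearMap.range_eq_map, ← b.span_eq, Submodule.map_span_le]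
    rintro _ ⟨i, rfl⟩
    exact Submodule.subset_span ⟨i, rfl⟩
  rw [eq_top_iff, ← hF.span_range_algebraMap_eq_top, Submodule.span_le]
  rintro _ ⟨x, rfl⟩
  exact range_le ⟨x, rfl⟩

omit [Field k] [Algebra k K] in
lemma algebraMap_linearCombination {J : Type*} (c : J → K) (v : J →₀ E) :
    algebraMap E' F' (Finsupp.linearCombination E (fun j => algebraMap K E' (c j)) v) =
      Finsupp.linearCombination F (fun j => algebraMap K F' (c j))
        (v.mapRange (algebraMap E F) (map_zero _)) := by
  rw [Finsupp.linearCombination_apply, Finsupp.linearCombination_apply,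
    Finsupp.sum_mapRange_index (by simp), Finsupp.sum, Finsupp.sum, map_sum]
  refine Finset.sum_congr rfl fun j _ => ?_
  rw [Algebra.smul_def, Algebra.smul_def, map_mul, ← IsScalarTower.algebraMap_apply,
    ← IsScalarTower.algebraMap_apply, ← IsScalarTower.algebraMap_apply]

variable (hE : IsFieldBaseChange k K E E')

include hE hF in
lemma linearIndependent_map {ι : Type*} {b : ι → F} (hb : LinearIndependent E b) :
    LinearIndependent E' fun i => algebraMap F F' (b i) := by
  obtain ⟨R, hR, hspan⟩ := hE.exists_subring
  rw [← LinearIndependent.iff_fractionRing R E', linearIndependent_iff']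
  intro s a ha i hi
  choose v hv using fun i => Finsupp.mem_span_range_iff_exists_finsupp.mp (hspan _ (a i).2)
  let w : ι → (_ →₀ F) := fun i => b i • (v i).mapRange (algebraMap E F) (map_zero _)
  have hw : ∀ i, Finsupp.linearCombination F (fun j => algebraMap K F'
      (Module.Basis.ofVectorSpace k K j)) (w i) = a i • algebraMap F F' (b i) := by
    intro i
    rw [map_smul, ← algebraMap_linearCombination (E' := E'), Finsupp.linearCombination_apply, hv,
      Subring.smul_def, Algebra.smul_def, Algebra.smul_def, mul_comm]
  have hsum : ∑ i ∈ s, w i = 0 := by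
    refine hF.linearIndependent.finsuppLinearCombination_injective ?_
    rw [map_zero, map_sum, ← ha]
    exact Finset.sum_congr rfl fun i _ => hw i
  have hvi : v i = 0 := by
    ext j
    refine linearIndependent_iff'.mp hb s (fun i => v i j) ?_ i hi
    rw [← Finsupp.zero_apply (M := F) (a := j), ← hsum, Finsupp.finsetSum_apply]
    refine Finset.sum_congr rfl fun i _ => ?_
    simp only [w, Finsupp.smul_apply, Finsupp.mapRange_apply, smul_eq_mul]
    rw [Algebra.smul_def, mul_comm]
  refine Subtype.ext ?_
  rw [← hv, hvi, Finsupp.sum_zero_index]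
  rfl

include hE hF in
lemma finrank_eq [Algebra.IsSeparable E F] : Module.finrank E' F' = Module.finrank E F := by
  let b := Module.Basis.ofVectorSpace E F
  let b' := Module.Basis.mk (hF.linearIndependent_map hE b.linearIndependent)
    (hF.span_range_basis_eq_top b).ge
  rw [Module.finrank_eq_nat_card_basis b, Module.finrank_eq_nat_card_basis b']

end IsFieldBaseChange

end FieldBaseChange

section Germ

variable {k : Type u} [Field k] {X : Scheme.{u}} (f : X ⟶ Spec (.of k)) [IsCurve f]

/-- The sections over a nonempty open subset as rational functions. -/
def germField {U : X.Opens} (hU : generic f ∈ U) : Γ(X, U) →+* FunctionField f :=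
  (X.presheaf.germ U (generic f) hU).hom

lemma germField_toSection {U : X.Opens} (hU : generic f ∈ U) (a : k) :
    germField f hU (toSection f U a) = algebraMap k (FunctionField f) a :=
  germ_toSection f U _ hU a

lemma isFractionRing_germField {U : X.Opens} (hU : generic f ∈ U) (h : IsAffineOpen U) :
    letI := (germField f hU).toAlgebra
    IsFractionRing Γ(X, U) (FunctionField f) :=
  have := IsCurve.isIntegral f
  have : Nonempty U := ⟨⟨_, hU⟩⟩
  functionField_isFractionRing_of_isAffineOpen X U h

lemma fieldMap_germField {k' : Type u} [Field k'] {Y : Scheme.{u}} {g : Y ⟶ Spec (.of k')}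
    [IsCurve g] {π : X ⟶ Y} (h : π (generic f) = generic g) {V : Y.Opens} {U : X.Opens}
    (e : U ≤ π ⁻¹ᵁ V) (hU : generic f ∈ U) (hρU : generic g ∈ V) (a : Γ(Y, V)) :
    fieldMap h (germField g hρU a) = germField f hU (π.appLE V U e a) := by
  have stalkSpecializes_germ :
      Y.presheaf.stalkSpecializes (specializes_of_eq h) (Y.presheaf.germ V _ hρU a) =
        Y.presheaf.germ V _ (e hU) a :=
    ConcreteCategory.congr_hom (TopCat.Presheaf.germ_stalkSpecializes Y.presheaf hρU
      (specializes_of_eq h)) a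
  refine (congrArg (π.stalkMap (generic f)) stalkSpecializes_germ).trans ?_
  refine (Scheme.Hom.germ_stalkMap_apply π V _ (e hU) a).trans ?_
  exact (TopCat.Presheaf.germ_res_apply X.presheaf (homOfLE e) _ hU _).symm

end Germ

section BaseChange

variable {k : Type u} [Field k] (K : Type u) [Field K] [Algebra k K]

instance : Surjective (specMap k K) :=
  ⟨fun _ => ⟨IsLocalRing.closedPoint K, Subsingleton.elim _ _⟩⟩

variable {X : Scheme.{u}} (f : X ⟶ Spec (.of k))

lemma isPushout_section {U : X.Opens} (hU : IsAffineOpen U) :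
    IsPushout (CommRingCat.ofHom (toSection f U)) (CommRingCat.ofHom (algebraMap k K))
      ((pullback.fst f (specMap k K)).appLE U (pullback.fst f (specMap k K) ⁻¹ᵁ U) le_rfl)
      (CommRingCat.ofHom (toSection (baseChangeHom K f) (pullback.fst f (specMap k K) ⁻¹ᵁ U))) := by
  have isPullback := IsPullback.of_hasPullback f (specMap k K)
  have preimage_eq : pullback.fst f (specMap k K) ⁻¹ᵁ U =
    pullback.fst f (specMap k K) ⁻¹ᵁ U ⊓ pullback.snd f (specMap k K) ⁻¹ᵁ ⊤ := by
      rw [Scheme.Hom.preimage_top, inf_top_eq]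
  have isPushout := (isIso_pushoutSection_iff isPullback (US := ⊤) (UT := ⊤) (UX := U)
    le_top le_top preimage_eq).mp
    (isIso_pushoutSection_of_isAffineOpen isPullback le_top le_top preimage_eq
      (isAffineOpen_top _) (isAffineOpen_top _) hU)
  refine isPushout.of_iso (Scheme.ΓSpecIso (.of k)) (Iso.refl _) (Scheme.ΓSpecIso (.of K))
    (Iso.refl _) ?_ ?_ ?_ ?_
  · rw [Iso.refl_hom, Category.comp_id, ← Iso.inv_comp_eq]
    rfl
  · rw [← Scheme.ΓSpecIso_naturality]
    congr 1
  · rw [Iso.refl_hom, Iso.refl_hom, Category.comp_id, Category.id_comp]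
  · rw [Iso.refl_hom, Category.comp_id, ← Iso.inv_comp_eq]
    rfl

variable [hf : IsCurve f]

instance : IsCurve (baseChangeHom K f) := by
  have := hf.isProper
  have := hf.geometricallyIrreducible
  exact ⟨inferInstance,
    (smoothOfRelativeDimension_isStableUnderBaseChange (n := 1)).of_isPullback
      (.of_hasPullback f (specMap k K)) hf.smooth, inferInstance⟩

lemma fst_generic :
    pullback.fst f (specMap k K) (generic (baseChangeHom K f)) = generic f := by
  obtain ⟨x, hx⟩ := (pullback.fst f (specMap k K)).surjective (generic f)
  have specializes_generic := (generic_specializes (baseChangeHom K f) x).map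
    (pullback.fst f (specMap k K)).continuous
  rw [hx] at specializes_generic
  exact (specializes_generic.antisymm (generic_specializes f _)).eq

instance : Algebra (FunctionField f) (FunctionField (baseChangeHom K f)) :=
  (fieldMap (fst_generic K f)).toAlgebra

theorem isFieldBaseChange_functionField :
    IsFieldBaseChange k K (FunctionField f) (FunctionField (baseChangeHom K f)) := by
  obtain ⟨U, hU, hη, -⟩ := exists_isStandardSmooth f (generic f)
  have : IsAffineHom (pullback.fst f (specMap k K)) :=
    isAffineHom_isStableUnderBaseChange.of_isPullback
      (IsPullback.of_hasPullback f (specMap k K)).flip inferInstance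
  let U' := pullback.fst f (specMap k K) ⁻¹ᵁ U
  have hη' : generic (baseChangeHom K f) ∈ U' := by
    change pullback.fst f (specMap k K) (generic (baseChangeHom K f)) ∈ U
    rwa [fst_generic]
  let φ : Γ(X, U) →+* Γ(baseChange K f, U') :=
    ((pullback.fst f (specMap k K)).appLE U U' le_rfl).hom
  have isPushout := isPushout_section K f hU
  let := (toSection f U).toAlgebra
  let := φ.toAlgebra
  let := (toSection (baseChangeHom K f) U').toAlgebra
  let : Algebra k Γ(baseChange K f, U') := (φ.comp (toSection f U)).toAlgebra
  have : IsScalarTower k Γ(X, U) Γ(baseChange K f, U') := .of_algebraMap_eq fun _ => rfl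
  have : IsScalarTower k K Γ(baseChange K f, U') :=
    .of_algebraMap_eq fun a => ConcreteCategory.congr_hom isPushout.w a
  have : Algebra.IsPushout k Γ(X, U) K Γ(baseChange K f, U') :=
    CommRingCat.isPushout_iff_isPushout.mp isPushout
  let := (germField f hη).toAlgebra
  have := isFractionRing_germField f hη hU
  let := (germField (baseChangeHom K f) hη').toAlgebra
  have := isFractionRing_germField (baseChangeHom K f) hη' (hU.preimage _)
  let : Algebra Γ(X, U) (FunctionField (baseChangeHom K f)) :=
    ((algebraMap (FunctionField f) (FunctionField (baseChangeHom K f))).comp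
      (germField f hη)).toAlgebra
  have : IsScalarTower Γ(X, U) (FunctionField f) (FunctionField (baseChangeHom K f)) :=
    .of_algebraMap_eq fun _ => rfl
  have : IsScalarTower Γ(X, U) Γ(baseChange K f, U') (FunctionField (baseChangeHom K f)) :=
    .of_algebraMap_eq fun a => fieldMap_germField (baseChangeHom K f) (fst_generic K f) le_rfl
      hη' hη a
  have : IsScalarTower K Γ(baseChange K f, U') (FunctionField (baseChangeHom K f)) :=
    .of_algebraMap_eq fun a => (germField_toSection (baseChangeHom K f) hη' a).symm
  exact .of_isPushout k K Γ(X, U) Γ(baseChange K f, U') _ _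

end BaseChange

lemma fieldMap_comp {k₁ k₂ k₃ : Type u} [Field k₁] [Field k₂] [Field k₃] {X Y Z : Scheme.{u}}
    {f : X ⟶ Spec (.of k₁)} {g : Y ⟶ Spec (.of k₂)} {h : Z ⟶ Spec (.of k₃)} [IsCurve f]
    [IsCurve g] [IsCurve h] {π : X ⟶ Y} {ρ : Y ⟶ Z} {σ : X ⟶ Z} (hπ : π (generic f) = generic g)
    (hρ : ρ (generic g) = generic h) (hσ : σ (generic f) = generic h) (comp_eq : π ≫ ρ = σ)
    (a : FunctionField h) : fieldMap hπ (fieldMap hρ a) = fieldMap hσ a := by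
  obtain ⟨U, hU, s, rfl⟩ := Z.presheaf.exists_germ_eq a
  have hρU : generic g ∈ ρ ⁻¹ᵁ U := by
    change ρ (generic g) ∈ U
    rwa [hρ]
  have hπU : generic f ∈ π ⁻¹ᵁ ρ ⁻¹ᵁ U := by
    change π (generic f) ∈ ρ ⁻¹ᵁ U
    rwa [hπ]
  have hle : π ⁻¹ᵁ ρ ⁻¹ᵁ U ≤ σ ⁻¹ᵁ U := by
    rw [← comp_eq]
    exact le_rfl
  refine (congrArg (fieldMap hπ) (fieldMap_germField g hρ le_rfl hρU hU s)).trans ?_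
  refine (fieldMap_germField f hπ le_rfl hπU hρU _).trans ?_
  refine Eq.trans ?_ (fieldMap_germField f hσ hle hπU hU s).symm
  refine congrArg (germField f hπU) ?_
  subst comp_eq
  exact ConcreteCategory.congr_hom
    (Scheme.Hom.appLE_comp_appLE π ρ U (ρ ⁻¹ᵁ U) (π ⁻¹ᵁ ρ ⁻¹ᵁ U) le_rfl le_rfl) s

section BaseChange

variable {k : Type u} [Field k] (K : Type u) [Field K] [Algebra k K] {X Y : Scheme.{u}}
  {f : X ⟶ Spec (.of k)} {g : Y ⟶ Spec (.of k)} {π : X ⟶ Y} (hπ : π ≫ g = f)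

lemma baseChangeMap_fst : baseChangeMap K f g π hπ ≫ pullback.fst g (specMap k K) =
    pullback.fst f (specMap k K) ≫ π := pullback.lift_fst _ _ _

lemma baseChangeMap_baseChangeHom :
    baseChangeMap K f g π hπ ≫ baseChangeHom K g = baseChangeHom K f := pullback.lift_snd _ _ _

variable (hc : IsNonconstant π)

include hc in
lemma IsNonconstant.baseChange : IsNonconstant (baseChangeMap K f g π hπ) := by
  rintro ⟨y, hy⟩
  refine hc ⟨pullback.fst g (specMap k K) y, fun x => ?_⟩
  obtain ⟨x, rfl⟩ := (pullback.fst f (specMap k K)).surjective x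
  rw [← hy x, ← Scheme.Hom.comp_apply, ← Scheme.Hom.comp_apply, baseChangeMap_fst]

variable [IsCurve f] [IsCurve g] [IrreducibleSpace X] [IrreducibleSpace (baseChange K f)]
  (hs : IsSeparableMap π)

include hc hs in
theorem degree_baseChangeMap_and_isSeparableMap :
    degree (baseChangeMap K f g π hπ) = degree π ∧
      IsSeparableMap (baseChangeMap K f g π hπ) := by
  have hg := map_generic f g π hc
  have hg' := map_generic (baseChangeHom K f) (baseChangeHom K g) _ (hc.baseChange K hπ)
  let := (fieldMap hg).toAlgebra
  let := (fieldMap hg').toAlgebra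
  have := isScalarTower_fieldMap hg' (baseChangeMap_baseChangeHom K hπ)
  let : Algebra (FunctionField g) (FunctionField (baseChangeHom K f)) :=
    ((algebraMap (FunctionField f) (FunctionField (baseChangeHom K f))).comp
      (fieldMap hg)).toAlgebra
  have : IsScalarTower (FunctionField g) (FunctionField f) (FunctionField (baseChangeHom K f)) :=
    .of_algebraMap_eq fun _ => rfl
  have map_generic_fst_comp :
      (pullback.fst f (specMap k K) ≫ π) (generic (baseChangeHom K f)) = generic g := by
    rw [Scheme.Hom.comp_apply, fst_generic, hg]
  have : IsScalarTower (FunctionField g) (FunctionField (baseChangeHom K g))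
      (FunctionField (baseChangeHom K f)) := .of_algebraMap_eq fun a =>
    (fieldMap_comp (fst_generic K f) hg map_generic_fst_comp rfl a).trans
      (fieldMap_comp hg' (fst_generic K g) map_generic_fst_comp (baseChangeMap_fst K hπ) a).symm
  have := (isSeparableMap_iff hg).mp hs
  rw [degree_eq hg, degree_eq hg', isSeparableMap_iff hg']
  exact ⟨(isFieldBaseChange_functionField K f).finrank_eq (isFieldBaseChange_functionField K g),
    (isFieldBaseChange_functionField K f).isSeparable (E := FunctionField g)⟩

end BaseChange

/-! ### Points over an algebraically closed field -/

section Points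

variable {k : Type u} [Field k] {K : Type u} [Field K] [Algebra k K]
  {X Y : Scheme.{u}} {f : X ⟶ Spec (.of k)} {g : Y ⟶ Spec (.of k)}

/-- The `K`-point of `X_K` over `K` given by a `K`-point of `X`. -/
def Pt.toBaseChange (z : Pt K f) : Spec (.of K) ⟶ baseChange K f :=
  pullback.lift (f := f) (g := specMap k K) z.1 (𝟙 _) (by rw [z.2, Category.id_comp])

lemma Pt.toBaseChange_fst (z : Pt K f) : z.toBaseChange ≫ pullback.fst f (specMap k K) = z.1 :=
  pullback.lift_fst _ _ _

lemma Pt.toBaseChange_snd (z : Pt K f) : z.toBaseChange ≫ baseChangeHom K f = 𝟙 _ :=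
  pullback.lift_snd _ _ _

lemma Pt.toBaseChange_map {π : X ⟶ Y} (hπ : π ≫ g = f) (z : Pt K f) :
    (z.map π hπ).toBaseChange = z.toBaseChange ≫ baseChangeMap K f g π hπ := by
  apply pullback.hom_ext
  · rw [Pt.toBaseChange_fst, Category.assoc, baseChangeMap_fst, ← Category.assoc,
      Pt.toBaseChange_fst]
    rfl
  · refine (Pt.toBaseChange_snd _).trans ?_
    rw [Category.assoc, baseChangeMap_baseChangeHom]
    exact z.toBaseChange_snd.symm

lemma Pt.geom_map {π : X ⟶ Y} (hπ : π ≫ g = f) (z : Pt K f) :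
    (z.map π hπ).geom = baseChangeMap K f g π hπ z.geom :=
  congrArg (fun p : Spec (.of K) ⟶ baseChange K g => p (IsLocalRing.closedPoint K))
    (z.toBaseChange_map hπ)

variable [IsAlgClosed K] [LocallyOfFiniteType f]

variable (K f) in
/-- The `K`-points of `X` are the closed points of `X_K`, if `K` is algebraically closed. -/
def ptEquiv : Pt K f ≃ closedPoints (baseChange K f) :=
  Equiv.trans
    { toFun z := ⟨z.toBaseChange, z.toBaseChange_snd⟩
      invFun p := ⟨p.1 ≫ pullback.fst f (specMap k K), by
        rw [Category.assoc, pullback.condition, reassoc_of% p.2]⟩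
      left_inv z := Subtype.ext z.toBaseChange_fst
      right_inv p := Subtype.ext (pullback.hom_ext (Pt.toBaseChange_fst _)
        ((Pt.toBaseChange_snd _).trans p.2.symm)) }
    (pointEquivClosedPoint (baseChangeHom K f))

lemma coe_ptEquiv (z : Pt K f) : (ptEquiv K f z : baseChange K f) = z.geom := rfl

end Points

section PointsOfCurves

variable {k : Type u} [Field k] {K : Type u} [Field K] [Algebra k K] [IsAlgClosed K]
  {X Y : Scheme.{u}} {f : X ⟶ Spec (.of k)} {g : Y ⟶ Spec (.of k)} [hf : IsCurve f]
  [hg : IsCurve g] [IrreducibleSpace X] {π : X ⟶ Y} (hπ : π ≫ g = f) (hc : IsNonconstant π)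
  (hs : IsSeparableMap π)

include hc hs

lemma Pt.hasFibreSum_ramIdx : HasFibreSum (fun z : Pt K f => z.map π hπ)
    (fun z => z.ramIdx π hπ) (degree π) := by
  have := IsCurve.irreducibleSpace (baseChangeHom K f)
  have := hf.isProper
  have := hg.isProper
  obtain ⟨hdeg, hsep⟩ := degree_baseChangeMap_and_isSeparableMap K hπ hc hs
  let t (x : closedPoints (baseChange K f)) : closedPoints (baseChange K g) :=
    ptEquiv K g (((ptEquiv K f).symm x).map π hπ)
  have ht (x : closedPoints (baseChange K f)) :
      (t x : baseChange K g) = baseChangeMap K f g π hπ x := by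
    obtain ⟨z, rfl⟩ := (ptEquiv K f).surjective x
    change (ptEquiv K g (((ptEquiv K f).symm (ptEquiv K f z)).map π hπ) : baseChange K g) = _
    rw [Equiv.symm_apply_apply, coe_ptEquiv, coe_ptEquiv, Pt.geom_map]
  rw [← hdeg]
  refine (CurveCorr.hasFibreSum_ramIdx (baseChangeMap_baseChangeHom K hπ)
    (hc.baseChange K hπ) hsep ht).of_equiv (ptEquiv K f) (ptEquiv K g) (fun z => ?_) fun z => rfl
  exact congrArg (fun z : Pt K f => ptEquiv K g (z.map π hπ)) ((ptEquiv K f).symm_apply_apply z)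

lemma Pt.sum_ramIdx_sub_one_le (Z : Finset (Pt K f)) :
    ∑ z ∈ Z, ((z.ramIdx π hπ : ℤ) - 1) ≤
      2 * (genus K f : ℤ) - 2 - degree π * (2 * (genus K g : ℤ) - 2) := by
  have := IsCurve.irreducibleSpace (baseChangeHom K f)
  have := IsCurve.irreducibleSpace (baseChangeHom K g)
  have := hf.isProper
  obtain ⟨hdeg, hsep⟩ := degree_baseChangeMap_and_isSeparableMap K hπ hc hs
  refine le_of_eq_of_le ?_ ((CurveCorr.sum_ramIdx_sub_one_le (baseChangeMap_baseChangeHom K hπ)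
    (hc.baseChange K hπ) hsep (Z.map (ptEquiv K f).toEmbedding)).trans_eq ?_)
  · rw [Finset.sum_map]
    rfl
  · rw [hdeg]
    rfl

lemma Pt.ramIdx_pos (z : Pt K f) : 0 < z.ramIdx π hπ := by
  have := IsCurve.irreducibleSpace (baseChangeHom K f)
  have := hf.isProper
  obtain ⟨-, hsep⟩ := degree_baseChangeMap_and_isSeparableMap K hπ hc hs
  exact CurveCorr.ramIdx_pos (baseChangeMap_baseChangeHom K hπ) (hc.baseChange K hπ) hsep
    (ptEquiv K f z)

end PointsOfCurves

section OpenImmersion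

lemma ramIdx_comp {X Y Z : Scheme.{u}} (i : X ⟶ Y) [IsOpenImmersion i] (π : Y ⟶ Z) (x : X) :
    ramIdx (i ≫ π) x = ramIdx π (i x) := by
  let e : Y.presheaf.stalk (i x) ≃+* X.presheaf.stalk x :=
    (asIso (i.stalkMap x)).commRingCatIsoToRingEquiv
  have stalkMap_comp_apply : ∀ a : Z.presheaf.stalk (π (i x)),
      (i ≫ π).stalkMap x a = e (π.stalkMap (i x) a) :=
    fun a => ConcreteCategory.congr_hom (Scheme.Hom.stalkMap_comp i π x) a
  unfold ramIdx Ideal.ramificationIdx'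
  congr 1
  ext n
  rw [Set.mem_ofPred_eq, Set.mem_ofPred_eq, Ideal.map_le_iff_le_comap, Ideal.map_le_iff_le_comap,
    ← IsLocalRing.map_ringEquiv_maximalIdeal e, ← Ideal.map_pow]
  refine forall₂_congr fun a _ => ?_
  exact (iff_of_eq (congrArg (· ∈ _) (stalkMap_comp_apply a))).trans Ideal.apply_mem_of_equiv_iff

variable {k : Type u} [Field k] {K : Type u} [Field K] [Algebra k K] {X Y Z : Scheme.{u}}
  {f : X ⟶ Spec (.of k)} {g : Y ⟶ Spec (.of k)} {h : Z ⟶ Spec (.of k)}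

instance (i : X ⟶ Y) [IsOpenImmersion i] (hi : i ≫ g = f) :
    IsOpenImmersion (baseChangeMap K f g i hi) := by
  have eq_map : baseChangeMap K f g i hi =
      pullback.map f (specMap k K) g (specMap k K) i (𝟙 _) (𝟙 _)
        (by rw [Category.comp_id, hi]) (by rw [Category.comp_id, Category.id_comp]) := by
    apply pullback.hom_ext
    · rw [baseChangeMap_fst, pullback.lift_fst]
    · exact (pullback.lift_snd _ _ _).trans
        ((pullback.lift_snd _ _ _).trans (Category.comp_id _)).symm
  rw [eq_map]
  infer_instance

lemma baseChangeMap_comp (i : X ⟶ Y) (hi : i ≫ g = f) (π : Y ⟶ Z) (hπ : π ≫ h = g) :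
    baseChangeMap K f g i hi ≫ baseChangeMap K g h π hπ =
      baseChangeMap K f h (i ≫ π) (by rw [Category.assoc, hπ, hi]) := by
  apply pullback.hom_ext
  · rw [Category.assoc, baseChangeMap_fst, baseChangeMap_fst, ← Category.assoc, baseChangeMap_fst,
      Category.assoc]
  · rw [Category.assoc]
    refine Eq.trans ?_ (baseChangeMap_baseChangeHom K _).symm
    refine (congrArg _ (baseChangeMap_baseChangeHom K hπ)).trans ?_
    exact baseChangeMap_baseChangeHom K hi

lemma Pt.ramIdx_map (i : X ⟶ Y) [IsOpenImmersion i] (hi : i ≫ g = f) (π : Y ⟶ Z)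
    (hπ : π ≫ h = g) (z : Pt K f) : (z.map i hi).ramIdx π hπ =
      z.ramIdx (i ≫ π) (by rw [Category.assoc, hπ, hi]) := by
  rw [Pt.ramIdx, Pt.ramIdx, ← baseChangeMap_comp i hi π hπ, ramIdx_comp, Pt.geom_map]

end OpenImmersion

section Components

variable (D : Scheme.{u}) [IsNoetherian D]

instance : Finite (_root_.ConnectedComponents D) :=
  have := ConnectedComponents.discreteTopology_iff.mpr (isOpen_connectedComponent_of_noetherian D)
  finite_of_compact_of_discrete

instance : Fintype (_root_.ConnectedComponents D) := Fintype.ofFinite _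

variable {D} {k : Type u} [Field k] {K : Type u} [Field K] [Algebra k K] (str : D ⟶ Spec (.of k))

lemma mk_component_map {c : _root_.ConnectedComponents D} (z : Pt K ((component D c).ι ≫ str)) :
    _root_.ConnectedComponents.mk ((z.map (component D c).ι rfl).1 (IsLocalRing.closedPoint K)) =
      c :=
  (z.1 (IsLocalRing.closedPoint K)).2

variable (K) in
/-- The `K`-points of a noetherian scheme are those of its connected components. -/
def componentPtEquiv :
    (Σ c : _root_.ConnectedComponents D, Pt K ((component D c).ι ≫ str)) ≃ Pt K str :=
  Equiv.ofBijective (fun z => z.2.map (component D z.1).ι rfl) <| by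
    constructor
    · rintro ⟨c, z⟩ ⟨c', z'⟩ hzz'
      obtain rfl : c = c' := by
        rw [← mk_component_map str z, ← mk_component_map str z']
        exact congrArg (fun p : Pt K str =>
          _root_.ConnectedComponents.mk (p.1 (IsLocalRing.closedPoint K))) hzz'
      congr 1
      refine Subtype.ext ((cancel_mono (component D c).ι).mp ?_)
      exact congrArg Subtype.val hzz'
    · intro z
      let c := _root_.ConnectedComponents.mk (z.1 (IsLocalRing.closedPoint K))
      have range_subset : Set.range z.1 ⊆ Set.range (component D c).ι := by
        rintro _ ⟨x, rfl⟩
        rw [Scheme.Opens.range_ι, Subsingleton.elim x (IsLocalRing.closedPoint K)]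
        rfl
      refine ⟨⟨c, IsOpenImmersion.lift (component D c).ι z.1 range_subset, ?_⟩, Subtype.ext ?_⟩
      · rw [IsOpenImmersion.lift_fac_assoc, z.2]
      · exact IsOpenImmersion.lift_fac _ _ range_subset

lemma componentPtEquiv_apply
    (z : Σ c : _root_.ConnectedComponents D, Pt K ((component D c).ι ≫ str)) :
    componentPtEquiv K str z = z.2.map (component D z.1).ι rfl := rfl

variable [hD : ∀ c, IsCurve ((component D c).ι ≫ str)] [∀ c, IrreducibleSpace (component D c)]
  [IsAlgClosed K] {Y : Scheme.{u}}
  {g : Y ⟶ Spec (.of k)} [IsCurve g] {str} {π : D ⟶ Y} (hπ : π ≫ g = str)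
  (hc : ∀ c, IsNonconstant ((component D c).ι ≫ π))
  (hs : ∀ c, IsSeparableMap ((component D c).ι ≫ π))

include hc hs

lemma hasFibreSum_ramIdx_of_components : HasFibreSum (fun z : Pt K str => z.map π hπ)
    (fun z => z.ramIdx π hπ) (∑ c, degree ((component D c).ι ≫ π)) := by
  have component_comp (c) : ((component D c).ι ≫ π) ≫ g = (component D c).ι ≫ str := by
    rw [Category.assoc, hπ]
  have hfibre := HasFibreSum.sigma fun c =>
    Pt.hasFibreSum_ramIdx (K := K) (component_comp c) (hc c) (hs c)
  refine hfibre.of_equiv (componentPtEquiv K str).symm (Equiv.refl _) (fun z => ?_) fun z => ?_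
  all_goals obtain ⟨⟨c, z⟩, rfl⟩ := (componentPtEquiv K str).surjective z
  all_goals rw [Equiv.symm_apply_apply]
  · exact Subtype.ext (Category.assoc z.1 (component D c).ι π).symm
  · exact (z.ramIdx_map _ rfl π hπ).symm

lemma sum_ramIdx_sub_one_le_sum_genus (Z : Finset (Pt K str)) :
    ∑ z ∈ Z, ((z.ramIdx π hπ : ℤ) - 1) ≤
      2 * ((∑ c, genus K ((component D c).ι ≫ str) : ℕ) : ℤ) -
        2 * Fintype.card (_root_.ConnectedComponents D) -
        (∑ c, degree ((component D c).ι ≫ π) : ℕ) * (2 * (genus K g : ℤ) - 2) := by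
  classical
  have component_comp (c) : ((component D c).ι ≫ π) ≫ g = (component D c).ι ≫ str := by
    rw [Category.assoc, hπ]
  let t (c) : Finset (Pt K ((component D c).ι ≫ str)) :=
    Z.preimage (fun z => componentPtEquiv K str ⟨c, z⟩)
      ((componentPtEquiv K str).injective.comp sigma_mk_injective).injOn
  have hZ : Z = (Finset.univ.sigma t).map (componentPtEquiv K str).toEmbedding := by
    ext z
    obtain ⟨z, rfl⟩ := (componentPtEquiv K str).surjective z
    rw [Finset.mem_map_equiv, Equiv.symm_apply_apply, Finset.mem_sigma, Finset.mem_preimage]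
    exact (and_iff_right (Finset.mem_univ _)).symm
  have sum_le := Finset.sum_le_sum fun c (_ : c ∈ Finset.univ) =>
    Pt.sum_ramIdx_sub_one_le (K := K) (component_comp c) (hc c) (hs c) (t c)
  rw [Finset.sum_sub_distrib, Finset.sum_sub_distrib, ← Finset.mul_sum, Finset.sum_const,
    ← Finset.sum_mul, Finset.card_univ, nsmul_eq_mul] at sum_le
  push_cast
  rw [hZ, Finset.sum_map, Finset.sum_sigma]
  refine le_of_eq_of_le (Finset.sum_congr rfl fun c _ => Finset.sum_congr rfl fun z _ => ?_)
    (sum_le.trans_eq (by ring))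
  rw [← z.ramIdx_map (component D c).ι rfl π hπ]
  rfl

lemma ramIdx_pos_of_components (z : Pt K str) : 0 < z.ramIdx π hπ := by
  obtain ⟨⟨c, z⟩, rfl⟩ := (componentPtEquiv K str).surjective z
  rw [componentPtEquiv_apply, Pt.ramIdx_map]
  exact Pt.ramIdx_pos _ (hc c) (hs c) z

end Components

/-! ### Finite backward-complete sets -/

namespace SelfCorrespondence

variable {k : Type u} [Field k] {C : Scheme.{u}} {f : C ⟶ Spec (.of k)}

/-- The transpose of a self-correspondence. -/
def swap (T : SelfCorrespondence f) : SelfCorrespondence f where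
  D := T.D
  str := T.str
  isNoetherian := T.isNoetherian
  isReduced := T.isReduced
  isCurve := T.isCurve
  π₁ := T.π₂
  π₂ := T.π₁
  π₁_comp := T.π₂_comp
  π₂_comp := T.π₁_comp
  nonconstant₁ := T.nonconstant₂
  nonconstant₂ := T.nonconstant₁
  separable₁ := T.separable₂
  separable₂ := T.separable₁

variable (T : SelfCorrespondence f) {K : Type u} [Field K] [Algebra k K]

lemma genusD_eq_sum :
    T.genusD K = ∑ c : _root_.ConnectedComponents T.D, genus K ((component T.D c).ι ≫ T.str) :=
  finsum_eq_sum_of_fintype _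

variable [IsAlgClosed K] [hf : IsCurve f]

lemma hasFibreSum_target : HasFibreSum (T.target (K := K)) T.e₂ T.d₂ := by
  have := fun c => (T.isCurve c).irreducibleSpace
  rw [d₂, finsum_eq_sum_of_fintype]
  exact hasFibreSum_ramIdx_of_components T.π₂_comp T.nonconstant₂ T.separable₂

lemma hasFibreSum_source : HasFibreSum (T.source (K := K)) T.e₁ T.d₁ :=
  T.swap.hasFibreSum_target

lemma e₂_pos (z : Pt K T.str) : 0 < T.e₂ z :=
  have := fun c => (T.isCurve c).irreducibleSpace
  ramIdx_pos_of_components T.π₂_comp T.nonconstant₂ T.separable₂ z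

lemma e₁_pos (z : Pt K T.str) : 0 < T.e₁ z := T.swap.e₂_pos z

lemma sum_e₂_sub_one_le (hd : 0 < T.d₂) (Z : Finset (Pt K T.str)) :
    ∑ z ∈ Z, ((T.e₂ z : ℤ) - 1) ≤ 2 * ((T.genusD K : ℤ) - T.d₂ * genus K f + T.d₂ - 1) := by
  have := fun c => (T.isCurve c).irreducibleSpace
  have riemannHurwitz := sum_ramIdx_sub_one_le_sum_genus T.π₂_comp T.nonconstant₂ T.separable₂ Z
  have d₂_eq_sum : T.d₂ = ∑ c, degree ((component T.D c).ι ≫ T.π₂) := finsum_eq_sum_of_fintype _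
  rw [← genusD_eq_sum, ← d₂_eq_sum] at riemannHurwitz
  have nonempty : Nonempty (_root_.ConnectedComponents T.D) := by
    by_contra hempty
    rw [not_nonempty_iff] at hempty
    rw [d₂_eq_sum, Finset.univ_eq_empty, Finset.sum_empty] at hd
    exact hd.false
  have one_le_card : (1 : ℤ) ≤ Fintype.card (_root_.ConnectedComponents T.D) := by
    exact_mod_cast Fintype.card_pos
  refine riemannHurwitz.trans ?_
  linarith

variable {T} in
omit [IsAlgClosed K] hf in
lemma Etale.equiramified {S : Set (Pt K f)} (h : T.Etale S) : T.Equiramified S :=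
  fun z hsource htarget => (h z hsource htarget).1.trans (h z hsource htarget).2.symm

variable {S : Set (Pt K f)} (hS : S.Finite) (hb : T.BackwardComplete S)

include hS hb

lemma ncard_le_of_backwardComplete (hd : T.d₁ < T.d₂) : (S.ncard : ℝ) ≤
    2 * (((T.genusD K : ℝ) - T.d₂ * genus K f + T.d₂ - 1) / (T.d₂ - T.d₁)) := by
  have hint := mul_card_sub_mul_card_le T.hasFibreSum_source T.hasFibreSum_target T.e₁_pos
    (fun z hz => hS.mem_toFinset.mpr (hb (hS.mem_toFinset.mp hz)))
    (T.sum_e₂_sub_one_le (Nat.zero_lt_of_lt hd))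
  have hreal : ((T.d₂ : ℝ) - T.d₁) * hS.toFinset.card ≤
      2 * ((T.genusD K : ℝ) - T.d₂ * genus K f + T.d₂ - 1) := by exact_mod_cast hint
  have sub_pos : (0 : ℝ) < T.d₂ - T.d₁ := sub_pos.mpr (by exact_mod_cast hd)
  rw [Set.ncard_eq_toFinset_card S hS, ← mul_div_assoc, le_div_iff₀ sub_pos]
  linarith

lemma eq_empty_of_ramificationDecreasing (hd : T.d₁ < T.d₂) (hr : T.RamificationDecreasing S) :
    S = ∅ := by
  have mul_le_mul := mul_card_le_mul_card T.hasFibreSum_source T.hasFibreSum_target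
    (fun z hz => hS.mem_toFinset.mpr (hb (hS.mem_toFinset.mp hz)))
    fun z hz => hr z (hb (hS.mem_toFinset.mp hz)) (hS.mem_toFinset.mp hz)
  have card_eq_zero : hS.toFinset.card = 0 := by
    by_contra hne
    exact hd.not_ge (Nat.le_of_mul_le_mul_right mul_le_mul (Nat.pos_of_ne_zero hne))
  rwa [Finset.card_eq_zero, Set.Finite.toFinset_eq_empty] at card_eq_zero

lemma complete_and_equiramified (hd : T.d₁ ≤ T.d₂) (hr : T.RamificationDecreasing S) :
    T.Complete S ∧ T.Equiramified S := by
  obtain ⟨forward, weight_eq⟩ := forall_mem_and_forall_eq_of_decreasing T.hasFibreSum_source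
    T.hasFibreSum_target T.e₁_pos
    (fun z hz => hS.mem_toFinset.mpr (hb (hS.mem_toFinset.mp hz))) hd
    fun z hz => hr z (hb (hS.mem_toFinset.mp hz)) (hS.mem_toFinset.mp hz)
  simp only [Set.Finite.mem_toFinset] at forward weight_eq
  exact ⟨⟨forward, hb⟩, fun z _ hz => weight_eq z hz⟩

omit hb in
lemma d₁_eq_d₂ (hne : S.Nonempty) (hc : T.Complete S) (he : T.Equiramified S) : T.d₁ = T.d₂ := by
  by_contra hd
  obtain hd | hd := lt_or_gt_of_ne hd
  · exact hne.ne_empty (T.eq_empty_of_ramificationDecreasing hS hc.2 hd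
      fun z h₁ h₂ => (he z h₁ h₂).ge)
  · exact hne.ne_empty (T.swap.eq_empty_of_ramificationDecreasing hS hc.1 hd
      fun z h₁ h₂ => (he z h₂ h₁).le)

omit hb in
lemma ncard_le_of_complete (hc : T.Complete S) (hd : T.d₁ ≠ T.d₂) : (S.ncard : ℝ) ≤
    2 * (((T.genusD K : ℝ) - (max T.d₁ T.d₂ : ℕ) * genus K f + (max T.d₁ T.d₂ : ℕ) - 1) /
      |(T.d₂ : ℝ) - T.d₁|) := by
  obtain hd | hd := lt_or_gt_of_ne hd
  · have hpos : (0 : ℝ) < T.d₂ - T.d₁ := sub_pos.mpr (by exact_mod_cast hd)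
    rw [max_eq_right hd.le, abs_of_pos hpos]
    exact T.ncard_le_of_backwardComplete hS hc.2 hd
  · have hpos : (0 : ℝ) < T.d₁ - T.d₂ := sub_pos.mpr (by exact_mod_cast hd)
    rw [max_eq_left hd.le, abs_sub_comm, abs_of_pos hpos]
    exact T.swap.ncard_le_of_backwardComplete hS hc.1 hd

end SelfCorrespondence

end CurveCorr

end

theorem mainTheorem5_general {k : Type u} [Field k] (K : Type u) [Field K] [Algebra k K]
    [IsAlgClosed K] {C : AlgebraicGeometry.Scheme.{u}}
    (f : C ⟶ AlgebraicGeometry.Spec (.of k)) [CurveCorr.IsCurve f]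
    (T : CurveCorr.SelfCorrespondence f) :
    (T.d₁ < T.d₂ → ∀ S : Set (CurveCorr.Pt K f), S.Finite → T.BackwardComplete S →
      (S.ncard : ℝ) ≤
          2 * (((T.genusD K : ℝ) - T.d₂ * CurveCorr.genus K f + T.d₂ - 1) / (T.d₂ - T.d₁)) ∧
        (T.RamificationDecreasing S → S = ∅)) ∧
    (T.d₁ ≤ T.d₂ → ∀ S : Set (CurveCorr.Pt K f), S.Finite → T.BackwardComplete S →
      T.RamificationDecreasing S → T.Complete S ∧ T.Equiramified S) ∧
    ((∃ S : Set (CurveCorr.Pt K f), S.Finite ∧ S.Nonempty ∧ T.Complete S ∧ T.Equiramified S) →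
      T.d₁ = T.d₂) ∧
    (T.d₁ ≠ T.d₂ → ∀ S : Set (CurveCorr.Pt K f), S.Finite → T.Complete S →
      (S.Nonempty → ¬ T.Equiramified S ∧ ¬ T.Etale S) ∧
        (S.ncard : ℝ) ≤
          2 * (((T.genusD K : ℝ) - (max T.d₁ T.d₂ : ℕ) * CurveCorr.genus K f
            + (max T.d₁ T.d₂ : ℕ) - 1) / |(T.d₂ : ℝ) - T.d₁|)) := by
  refine ⟨fun hd S hS hb => ⟨T.ncard_le_of_backwardComplete hS hb hd,
      T.eq_empty_of_ramificationDecreasing hS hb hd⟩,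
    fun hd S hS hb hr => T.complete_and_equiramified hS hb hd hr, ?_, ?_⟩
  · rintro ⟨S, hS, hne, hc, he⟩
    exact T.d₁_eq_d₂ hS hne hc he
  · intro hd S hS hc
    have not_equiramified : S.Nonempty → ¬ T.Equiramified S :=
      fun hne he => hd (T.d₁_eq_d₂ hS hne hc he)
    exact ⟨fun hne => ⟨not_equiramified hne,
      fun etale => not_equiramified hne etale.equiramified⟩, T.ncard_le_of_complete hS hc hd⟩

theorem mainTheorem5 {k : Type u} [Field k] (K : Type u) [Field K] [Algebra k K]
    [IsAlgClosure k K] {C : AlgebraicGeometry.Scheme.{u}}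
    (f : C ⟶ AlgebraicGeometry.Spec (.of k)) [CurveCorr.IsCurve f]
    (T : CurveCorr.SelfCorrespondence f) :
    (T.d₁ < T.d₂ → ∀ S : Set (CurveCorr.Pt K f), S.Finite → T.BackwardComplete S →
      (S.ncard : ℝ) ≤
          2 * (((T.genusD K : ℝ) - T.d₂ * CurveCorr.genus K f + T.d₂ - 1) / (T.d₂ - T.d₁)) ∧
        (T.RamificationDecreasing S → S = ∅)) ∧
    (T.d₁ ≤ T.d₂ → ∀ S : Set (CurveCorr.Pt K f), S.Finite → T.BackwardComplete S →
      T.RamificationDecreasing S → T.Complete S ∧ T.Equiramified S) ∧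
    ((∃ S : Set (CurveCorr.Pt K f), S.Finite ∧ S.Nonempty ∧ T.Complete S ∧ T.Equiramified S) →
      T.d₁ = T.d₂) ∧
    (T.d₁ ≠ T.d₂ → ∀ S : Set (CurveCorr.Pt K f), S.Finite → T.Complete S →
      (S.Nonempty → ¬ T.Equiramified S ∧ ¬ T.Etale S) ∧
        (S.ncard : ℝ) ≤
          2 * (((T.genusD K : ℝ) - (max T.d₁ T.d₂ : ℕ) * CurveCorr.genus K f
            + (max T.d₁ T.d₂ : ℕ) - 1) / |(T.d₂ : ℝ) - T.d₁|)) := by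
  have := IsAlgClosure.isAlgClosed k (K := K)
  exact mainTheorem5_general K f T
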